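/- Let $d\ge 2$, let $B_1\subset\mathbb{R}^d$ be the open unit ball and let $\partial B_1$ be the unit sphere, equipped with the $(d-1)$-dimensional Hausdorff measure $\mathcal{H}^{d-1}$. For $u\in H^1(B_1)$ let $$W(u)=\int_{B_1}|\nabla u|^2\,dx-2\int_{\partial B_1}u^2\,d\mathcal{H}^{d-1}+\int_{B_1}\max\{u(x),0\}\,dx ,$$ where the values of $u$ on $\partial B_1$ are understood in the sense of traces. Let $$\mathcal{K}=\Big\{Q_A:\mathbb{R}^d\to\mathbb{R}\ :\ Q_A(x)=x\cdot Ax,\ A\in\mathbb{R}^{d\times d}\ \text{symmetric and non-negative with}\ \operatorname{tr}A=\tfrac14\Big\}.$$ The energy $W$ is constant on $\mathcal{K}$; denote by $\Theta$ its value on $\mathcal{K}$, that is $\Theta=W(Q_A)=\frac{|B_1|}{8(d+2)}$ for $Q_A\in\mathcal{K}$. Set $\gamma=0$ if $d=2$ and $\gamma=\frac{d-1}{d+3}$ if $d\ge3$. Then there are constants $\delta>0$ and $\varepsilon>0$, depending only on $d$, such that the following holds. Let $c\in H^1(\partial B_1)$ be non-negative, with $2$-homogeneous extension $z(x)=|x|^2c(x/|x|)$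 to $B_1$, and suppose that $$\operatorname{dist}_{L^2(\partial B_1)}(c,\mathcal{K})\le\delta\qquad\text{and}\qquad 0\le W(z)-\Theta\le 1 .$$ Then there is a non-negative function $h\in H^1(B_1)$ with $h=c$ on $\partial B_1$ (in the sense of traces) such that $$W(h)\le W(z)-\varepsilon\,\big(W(z)-\Theta\big)^{1+\gamma}.$$ -/

import Mathlib

open MeasureTheory Metric

noncomputable section

namespace Obstacle

/-- Euclidean space `ℝ^d`. -/
abbrev E (d : ℕ) : Type := EuclideanSpace ℝ (Fin d)

/-- The unit sphere `∂B₁` of `ℝ^d`. -/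
abbrev S (d : ℕ) : Type := sphere (0 : E d) 1

/-- Lebesgue measure on the unit ball `B₁`. -/
def ballMeasure (d : ℕ) : Measure (E d) := volume.restrict (ball (0 : E d) 1)

/-- Surface measure on `∂B₁`, i.e. the `(d-1)`-dimensional Hausdorff measure with its usual
normalization (total mass `d * ω_d`). -/
def surfaceMeasure (d : ℕ) : Measure (S d) := (volume : Measure (E d)).toSphere

/-- Divergence of a vector field on `ℝ^d`. -/
def divergence {d : ℕ} (X : E d → E d) (x : E d) : ℝ :=
  ∑ i : Fin d, (fderiv ℝ X x (EuclideanSpace.single i 1)) i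

/-- Tangential divergence along the sphere, at a point `θ ∈ ∂B₁`, of a vector field on `ℝ^d`:
the trace of `DX(θ)` over the tangent space `θ^⊥`. -/
def sphereDivergence {d : ℕ} (X : E d → E d) (θ : S d) : ℝ :=
  divergence X θ - inner ℝ (fderiv ℝ X θ (θ : E d)) (θ : E d)

/-- `c ∈ H¹(∂B₁)` with weak tangential gradient `g ∈ L²(∂B₁; ℝ^d)`, tested against smooth
vector fields tangent to the sphere. -/
structure HasSphereWeakGradient {d : ℕ} (c : S d → ℝ) (g : S d → E d) : Prop where
  memLp : MemLp c 2 (surfaceMeasure d)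
  memLp_grad : MemLp g 2 (surfaceMeasure d)
  tangent : ∀ᵐ θ ∂(surfaceMeasure d), inner ℝ (g θ) (θ : E d) = 0
  integral_eq : ∀ X : E d → E d, ContDiff ℝ (⊤ : ℕ∞) X →
    (∀ θ : S d, inner ℝ (X θ) (θ : E d) = 0) →
    ∫ θ, c θ * sphereDivergence X θ ∂(surfaceMeasure d)
      = - ∫ θ, inner ℝ (g θ) (X θ) ∂(surfaceMeasure d)

/-- The Sobolev space `H¹(∂B₁)`. -/
def MemH1Sphere {d : ℕ} (c : S d → ℝ) : Prop := ∃ g : S d → E d, HasSphereWeakGradient c g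

/-- `u ∈ H¹(B₁)` with weak gradient `g ∈ L²(B₁; ℝ^d)`, tested against smooth vector fields with
compact support in the open ball. -/
structure HasWeakGradient {d : ℕ} (u : E d → ℝ) (g : E d → E d) : Prop where
  memLp : MemLp u 2 (ballMeasure d)
  memLp_grad : MemLp g 2 (ballMeasure d)
  integral_eq : ∀ X : E d → E d, ContDiff ℝ (⊤ : ℕ∞) X → HasCompactSupport X →
    tsupport X ⊆ ball (0 : E d) 1 →
    ∫ x, u x * divergence X x ∂(ballMeasure d) = - ∫ x, inner ℝ (g x) (X x) ∂(ballMeasure d)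

/-- The Sobolev space `H¹(B₁)`. -/
def MemH1Ball {d : ℕ} (u : E d → ℝ) : Prop := ∃ g : E d → E d, HasWeakGradient u g

/-- `u ∈ H¹(B₁)` has trace `τ ∈ L²(∂B₁)` on `∂B₁`: the Gauss-Green formula
`∫_{B₁} (u div X + ∇u · X) = ∫_{∂B₁} τ (X · θ)` holds for all smooth vector fields `X` on `ℝ^d`.
(Every `u ∈ H¹(B₁)` has exactly one trace in this sense, up to null sets.) -/
structure HasTrace {d : ℕ} (u : E d → ℝ) (τ : S d → ℝ) : Prop where
  memLp : MemLp τ 2 (surfaceMeasure d)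
  green : ∃ g : E d → E d, HasWeakGradient u g ∧
    ∀ X : E d → E d, ContDiff ℝ (⊤ : ℕ∞) X →
      ∫ x, (u x * divergence X x + inner ℝ (g x) (X x)) ∂(ballMeasure d)
        = ∫ θ, τ θ * inner ℝ (X θ) (θ : E d) ∂(surfaceMeasure d)

open Classical in
/-- The weak gradient of `u ∈ H¹(B₁)` (unique up to null sets). -/
def weakGradient {d : ℕ} (u : E d → ℝ) : E d → E d :=
  if h : ∃ g : E d → E d, HasWeakGradient u g then h.choose else 0

open Classical in
/-- The trace on `∂B₁` of `u ∈ H¹(B₁)` (unique up to null sets). -/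
def boundaryTrace {d : ℕ} (u : E d → ℝ) : S d → ℝ :=
  if h : ∃ τ : S d → ℝ, HasTrace u τ then h.choose else 0

/-- Weiss' boundary adjusted energy
`W(u) = ∫_{B₁} |∇u|² - 2 ∫_{∂B₁} u² + ∫_{B₁} max(u, 0)` of `u ∈ H¹(B₁)`. -/
def weissEnergy {d : ℕ} (u : E d → ℝ) : ℝ :=
  ∫ x, ‖weakGradient u x‖ ^ 2 ∂(ballMeasure d)
    - 2 * ∫ θ, (boundaryTrace u θ) ^ 2 ∂(surfaceMeasure d)
    + ∫ x, max (u x) 0 ∂(ballMeasure d)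

/-- The quadratic form `Q_A(x) = x · A x`. -/
def quadForm {d : ℕ} (A : Matrix (Fin d) (Fin d) ℝ) (x : E d) : ℝ :=
  x.ofLp ⬝ᵥ (A.mulVec x.ofLp)

/-- The class `𝒦` of the forms `Q_A`, `A` symmetric non-negative with trace `1/4`. -/
def blowUps (d : ℕ) : Set (E d → ℝ) :=
  {Q | ∃ A : Matrix (Fin d) (Fin d) ℝ, A.PosSemidef ∧ A.trace = 1 / 4 ∧ Q = quadForm A}

/-- The energy density `Θ`: the value of `W` on `𝒦`. As `W` is constant on `𝒦`, it is evaluated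
at `A = (1 / (4 d)) I`. -/
def theta (d : ℕ) : ℝ :=
  weissEnergy (quadForm ((1 / (4 * (d : ℝ))) • (1 : Matrix (Fin d) (Fin d) ℝ)))

/-- The distance `dist_{L²(∂B₁)}(c, 𝒦) = inf_{Q ∈ 𝒦} ‖c - Q‖_{L²(∂B₁)}`. -/
def distBlowUps {d : ℕ} (c : S d → ℝ) : ENNReal :=
  ⨅ Q ∈ blowUps d, eLpNorm (fun θ : S d => c θ - Q θ) 2 (surfaceMeasure d)

open Classical in
/-- The `2`-homogeneous extension `z(x) = |x|² c(x / |x|)` of `c`, with `z(0) = 0`. -/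
def homogExt {d : ℕ} (c : S d → ℝ) (x : E d) : ℝ :=
  if h : x = 0 then 0
  else ‖x‖ ^ 2 * c ⟨‖x‖⁻¹ • x, by simp [norm_smul, h]⟩

/-- The exponent `γ`: `0` in dimension two, `(d-1)/(d+3)` in dimension `d ≥ 3`. -/
def gammaExp (d : ℕ) : ℝ := if d = 2 then 0 else ((d : ℝ) - 1) / ((d : ℝ) + 3)

end Obstacle

end

open Set Filter Topology

noncomputable section

namespace Obstacle

variable {d : ℕ}

/-! Write `n = d + 2` and expand the boundary datum on the sphere as `c = p + φ`, where `p` is the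
`L²` projection onto polynomials of degree at most two and `φ` is orthogonal to them. Since `|θ|² =
1`, one can write `p = Q_A + a + b · θ` with `A` symmetric and `tr A = 1/4`. The `2`-homogeneous
extension turns the energy into a quadratic functional of `c` on the sphere for which degree two,
with Laplace-Beltrami eigenvalue `2d`, is neutral. With `w = W(z) - Θ` and `Γ = ‖∇φ‖² - 2d ‖φ‖²`
this gives `n w = Γ - 2d a² ‖1‖² - (d + 1) ‖b · θ‖²` (`weissEnergy_homogExt_sub_theta`). The modes
in `φ` have eigenvalue at least `3(d + 1) > 2d` (`spectral_gap`), so `Γ` controls the `H¹` norm of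
`φ`; as `w ≥ 0`, it also controls `a`, `b` and `n w`.

The competitor is `h = r² k + r^(2+e) (c - k)`, with `k = p + Q_T` nonnegative on the sphere and `tr
T = 0`. It equals `r² ((1 - r^e) k + r^e c)`, hence is nonnegative, and its trace is `c`. Raising
the homogeneity of `c - k` gains `2 e Γ / (n (n + e))` and costs at most `e² (‖φ‖² + ‖∇φ‖² + (1 +
2d) ‖Q_T‖²)` (`weissEnergy_competitor_le`); `Q_T` is absent from the first order term because it is
an eigenfunction with the neutral eigenvalue `2d`.

It remains to bound `Q_T`. If `-m ≤ 0` is the negative part of the minimum of `Q_A` on the sphere, a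
correction `T` of size `m + |a| + |b|` suffices, once `|a| + |b|` is small
(`exists_nonneg_correction`); this smallness is the only role of `δ`. When `m > 0`, `c` is
nonnegative while `Q_A ≤ -m/2` on a cap of radius comparable to `√m` (for `m ≤ 1`), so `√m ^ (d +
3)` is bounded by a multiple of `‖c - Q_A‖²`, hence of `Γ`. Interpolating with `w ≤ CΓ` gives `m²
w^γ ≤ CΓ` (`exists_sq_mul_rpow_le`). In the plane the embedding of `H¹` of the circle into bounded
functions gives directly `m² ≤ CΓ`, which is `γ = 0` (`exists_sq_le_two`).

With `e = ε₁ w^γ` and `ε₁` small, half of the first order gain absorbs the error; the other half is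
at least a multiple of `w^(1+γ)`. -/

instance : IsFiniteMeasure (surfaceMeasure d) :=
  inferInstanceAs (IsFiniteMeasure (volume : Measure (E d)).toSphere)

instance : IsFiniteMeasure (ballMeasure d) :=
  ⟨by simpa [ballMeasure] using measure_ball_lt_top⟩

/-! ### Polar coordinates on the ball. -/

/-- Polar coordinates `(θ, r) ↦ r θ`. -/
def polar (d : ℕ) (p : S d × Ioi (0 : ℝ)) : E d := p.2.1 • (p.1 : E d)

theorem polar_eq : polar d = Subtype.val ∘ (homeomorphUnitSphereProd (E d)).symm := by
  ext p; simp [polar]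

theorem measurableEmbedding_polar : MeasurableEmbedding (polar d) := by
  rw [polar_eq]
  exact (MeasurableEmbedding.subtype_coe (measurableSet_singleton _).compl).comp
    (Homeomorph.measurableEmbedding _)

theorem continuous_polar : Continuous (polar d) := by unfold polar; fun_prop

theorem norm_sphere (θ : S d) : ‖(θ : E d)‖ = 1 := by simp

theorem norm_polar (p : S d × Ioi (0 : ℝ)) : ‖polar d p‖ = p.2.1 := by
  simp [polar, norm_smul, abs_of_pos (mem_Ioi.1 p.2.2)]

theorem polar_ne_zero (p : S d × Ioi (0 : ℝ)) : polar d p ≠ 0 := by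
  rw [← norm_pos_iff, norm_polar]; exact p.2.2

theorem measurePreserving_polar [NeZero d] :
    MeasurePreserving (polar d) ((surfaceMeasure d).prod (Measure.volumeIoiPow (d - 1)))
      volume := by
  have h1 := (volume : Measure (E d)).measurePreserving_homeomorphUnitSphereProd
  have h2 := h1.symm (homeomorphUnitSphereProd (E d)).toMeasurableEquiv
  rw [finrank_euclideanSpace_fin] at h2
  refine ⟨measurableEmbedding_polar.measurable, ?_⟩
  rw [polar_eq, ← Measure.map_map measurable_subtype_coe
    (homeomorphUnitSphereProd (E d)).symm.measurable]
  have h3 := h2.map_eq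
  have h4 : Measure.map (homeomorphUnitSphereProd (E d)).symm
      ((surfaceMeasure d).prod (Measure.volumeIoiPow (d - 1)))
      = Measure.comap Subtype.val volume := h3
  rw [h4, map_comap_subtype_coe (measurableSet_singleton _).compl, restrict_compl_singleton]

/-- The measure `r ^ (d - 1) dr` on `(0, 1)`. -/
def radial (d : ℕ) : Measure (Ioi (0 : ℝ)) := (Measure.volumeIoiPow (d - 1)).restrict {r | r.1 < 1}

theorem measurableSet_radial : MeasurableSet {r : Ioi (0 : ℝ) | r.1 < 1} :=
  measurableSet_lt measurable_subtype_coe measurable_const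

instance : IsFiniteMeasure (radial d) := ⟨by
  rw [radial, Measure.restrict_apply_univ]
  have := Measure.volumeIoiPow_apply_Iio (d - 1) ⟨1, mem_Ioi.2 one_pos⟩
  have h2 : {r : Ioi (0 : ℝ) | r.1 < 1} = Iio ⟨1, mem_Ioi.2 one_pos⟩ := rfl
  rw [h2, this]; exact ENNReal.ofReal_lt_top⟩

theorem ae_radial_lt_one : ∀ᵐ r ∂radial d, r.1 < 1 := ae_restrict_mem measurableSet_radial

theorem measurePreserving_polar_ball [NeZero d] :
    MeasurePreserving (polar d) ((surfaceMeasure d).prod (radial d)) (ballMeasure d) := by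
  have h := (measurePreserving_polar (d := d)).restrict_preimage
    (s := ball (0 : E d) 1) measurableSet_ball
  have h2 : polar d ⁻¹' ball 0 1 = univ ×ˢ {r : Ioi (0 : ℝ) | r.1 < 1} := by
    ext p; simp [norm_polar]
  rw [h2, ← Measure.prod_restrict, Measure.restrict_univ] at h
  exact h

theorem integral_volumeIoiPow {F : Type*} [NormedAddCommGroup F] [NormedSpace ℝ F]
    (k : ℕ) (f : ℝ → F) :
    ∫ r, f r.1 ∂(Measure.volumeIoiPow k) = ∫ r in Ioi (0 : ℝ), r ^ k • f r := by
  simp only [Measure.volumeIoiPow, ENNReal.ofReal]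
  rw [integral_withDensity_eq_integral_smul,
    integral_subtype_comap measurableSet_Ioi fun a ↦ Real.toNNReal (a ^ k) • f a,
    setIntegral_congr_fun measurableSet_Ioi fun x hx ↦ ?_]
  · rw [NNReal.smul_def, Real.coe_toNNReal _ (pow_nonneg (mem_Ioi.1 hx).le _)]
  · exact (measurable_subtype_coe.pow_const _).real_toNNReal

theorem integral_radial {F : Type*} [NormedAddCommGroup F] [NormedSpace ℝ F] (f : ℝ → F) :
    ∫ r, f r.1 ∂(radial d) = ∫ r in (0 : ℝ)..1, r ^ (d - 1) • f r := by
  have h1 : ∫ r, f r.1 ∂(radial d)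
      = ∫ r, (Iio (1 : ℝ)).indicator f r.1 ∂(Measure.volumeIoiPow (d - 1)) := by
    rw [radial, ← integral_indicator measurableSet_radial]
    rfl
  rw [h1, integral_volumeIoiPow, intervalIntegral.integral_of_le zero_le_one,
    integral_Ioc_eq_integral_Ioo]
  have : ∀ r : ℝ, r ^ (d - 1) • (Iio (1 : ℝ)).indicator f r
      = (Iio (1 : ℝ)).indicator (fun r => r ^ (d - 1) • f r) r := by
    intro r; by_cases hr : r < 1 <;> simp [hr]
  simp_rw [this]
  rw [setIntegral_indicator measurableSet_Iio]
  rfl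

theorem integral_radial_rpow [NeZero d] {β : ℝ} (hβ : 0 ≤ β) :
    ∫ r, r.1 ^ β ∂(radial d) = 1 / (d + β) := by
  rw [integral_radial (fun r => r ^ β)]
  have hd : (1 : ℝ) ≤ d := by exact_mod_cast NeZero.one_le
  have h : ∀ r ∈ uIoc (0 : ℝ) 1, r ^ (d - 1) • r ^ β = r ^ ((d : ℝ) - 1 + β) := by
    intro r hr
    rw [uIoc_of_le zero_le_one] at hr
    rw [Real.rpow_add hr.1, smul_eq_mul, ← Real.rpow_natCast, Nat.cast_sub NeZero.one_le]
    simp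
  rw [intervalIntegral.integral_congr_ae (Eventually.of_forall h),
    integral_rpow (Or.inl (by linarith))]
  rw [Real.one_rpow, Real.zero_rpow (by linarith)]
  ring_nf

theorem integral_ball_eq [NeZero d] {F : Type*} [NormedAddCommGroup F] [NormedSpace ℝ F]
    (f : E d → F) :
    ∫ x, f x ∂(ballMeasure d)
      = ∫ p, f (polar d p) ∂((surfaceMeasure d).prod (radial d)) :=
  (measurePreserving_polar_ball.integral_comp measurableEmbedding_polar f).symm

theorem memLp_ball_iff [NeZero d] {F : Type*} [NormedAddCommGroup F] (f : E d → F)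
    {q : ENNReal} : MemLp f q (ballMeasure d)
      ↔ MemLp (fun p => f (polar d p)) q ((surfaceMeasure d).prod (radial d)) := by
  rw [← measurePreserving_polar_ball.map_eq, measurableEmbedding_polar.memLp_map_measure_iff]
  rfl

theorem ae_ball_iff [NeZero d] {P : E d → Prop} :
    (∀ᵐ x ∂(ballMeasure d), P x)
      ↔ ∀ᵐ p ∂((surfaceMeasure d).prod (radial d)), P (polar d p) := by
  rw [← measurePreserving_polar_ball.map_eq, measurableEmbedding_polar.ae_map_iff]

open Classical in
/-- The function on `ℝ^d` with given expression in polar coordinates, and value `0` at `0`. -/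
def radialLift {β : Type*} [Zero β] (F : S d × Ioi (0 : ℝ) → β) (x : E d) : β :=
  if h : x = 0 then 0 else F (homeomorphUnitSphereProd (E d) ⟨x, h⟩)

theorem radialLift_polar {β : Type*} [Zero β] (F : S d × Ioi (0 : ℝ) → β)
    (p : S d × Ioi (0 : ℝ)) : radialLift F (polar d p) = F p := by
  rw [radialLift, dif_neg (polar_ne_zero p)]
  congr 1
  have : (⟨polar d p, polar_ne_zero p⟩ : ({0}ᶜ : Set (E d)))
      = (homeomorphUnitSphereProd (E d)).symm p := by
    exact Subtype.ext (congrFun polar_eq p)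
  exact (congrArg _ this).trans (Homeomorph.apply_symm_apply _ _)

theorem homogExt_eq_radialLift (c : S d → ℝ) :
    homogExt c = radialLift fun p => p.2.1 ^ (2 : ℕ) * c p.1 := by
  ext x
  unfold homogExt radialLift
  by_cases h : x = 0
  · simp [h]
  · rw [dif_neg h, dif_neg h]
    change _ = (homeomorphUnitSphereProd (E d) ⟨x, h⟩).2.1 ^ 2
      * c (homeomorphUnitSphereProd (E d) ⟨x, h⟩).1
    rw [homeomorphUnitSphereProd_apply_snd_coe]
    congr 2
    exact Subtype.ext (homeomorphUnitSphereProd_apply_fst_coe (E := E d) ⟨x, h⟩).symm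

/-! ### Tangential fields and the divergence theorem on the sphere. -/

theorem hasFDerivAt_norm_sq' (x : E d) :
    HasFDerivAt (fun x : E d => ‖x‖ ^ 2) ((2 : ℝ) • innerSL ℝ x) x := by
  refine (hasStrictFDerivAt_norm_sq x).hasFDerivAt.congr_fderiv ?_
  ext v; simp

/-- The trace of a linear endomorphism of `ℝ^d`. -/
def traceE (L : E d →L[ℝ] E d) : ℝ := ∑ i : Fin d, (L (EuclideanSpace.single i 1)) i

theorem divergence_eq_traceE (X : E d → E d) (x : E d) :
    divergence X x = traceE (fderiv ℝ X x) := rfl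

theorem traceE_add (L M : E d →L[ℝ] E d) : traceE (L + M) = traceE L + traceE M := by
  simp [traceE, Finset.sum_add_distrib]

theorem traceE_sub (L M : E d →L[ℝ] E d) : traceE (L - M) = traceE L - traceE M := by
  simp [traceE, Finset.sum_sub_distrib]

theorem traceE_smul (a : ℝ) (L : E d →L[ℝ] E d) : traceE (a • L) = a * traceE L := by
  simp [traceE, Finset.mul_sum]

theorem traceE_id : traceE (ContinuousLinearMap.id ℝ (E d)) = d := by
  simp [traceE]

theorem traceE_smulRight (l : E d →L[ℝ] ℝ) (v : E d) : traceE (l.smulRight v) = l v := by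
  have hv : v = ∑ i, v i • EuclideanSpace.single i (1 : ℝ) := by
    ext j; simp [Finset.sum_apply, Pi.single_apply]
  conv_rhs => rw [hv]
  simp [traceE, mul_comm]

/-- The tangential field `|x|² X(x) - (X(x) · x) x`. -/
def tangential (X : E d → E d) (x : E d) : E d := ‖x‖ ^ 2 • X x - inner ℝ (X x) x • x

theorem inner_tangential (X : E d → E d) (x : E d) : inner ℝ (tangential X x) x = 0 := by
  simp [tangential, inner_sub_left, inner_smul_left]; ring

theorem tangential_sphere (X : E d → E d) (θ : S d) :
    tangential X θ = X θ - inner ℝ (X θ) (θ : E d) • (θ : E d) := by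
  simp [tangential]

/-- The factor `|x|²` in place of a normalized projection keeps the field smooth at the origin, so
it is an admissible global test field; it is tangent to every sphere centred at `0`. -/
theorem contDiff_tangential {X : E d → E d} {k : WithTop ℕ∞} (hX : ContDiff ℝ k X) :
    ContDiff ℝ k (tangential X) :=
  ((contDiff_norm_sq ℝ).smul hX).sub ((hX.inner ℝ contDiff_id).smul contDiff_id)

theorem hasFDerivAt_tangential {X : E d → E d} {x : E d} (hX : DifferentiableAt ℝ X x) :
    HasFDerivAt (tangential X)
      (‖x‖ ^ 2 • fderiv ℝ X x + ((2 : ℝ) • innerSL ℝ x).smulRight (X x)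
        - (inner ℝ (X x) x • ContinuousLinearMap.id ℝ (E d)
          + ((innerSL ℝ x).comp (fderiv ℝ X x) + innerSL ℝ (X x)).smulRight x)) x := by
  have h1 : HasFDerivAt (fun x : E d => ‖x‖ ^ 2) ((2 : ℝ) • innerSL ℝ x) x := by
    exact hasFDerivAt_norm_sq' x
  have h2 : HasFDerivAt (fun y : E d => inner ℝ (X y) y)
      ((innerSL ℝ x).comp (fderiv ℝ X x) + innerSL ℝ (X x)) x := by
    refine (hX.hasFDerivAt.inner ℝ (hasFDerivAt_id x)).congr_fderiv ?_
    ext v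
    simp [real_inner_comm, add_comm]
  exact (h1.smul hX.hasFDerivAt).sub (h2.smul (hasFDerivAt_id x))

theorem divergence_tangential {X : E d → E d} {x : E d} (hX : DifferentiableAt ℝ X x) :
    divergence (tangential X) x = ‖x‖ ^ 2 * divergence X x
      - inner ℝ (fderiv ℝ X x x) x - (d - 1) * inner ℝ (X x) x := by
  rw [divergence_eq_traceE, (hasFDerivAt_tangential hX).fderiv, traceE_sub, traceE_add, traceE_add,
    traceE_smul, traceE_smul, traceE_smulRight, traceE_smulRight, traceE_id, divergence_eq_traceE]
  simp [real_inner_comm]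
  ring

theorem sphereDivergence_tangential {X : E d → E d} {θ : S d} (hX : DifferentiableAt ℝ X θ) :
    sphereDivergence (tangential X) θ
      = sphereDivergence X θ - (d - 1) * inner ℝ (X θ) (θ : E d) := by
  rw [sphereDivergence, divergence_tangential hX, sphereDivergence,
    (hasFDerivAt_tangential hX).fderiv]
  simp [inner_add_left, inner_sub_left, inner_smul_left]
  simp [real_inner_comm]
  ring

theorem divergence_smul {f : E d → ℝ} {f' : E d →L[ℝ] ℝ} {X : E d → E d} {x : E d}
    (hf : HasFDerivAt f f' x) (hX : DifferentiableAt ℝ X x) :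
    divergence (fun y => f y • X y) x = f x * divergence X x + f' (X x) := by
  rw [divergence_eq_traceE,
    show (fun y => f y • X y) = f • X from rfl, (hf.smul hX.hasFDerivAt).fderiv, traceE_add,
    traceE_smul, traceE_smulRight, divergence_eq_traceE]

theorem continuous_divergence {X : E d → E d} (hX : ContDiff ℝ 1 X) :
    Continuous (divergence X) := by
  have h := hX.continuous_fderiv one_ne_zero
  unfold divergence
  fun_prop

theorem continuous_sphereDivergence {X : E d → E d} (hX : ContDiff ℝ 1 X) :
    Continuous (sphereDivergence X) := by
  have h := hX.continuous_fderiv one_ne_zero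
  have h2 := continuous_divergence hX
  unfold sphereDivergence
  fun_prop

theorem integral_divergence_eq_zero {X : E d → E d} (hX : ContDiff ℝ 1 X)
    (hc : HasCompactSupport X) : ∫ x, divergence X x = 0 := by
  have hi : ∀ i : Fin d, Integrable fun x => (fderiv ℝ X x (EuclideanSpace.single i 1)) i := by
    intro i
    have h := hX.continuous_fderiv one_ne_zero
    refine Continuous.integrable_of_hasCompactSupport (by fun_prop) ?_
    refine (hc.fderiv (𝕜 := ℝ)).comp_left
      (g := fun L : E d →L[ℝ] E d => (L (EuclideanSpace.single i 1)) i) (by simp)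
  unfold divergence
  rw [integral_finsetSum _ fun i _ => hi i]
  refine Finset.sum_eq_zero fun i _ => ?_
  have hd : Differentiable ℝ X := hX.differentiable one_ne_zero
  have hXi : ∀ x, HasFDerivAt (fun y => (X y) i)
      ((EuclideanSpace.proj i).comp (fderiv ℝ X x)) x := fun x =>
    (EuclideanSpace.proj i : E d →L[ℝ] ℝ).hasFDerivAt.comp x (hd x).hasFDerivAt
  have hi' : ∀ x, fderiv ℝ (fun y => (X y) i) x (EuclideanSpace.single i 1)
      = (fderiv ℝ X x (EuclideanSpace.single i 1)) i := fun x => by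
    rw [(hXi x).fderiv]; rfl
  have := integral_mul_fderiv_eq_neg_fderiv_mul_of_integrable (μ := (volume : Measure (E d)))
    (𝕜 := ℝ) (f := fun _ => (1 : ℝ)) (g := fun y => (X y) i) (v := EuclideanSpace.single i 1)
    (by simp) (by simpa [hi'] using hi i)
    (by
      simp only [one_mul]
      refine Continuous.integrable_of_hasCompactSupport (by fun_prop) ?_
      exact hc.comp_left (g := fun v : E d => v i) (by simp))
    (by fun_prop) (fun x _ => (hXi x).differentiableAt)
  simpa [hi'] using this

theorem Continuous.integrable_sphere {F : Type*} [NormedAddCommGroup F]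
    {f : S d → F} (hf : Continuous f) : Integrable f (surfaceMeasure d) :=
  hf.integrable_of_hasCompactSupport (HasCompactSupport.of_compactSpace f)

theorem Continuous.memLp_sphere {F : Type*} [NormedAddCommGroup F]
    {f : S d → F} (hf : Continuous f) {q : ENNReal} : MemLp f q (surfaceMeasure d) :=
  hf.memLp_of_hasCompactSupport (HasCompactSupport.of_compactSpace f)

/-- The gradient of the radial cutoff `η(|x|²)` is orthogonal to the tangential field, so the
divergence of the product is the cutoff times the divergence. Its integral over the whole space
vanishes, and polar coordinates give the formula. -/
theorem integral_divergence_tangential_mul_eq_zero [NeZero d] {X : E d → E d}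
    (hX : ContDiff ℝ 1 X) {η : ℝ → ℝ} (hη : ContDiff ℝ 1 η) (hc : HasCompactSupport η) :
    ∫ r in Ioi (0 : ℝ), r ^ (d - 1) * (η (r ^ 2)
      * ∫ θ, divergence (tangential X) (r • (θ : E d)) ∂(surfaceMeasure d)) = 0 := by
  set Y := tangential X with hY
  have hYc : ContDiff ℝ 1 Y := contDiff_tangential hX
  set Z : E d → E d := fun x => η (‖x‖ ^ 2) • Y x with hZ
  have hηc : ContDiff ℝ 1 fun x : E d => η (‖x‖ ^ 2) := hη.comp (contDiff_norm_sq ℝ)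
  have hZc : ContDiff ℝ 1 Z := hηc.smul hYc
  have hηs : HasCompactSupport fun x : E d => η (‖x‖ ^ 2) := by
    obtain ⟨R, hR⟩ := hc.isCompact.isBounded.subset_closedBall 0
    refine HasCompactSupport.intro (isCompact_closedBall (0 : E d) (max R 1)) fun x hx => ?_
    by_contra h
    have h1 := hR (subset_tsupport _ h)
    simp only [mem_closedBall, dist_zero_right, not_le, Real.norm_eq_abs, abs_pow, abs_norm] at hx h1
    have h2 := (le_max_right R 1).trans_lt hx
    have h3 := (le_max_left R 1).trans_lt hx
    nlinarith
  have hZs : HasCompactSupport Z := hηs.smul_right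
  have hdivZ : ∀ x, divergence Z x = η (‖x‖ ^ 2) * divergence Y x := by
    intro x
    have h1 : HasFDerivAt (fun x : E d => ‖x‖ ^ 2) ((2 : ℝ) • innerSL ℝ x) x := by
      exact hasFDerivAt_norm_sq' x
    have h2 := (hη.differentiable one_ne_zero _).hasDerivAt.comp_hasFDerivAt x h1
    have h3 := divergence_smul h2 (hYc.differentiable one_ne_zero x)
    simp only [Function.comp_apply] at h3
    rw [hZ, h3]
    have := inner_tangential X x
    rw [real_inner_comm] at this
    simp [hY, this]
  have h0 := integral_divergence_eq_zero hZc hZs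
  have hint : Integrable (divergence Z) := by
    refine (continuous_divergence hZc).integrable_of_hasCompactSupport ?_
    rw [show divergence Z = fun x => η (‖x‖ ^ 2) * divergence Y x from funext hdivZ]
    exact hηs.mul_right
  rw [← measurePreserving_polar.integral_comp measurableEmbedding_polar] at h0
  rw [← measurePreserving_polar.integrable_comp_emb measurableEmbedding_polar] at hint
  rw [integral_prod_symm (fun p => divergence Z (polar d p)) hint] at h0
  refine ((integral_volumeIoiPow (d - 1) fun r => η (r ^ 2)
      * ∫ θ, divergence Y (r • (θ : E d)) ∂(surfaceMeasure d)).symm.trans ?_).trans h0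
  refine integral_congr_ae (Eventually.of_forall fun r => ?_)
  simp only [hdivZ, norm_polar, integral_const_mul]
  rfl

/-- The divergence theorem on the sphere. -/
theorem integral_sphereDivergence [NeZero d] {X : E d → E d} (hX : ContDiff ℝ 1 X) :
    ∫ θ, (sphereDivergence X θ - (d - 1) * inner ℝ (X θ) (θ : E d)) ∂(surfaceMeasure d) = 0 := by
  set Y := tangential X with hY
  have hYc : ContDiff ℝ 1 Y := contDiff_tangential hX
  set K : ℝ → ℝ := fun r => ∫ θ, divergence Y (r • (θ : E d)) ∂(surfaceMeasure d) with hK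
  have hKc : Continuous K := by
    have := continuous_divergence hYc
    have h2 : Continuous (Function.uncurry fun (r : ℝ) (θ : S d) => divergence Y (r • (θ : E d))) :=
      by unfold Function.uncurry; fun_prop
    simpa [hK] using continuous_parametric_integral_of_continuous
      (μ := surfaceMeasure d) h2 isCompact_univ
  -- All radial averages of `K` against cutoffs vanish. If `K 1 ≠ 0`, a bump supported where `K` has
  -- the sign of `K 1` makes `G` continuous and nonnegative on the half-line with zero integral,
  -- contradicting `G 1 = (K 1)² ≠ 0`.
  have hK1 : K 1 = 0 := by
    by_contra hne
    have hpos : ∀ᶠ r in 𝓝 (1 : ℝ), 0 < K 1 * K r := by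
      have : Tendsto (fun r => K 1 * K r) (𝓝 1) (𝓝 (K 1 * K 1)) :=
        (hKc.tendsto 1).const_mul _
      exact this.eventually (lt_mem_nhds (mul_self_pos.2 hne))
    obtain ⟨ε, hε, hball⟩ := Metric.eventually_nhds_iff_ball.1 hpos
    let η : ContDiffBump (1 : ℝ) := ⟨ε / 2, ε, half_pos hε, half_lt_self hε⟩
    have h0 := integral_divergence_tangential_mul_eq_zero hX (η := η) η.contDiff
      η.hasCompactSupport
    -- For `r > 0`, `|r - 1| ≤ |r - 1| (r + 1) = |r² - 1|`, so the bump in `r²` localizes `r` at the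
    -- same scale.
    have hη : ∀ r : ℝ, 0 < r → η (r ^ 2) ≠ 0 → 0 < K 1 * K r := by
      intro r hr h
      have h1 : r ^ 2 ∈ ball (1 : ℝ) ε := by
        rw [← η.support_eq]; exact h
      refine hball r ?_
      rw [mem_ball, Real.dist_eq, abs_lt] at h1 ⊢
      constructor <;> nlinarith
    set G : ℝ → ℝ := fun r => r ^ (d - 1) * (η (r ^ 2) * K r) * K 1 with hG
    have hGc : Continuous G := by
      have := η.continuous
      fun_prop
    have h1 : ∫ r in Ioi (0 : ℝ), G r = 0 := by
      rw [hG, integral_mul_const, h0, zero_mul]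
    have hGi : IntegrableOn G (Ioi 0) := by
      refine (hGc.integrable_of_hasCompactSupport ?_).integrableOn
      refine HasCompactSupport.intro (isCompact_closedBall (0 : ℝ) (1 + ε)) fun r hr => ?_
      have : η (r ^ 2) = 0 := by
        by_contra h
        have h1 : r ^ 2 ∈ ball (1 : ℝ) ε := by
          rw [← η.support_eq]; exact h
        rw [mem_closedBall, dist_zero_right, Real.norm_eq_abs, not_le] at hr
        rw [mem_ball, Real.dist_eq, abs_lt, ← sq_abs] at h1
        nlinarith
      simp [hG, this]
    have h2 : 0 ≤ᵐ[volume.restrict (Ioi 0)] G := by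
      filter_upwards [ae_restrict_mem measurableSet_Ioi] with r hr
      by_cases h : η (r ^ 2) = 0
      · simp [hG, h]
      · have := hη r hr h
        have h3 : G r = r ^ (d - 1) * η (r ^ 2) * (K 1 * K r) := by simp only [hG]; ring
        rw [h3]
        exact mul_nonneg (mul_nonneg (pow_nonneg (mem_Ioi.1 hr).le _) η.nonneg) this.le
    have h3 := (integral_eq_zero_iff_of_nonneg_ae h2 hGi).1 h1
    have h4 := Measure.eqOn_open_of_ae_eq h3 isOpen_Ioi hGc.continuousOn continuousOn_const
      (mem_Ioi.2 one_pos)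
    have h5 : η 1 = 1 := η.one_of_mem_closedBall (mem_closedBall_self η.rIn_pos.le)
    simp [hG, h5] at h4
    exact hne h4
  rw [← hK1]
  refine integral_congr_ae (Eventually.of_forall fun θ => ?_)
  simp only [one_smul, hY]
  rw [divergence_tangential (hX.differentiable one_ne_zero _), sphereDivergence]
  simp

/-! ### Weak gradients on the sphere. -/

theorem MemLp.integrable_inner_two {α F : Type*} [MeasurableSpace α] {μ : Measure α}
    [NormedAddCommGroup F] [InnerProductSpace ℝ F] {f g : α → F} (hf : MemLp f 2 μ)
    (hg : MemLp g 2 μ) : Integrable (fun x => inner ℝ (f x) (g x)) μ := by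
  have h : Integrable (fun x => ‖f x‖ * ‖g x‖) μ := MemLp.integrable_mul hf.norm hg.norm
  refine h.mono (hf.1.inner hg.1) (Eventually.of_forall fun x => ?_)
  simpa using norm_inner_le_norm (𝕜 := ℝ) (f x) (g x)

theorem MemLp.integrable_mul_two {α : Type*} [MeasurableSpace α] {μ : Measure α}
    {f g : α → ℝ} (hf : MemLp f 2 μ) (hg : MemLp g 2 μ) :
    Integrable (fun x => f x * g x) μ := MemLp.integrable_mul hf hg

theorem sphereDivergence_smul {f : E d → ℝ} {f' : E d →L[ℝ] ℝ} {X : E d → E d} {θ : S d}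
    (hf : HasFDerivAt f f' θ) (hX : DifferentiableAt ℝ X θ) :
    sphereDivergence (fun y => f y • X y) θ = f θ * sphereDivergence X θ + f' (X θ)
      - f' θ * inner ℝ (X θ) (θ : E d) := by
  have h := (hf.smul hX.hasFDerivAt).fderiv
  rw [show (f • X) = fun y => f y • X y from rfl] at h
  rw [sphereDivergence, divergence_smul hf hX, h, sphereDivergence]
  simp [inner_add_left, inner_smul_left]
  ring

namespace HasSphereWeakGradient

variable {c c₁ c₂ : S d → ℝ} {g g₁ g₂ : S d → E d}

/-- The divergence theorem on the sphere, applied to `p Y` with `Y` tangent: only the tangential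
part of the classical gradient pairs with `Y`. -/
theorem of_gradient [NeZero d] {p : E d → ℝ} {X : E d → E d} (hp : ContDiff ℝ 1 p)
    (hpX : ∀ x, HasFDerivAt p (innerSL ℝ (X x)) x) (hX : Continuous X) :
    HasSphereWeakGradient (fun θ : S d => p θ)
      (fun θ : S d => X θ - inner ℝ (X θ) (θ : E d) • (θ : E d)) where
  memLp := Continuous.memLp_sphere (hp.continuous.comp continuous_subtype_val)
  memLp_grad := Continuous.memLp_sphere (by fun_prop)
  tangent := Eventually.of_forall fun θ => by simp [inner_sub_left, inner_smul_left]
  integral_eq := fun Y hY hYt => by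
    have hY1 : ContDiff ℝ 1 Y := hY.of_le (by exact_mod_cast le_top)
    have h := integral_sphereDivergence (hp.smul hY1)
    rw [show (p • Y) = fun y => p y • Y y from rfl] at h
    have hpt : ∀ θ : S d, sphereDivergence (fun y => p y • Y y) θ
        - (d - 1) * inner ℝ (p θ • Y θ) (θ : E d)
        = p θ * sphereDivergence Y θ
          + inner ℝ (X θ - inner ℝ (X θ) (θ : E d) • (θ : E d)) (Y θ) := by
      intro θ
      rw [sphereDivergence_smul (hpX θ) (hY1.differentiable one_ne_zero _), inner_smul_left, hYt]
      have h3 := hYt θ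
      rw [real_inner_comm] at h3
      simp [inner_sub_left, inner_smul_left, h3]
    simp_rw [hpt] at h
    have := continuous_sphereDivergence hY1
    have := hp.continuous
    have := hY1.continuous
    rw [integral_add (Continuous.integrable_sphere (by fun_prop))
      (Continuous.integrable_sphere (by fun_prop))] at h
    linarith

theorem add (h₁ : HasSphereWeakGradient c₁ g₁) (h₂ : HasSphereWeakGradient c₂ g₂) :
    HasSphereWeakGradient (fun θ => c₁ θ + c₂ θ) (fun θ => g₁ θ + g₂ θ) where
  memLp := h₁.memLp.add h₂.memLp
  memLp_grad := h₁.memLp_grad.add h₂.memLp_grad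
  tangent := by
    filter_upwards [h₁.tangent, h₂.tangent] with θ e₁ e₂
    rw [inner_add_left, e₁, e₂, add_zero]
  integral_eq := fun X hX hXt => by
    have hX1 : ContDiff ℝ 1 X := hX.of_le (by exact_mod_cast le_top)
    have hd : MemLp (fun θ : S d => sphereDivergence X θ) 2 (surfaceMeasure d) :=
      Continuous.memLp_sphere ((continuous_sphereDivergence hX1))
    have hX2 : MemLp (fun θ : S d => X θ) 2 (surfaceMeasure d) :=
      Continuous.memLp_sphere (hX.continuous.comp continuous_subtype_val)
    simp_rw [add_mul, inner_add_left]
    rw [integral_add (MemLp.integrable_mul_two h₁.memLp hd)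
        (MemLp.integrable_mul_two h₂.memLp hd),
      integral_add (MemLp.integrable_inner_two h₁.memLp_grad hX2)
        (MemLp.integrable_inner_two h₂.memLp_grad hX2),
      h₁.integral_eq X hX hXt, h₂.integral_eq X hX hXt]
    ring

theorem neg (h : HasSphereWeakGradient c g) :
    HasSphereWeakGradient (fun θ => -c θ) (fun θ => -g θ) where
  memLp := h.memLp.neg
  memLp_grad := h.memLp_grad.neg
  tangent := by
    filter_upwards [h.tangent] with θ e
    rw [inner_neg_left, e, neg_zero]
  integral_eq := fun X hX hXt => by
    simp_rw [neg_mul, inner_neg_left, integral_neg, h.integral_eq X hX hXt]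

theorem sub (h₁ : HasSphereWeakGradient c₁ g₁) (h₂ : HasSphereWeakGradient c₂ g₂) :
    HasSphereWeakGradient (fun θ => c₁ θ - c₂ θ) (fun θ => g₁ θ - g₂ θ) := by
  simpa only [sub_eq_add_neg] using h₁.add h₂.neg

/-- The weak formula for vector fields which need not be tangent to the sphere. -/
theorem integral_eq_of_smooth (h : HasSphereWeakGradient c g) {X : E d → E d}
    (hX : ContDiff ℝ (⊤ : ℕ∞) X) :
    ∫ θ, c θ * (sphereDivergence X θ - (d - 1) * inner ℝ (X θ) (θ : E d)) ∂(surfaceMeasure d)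
      = - ∫ θ, inner ℝ (g θ) (X θ) ∂(surfaceMeasure d) := by
  have h1 := h.integral_eq (tangential X) (contDiff_tangential hX)
    (fun θ => inner_tangential X θ)
  have hX1 : Differentiable ℝ X := hX.differentiable (by simp)
  simp_rw [sphereDivergence_tangential (hX1 _)] at h1
  rw [h1]
  congr 1
  refine integral_congr_ae ?_
  filter_upwards [h.tangent] with θ hθ
  rw [tangential_sphere, inner_sub_right, inner_smul_right, hθ, mul_zero, sub_zero]

/-- Testing a weak gradient with the tangential part of a smooth field. -/
theorem integral_inner_tangent (h : HasSphereWeakGradient c g) {X : E d → E d}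
    (hX : ContDiff ℝ (⊤ : ℕ∞) X) :
    ∫ θ, inner ℝ (g θ) (X θ - inner ℝ (X θ) (θ : E d) • (θ : E d)) ∂(surfaceMeasure d)
      = - ∫ θ, c θ * (sphereDivergence X θ - (d - 1) * inner ℝ (X θ) (θ : E d))
        ∂(surfaceMeasure d) := by
  rw [h.integral_eq_of_smooth hX, neg_neg]
  refine integral_congr_ae ?_
  filter_upwards [h.tangent] with θ hθ
  rw [inner_sub_right, inner_smul_right, hθ, mul_zero, sub_zero]

end HasSphereWeakGradient

/-! ### Green's formula and weak gradients on the ball. -/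

theorem Continuous.memLp_ball {F : Type*} [NormedAddCommGroup F]
    {f : E d → F} (hf : Continuous f) {q : ENNReal} : MemLp f q (ballMeasure d) := by
  obtain ⟨C, hC⟩ := (isCompact_closedBall (0 : E d) 1).exists_bound_of_continuousOn hf.continuousOn
  refine MemLp.of_bound hf.aestronglyMeasurable C ?_
  filter_upwards [ae_restrict_mem measurableSet_ball] with x hx
  exact hC x (ball_subset_closedBall hx)

/-- `u ∈ H¹(B₁)` has weak gradient `g` and trace `τ`. -/
structure HasGreen (u : E d → ℝ) (g : E d → E d) (τ : S d → ℝ) : Prop where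
  memLp : MemLp u 2 (ballMeasure d)
  memLp_grad : MemLp g 2 (ballMeasure d)
  memLp_trace : MemLp τ 2 (surfaceMeasure d)
  green : ∀ X : E d → E d, ContDiff ℝ (⊤ : ℕ∞) X →
      ∫ x, (u x * divergence X x + inner ℝ (g x) (X x)) ∂(ballMeasure d)
        = ∫ θ, τ θ * inner ℝ (X θ) (θ : E d) ∂(surfaceMeasure d)

namespace HasGreen

variable {u u₁ u₂ : E d → ℝ} {g g₁ g₂ : E d → E d} {τ τ₁ τ₂ : S d → ℝ}

theorem integrable_mul_divergence (hu : MemLp u 2 (ballMeasure d)) {X : E d → E d}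
    (hX : ContDiff ℝ (⊤ : ℕ∞) X) :
    Integrable (fun x => u x * divergence X x) (ballMeasure d) :=
  MemLp.integrable_mul_two hu
    (Continuous.memLp_ball (continuous_divergence (hX.of_le (by exact_mod_cast le_top))))

theorem integrable_inner (hg : MemLp g 2 (ballMeasure d)) {X : E d → E d}
    (hX : ContDiff ℝ (⊤ : ℕ∞) X) :
    Integrable (fun x => inner ℝ (g x) (X x)) (ballMeasure d) :=
  MemLp.integrable_inner_two hg (Continuous.memLp_ball hX.continuous)

/-- Test fields supported in the open ball vanish on the sphere, so the boundary term drops out of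
Green's formula. -/
theorem hasWeakGradient (h : HasGreen u g τ) : HasWeakGradient u g where
  memLp := h.memLp
  memLp_grad := h.memLp_grad
  integral_eq := fun X hX _ hXs => by
    have h1 := h.green X hX
    rw [integral_add (integrable_mul_divergence h.memLp hX)
      (integrable_inner h.memLp_grad hX)] at h1
    have h2 : ∀ θ : S d, X θ = 0 := fun θ => by
      by_contra hne
      have := hXs (subset_tsupport X hne)
      simp at this
    simp only [h2, inner_zero_left, mul_zero, integral_zero] at h1
    linarith

theorem hasTrace (h : HasGreen u g τ) : HasTrace u τ where
  memLp := h.memLp_trace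
  green := ⟨g, h.hasWeakGradient, h.green⟩

theorem add (h₁ : HasGreen u₁ g₁ τ₁) (h₂ : HasGreen u₂ g₂ τ₂) :
    HasGreen (fun x => u₁ x + u₂ x) (fun x => g₁ x + g₂ x) (fun θ => τ₁ θ + τ₂ θ) where
  memLp := h₁.memLp.add h₂.memLp
  memLp_grad := h₁.memLp_grad.add h₂.memLp_grad
  memLp_trace := h₁.memLp_trace.add h₂.memLp_trace
  green := fun X hX => by
    have hXs : MemLp (fun θ : S d => inner ℝ (X θ) (θ : E d)) 2 (surfaceMeasure d) :=
      Continuous.memLp_sphere (by have := hX.continuous; fun_prop)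
    have h3 : ∀ x, (u₁ x + u₂ x) * divergence X x + inner ℝ (g₁ x + g₂ x) (X x)
        = (u₁ x * divergence X x + inner ℝ (g₁ x) (X x))
          + (u₂ x * divergence X x + inner ℝ (g₂ x) (X x)) := fun x => by
      rw [inner_add_left]; ring
    simp_rw [h3, add_mul]
    rw [integral_add ((integrable_mul_divergence h₁.memLp hX).fun_add
        (integrable_inner h₁.memLp_grad hX)) ((integrable_mul_divergence h₂.memLp hX).fun_add
        (integrable_inner h₂.memLp_grad hX)), h₁.green X hX, h₂.green X hX,
      integral_add (MemLp.integrable_mul_two h₁.memLp_trace hXs)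
        (MemLp.integrable_mul_two h₂.memLp_trace hXs)]

end HasGreen

/-- The weak gradient on the ball is unique. -/
theorem HasWeakGradient.ae_eq {u : E d → ℝ} {g₁ g₂ : E d → E d} (h₁ : HasWeakGradient u g₁)
    (h₂ : HasWeakGradient u g₂) : g₁ =ᵐ[ballMeasure d] g₂ := by
  have hli : LocallyIntegrableOn (fun x => g₁ x - g₂ x) (ball (0 : E d) 1) volume :=
    IntegrableOn.locallyIntegrableOn
      (((h₁.memLp_grad.sub h₂.memLp_grad).integrable (by norm_num)))
  have h := isOpen_ball.ae_eq_zero_of_integral_contDiff_smul_eq_zero hli ?_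
  · filter_upwards [ae_restrict_of_ae h, ae_restrict_mem measurableSet_ball] with x hx hxb
    exact sub_eq_zero.1 (hx hxb)
  · intro f hf hfc hfs
    have hz : ∀ x, x ∉ ball (0 : E d) 1 → f x • (g₁ x - g₂ x) = 0 := fun x hx => by
      have : f x = 0 := by
        by_contra h; exact hx (hfs (subset_tsupport f h))
      simp [this]
    have hres : ∫ x, f x • (g₁ x - g₂ x) = ∫ x, f x • (g₁ x - g₂ x) ∂(ballMeasure d) := by
      rw [ballMeasure, setIntegral_eq_integral_of_forall_compl_eq_zero hz]
    rw [hres]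
    have hfi : Integrable (fun x => f x • (g₁ x - g₂ x)) (ballMeasure d) := by
      have h1 : Integrable (fun x => g₁ x - g₂ x) (ballMeasure d) :=
        (h₁.memLp_grad.sub h₂.memLp_grad).integrable (by norm_num)
      obtain ⟨C, hC⟩ := hfc.exists_bound_of_continuous hf.continuous
      exact h1.bdd_smul C hf.continuous.aestronglyMeasurable (Eventually.of_forall hC)
    -- Pairing with a constant vector `v` reduces the vector identity to the two weak formulas
    -- tested with the field `f v`.
    refine ext_inner_right ℝ fun v => ?_
    rw [inner_zero_left, real_inner_comm, ← integral_inner hfi]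
    have hX : ContDiff ℝ (⊤ : ℕ∞) fun x => f x • v := hf.smul contDiff_const
    have hXs : tsupport (fun x => f x • v) ⊆ ball (0 : E d) 1 :=
      (closure_mono (Function.support_smul_subset_left f (fun _ => v))).trans hfs
    have e₁ := h₁.integral_eq _ hX hfc.smul_right hXs
    have e₂ := h₂.integral_eq _ hX hfc.smul_right hXs
    have hs : ∀ x, inner ℝ v (f x • (g₁ x - g₂ x))
        = inner ℝ (g₁ x) (f x • v) - inner ℝ (g₂ x) (f x • v) := fun x => by
      rw [inner_smul_right, inner_sub_right, inner_smul_right, inner_smul_right,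
        real_inner_comm v, real_inner_comm v]; ring
    simp_rw [hs]
    rw [integral_sub (HasGreen.integrable_inner h₁.memLp_grad hX)
      (HasGreen.integrable_inner h₂.memLp_grad hX)]
    linarith

/-! ### Homogeneous extensions `r^β c(θ)`. -/

/-- The function `r ^ β c(θ)`. -/
def homogPow (β : ℝ) (c : S d → ℝ) : E d → ℝ := radialLift fun p => p.2.1 ^ β * c p.1

/-- The gradient of `r ^ β c(θ)`, where `g` is the tangential gradient of `c`. -/
def homogGrad (β : ℝ) (c : S d → ℝ) (g : S d → E d) : E d → E d :=
  radialLift fun p => p.2.1 ^ (β - 1) • ((β * c p.1) • (p.1 : E d) + g p.1)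

theorem homogPow_polar (β : ℝ) (c : S d → ℝ) (p : S d × Ioi (0 : ℝ)) :
    homogPow β c (polar d p) = p.2.1 ^ β * c p.1 := radialLift_polar _ p

theorem homogGrad_polar (β : ℝ) (c : S d → ℝ) (g : S d → E d) (p : S d × Ioi (0 : ℝ)) :
    homogGrad β c g (polar d p) = p.2.1 ^ (β - 1) • ((β * c p.1) • (p.1 : E d) + g p.1) :=
  radialLift_polar _ p

theorem homogExt_eq_homogPow (c : S d → ℝ) : homogExt c = homogPow 2 c := by
  rw [homogExt_eq_radialLift, homogPow]
  simp

theorem ae_prod_radial_lt_one :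
    ∀ᵐ p ∂((surfaceMeasure d).prod (radial d)), p.2.1 < 1 :=
  Measure.quasiMeasurePreserving_snd.ae ae_radial_lt_one

theorem memLp_rpow_prod {β : ℝ} (hβ : 0 ≤ β) {q : ENNReal} :
    MemLp (fun p : S d × Ioi (0 : ℝ) => p.2.1 ^ β) q ((surfaceMeasure d).prod (radial d)) := by
  refine MemLp.of_bound (Measurable.aestronglyMeasurable (by fun_prop)) 1 ?_
  filter_upwards [ae_prod_radial_lt_one] with p hp
  have h0 : (0 : ℝ) ≤ p.2.1 := (mem_Ioi.1 p.2.2).le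
  rw [Real.norm_of_nonneg (Real.rpow_nonneg h0 _)]
  exact Real.rpow_le_one h0 hp.le hβ

theorem memLp_rpow_smul_prod {F : Type*} [NormedAddCommGroup F] [NormedSpace ℝ F] {β : ℝ}
    (hβ : 0 ≤ β) {f : S d × Ioi (0 : ℝ) → F}
    (hf : MemLp f 2 ((surfaceMeasure d).prod (radial d))) :
    MemLp (fun p => p.2.1 ^ β • f p) 2 ((surfaceMeasure d).prod (radial d)) :=
  MemLp.smul hf (memLp_rpow_prod (q := ⊤) hβ)

theorem memLp_polar_of_continuous [NeZero d] {F : Type*} [NormedAddCommGroup F] {f : E d → F}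
    (hf : Continuous f) {q : ENNReal} :
    MemLp (fun p => f (polar d p)) q ((surfaceMeasure d).prod (radial d)) :=
  (memLp_ball_iff f).1 (Continuous.memLp_ball hf)

theorem memLp_gradient_sphere {c : S d → ℝ} {g : S d → E d} (h : HasSphereWeakGradient c g)
    (β : ℝ) : MemLp (fun θ => (β * c θ) • (θ : E d) + g θ) 2 (surfaceMeasure d) := by
  refine MemLp.add ?_ h.memLp_grad
  refine MemLp.smul (p := 2) (q := ⊤) (r := 2) (f := fun θ : S d => (θ : E d))
    (φ := fun θ => β * c θ) ?_ (h.memLp.const_mul β)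
  exact Continuous.memLp_sphere continuous_subtype_val

theorem sphereDivergence_dilation {X : E d → E d} (hX : Differentiable ℝ X) (r : ℝ) (θ : S d) :
    sphereDivergence (fun x => X (r • x)) θ
      = r * (divergence X (r • (θ : E d))
        - inner ℝ (fderiv ℝ X (r • (θ : E d)) θ) (θ : E d)) := by
  have h1 : HasFDerivAt (fun x : E d => r • x) (r • ContinuousLinearMap.id ℝ (E d)) (θ : E d) :=
    (hasFDerivAt_id _).const_smul r
  have h2 : HasFDerivAt (fun x => X (r • x)) (r • fderiv ℝ X (r • (θ : E d))) (θ : E d) := by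
    refine ((hX (r • (θ : E d))).hasFDerivAt.comp (θ : E d) h1).congr_fderiv ?_
    ext v; simp
  rw [sphereDivergence, divergence_eq_traceE, h2.fderiv, traceE_smul, divergence_eq_traceE]
  simp [inner_smul_left]
  ring

/-- With the weight `r^(d-1)` the integrand is the derivative of `r^(β+d-1) X(rθ) · θ` along the
ray; the endpoint `0` contributes nothing because the exponent is positive. -/
theorem integral_radial_derivative [NeZero d] {X : E d → E d} (hX : ContDiff ℝ 1 X) {β : ℝ}
    (hβ : 1 ≤ β) (θ : S d) :
    ∫ r, (r.1 ^ β * inner ℝ (fderiv ℝ X (r.1 • (θ : E d)) θ) (θ : E d)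
        + (β + d - 1) * (r.1 ^ (β - 1) * inner ℝ (X (r.1 • (θ : E d))) (θ : E d))) ∂(radial d)
      = inner ℝ (X θ) (θ : E d) := by
  rw [integral_radial fun r => r ^ β * inner ℝ (fderiv ℝ X (r • (θ : E d)) θ) (θ : E d)
        + (β + d - 1) * (r ^ (β - 1) * inner ℝ (X (r • (θ : E d))) (θ : E d))]
  have hd : (1 : ℝ) ≤ d := by exact_mod_cast NeZero.one_le
  set w : ℝ → ℝ := fun r => inner ℝ (X (r • (θ : E d))) (θ : E d) with hw
  have hXc := hX.continuous
  have hXf := hX.continuous_fderiv one_ne_zero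
  have hwd : ∀ r, HasDerivAt w (inner ℝ (fderiv ℝ X (r • (θ : E d)) θ) (θ : E d)) r := fun r => by
    have h1 : HasDerivAt (fun r : ℝ => r • (θ : E d)) ((1 : ℝ) • (θ : E d)) r :=
      (hasDerivAt_id r).smul_const _
    rw [one_smul] at h1
    have h2 := (hX.differentiable one_ne_zero (r • (θ : E d))).hasFDerivAt.comp_hasDerivAt r h1
    simpa using h2.inner ℝ (hasDerivAt_const r (θ : E d))
  have hwc : Continuous w := by rw [hw]; fun_prop
  set a : ℝ := d - 1 + β with ha
  have ha1 : 0 ≤ a - 1 := by linarith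
  have hc1 : Continuous fun r : ℝ => r ^ a := Real.continuous_rpow_const (by linarith)
  have hc2 : Continuous fun r : ℝ => r ^ (a - 1) := Real.continuous_rpow_const ha1
  have hcD : Continuous fun r : ℝ => inner ℝ (fderiv ℝ X (r • (θ : E d)) θ) (θ : E d) := by fun_prop
  have key := intervalIntegral.integral_eq_sub_of_hasDerivAt_of_le (a := 0) (b := 1)
    (f := fun r => r ^ a * w r) (f' := fun r => a * r ^ (a - 1) * w r
      + r ^ a * inner ℝ (fderiv ℝ X (r • (θ : E d)) θ) (θ : E d))
    zero_le_one (hc1.mul hwc).continuousOn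
    (fun r hr => (Real.hasDerivAt_rpow_const (Or.inl hr.1.ne')).mul (hwd r))
    (Continuous.intervalIntegrable (by fun_prop) _ _)
  have h0 : (0 : ℝ) ^ a = 0 := Real.zero_rpow (by linarith)
  have h1 : w 1 = inner ℝ (X θ) (θ : E d) := by simp [hw]
  rw [h0, Real.one_rpow, h1, zero_mul, one_mul, sub_zero] at key
  rw [← key]
  refine intervalIntegral.integral_congr_ae (Eventually.of_forall fun r hr => ?_)
  rw [uIoc_of_le zero_le_one] at hr
  have hp : ∀ x : ℝ, r ^ (d - 1) * r ^ x = r ^ ((d : ℝ) - 1 + x) := fun x => by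
    rw [Real.rpow_add hr.1, ← Real.rpow_natCast, Nat.cast_sub NeZero.one_le]
    simp
  have h3 : (d : ℝ) - 1 + (β - 1) = a - 1 := by rw [ha]; ring
  rw [smul_eq_mul, mul_add, ← mul_assoc, hp, ← mul_assoc, mul_comm (r ^ (d - 1)), mul_assoc,
    ← mul_assoc (r ^ (d - 1)), hp, h3]
  rw [show β + d - 1 = a by rw [ha]; ring]
  ring

/-- Fubini in polar coordinates: on each sphere of radius `r` the tangential term is integrated by
parts using the weak gradient of `c`, and what is left is an exact derivative along each ray. The
condition `β ≥ 1` makes the factor `r^(β-1)` of the gradient bounded. -/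
theorem hasGreen_homogPow [NeZero d] {c : S d → ℝ} {g : S d → E d}
    (h : HasSphereWeakGradient c g) {β : ℝ} (hβ : 1 ≤ β) :
    HasGreen (homogPow β c) (homogGrad β c g) c where
  memLp := by
    rw [memLp_ball_iff]
    simp_rw [homogPow_polar]
    exact memLp_rpow_smul_prod (by linarith) (h.memLp.comp_fst _)
  memLp_grad := by
    rw [memLp_ball_iff]
    simp_rw [homogGrad_polar]
    exact memLp_rpow_smul_prod (by linarith) ((memLp_gradient_sphere h β).comp_fst _)
  memLp_trace := h.memLp
  green := fun X hX => by
    have hX1 : ContDiff ℝ 1 X := hX.of_le (by exact_mod_cast le_top)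
    have hXc := hX1.continuous
    have hXf := hX1.continuous_fderiv one_ne_zero
    have hXd := continuous_divergence hX1
    rw [integral_ball_eq]
    simp_rw [homogPow_polar, homogGrad_polar]
    set M := (surfaceMeasure d).prod (radial d) with hM
    have hcM : MemLp (fun p : S d × Ioi (0 : ℝ) => c p.1) 2 M := h.memLp.comp_fst _
    have hgM : MemLp (fun p : S d × Ioi (0 : ℝ) => g p.1) 2 M := h.memLp_grad.comp_fst _
    have hθM : MemLp (fun p : S d × Ioi (0 : ℝ) => (p.1 : E d)) ⊤ M :=
      MemLp.comp_fst (Continuous.memLp_sphere continuous_subtype_val) _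
    have hX2 : MemLp (fun p => X (polar d p)) 2 M := memLp_polar_of_continuous hXc
    have hD2 : MemLp (fun p => divergence X (polar d p)) 2 M := memLp_polar_of_continuous hXd
    have hT2 : MemLp (fun p : S d × Ioi (0 : ℝ) => inner ℝ (X (polar d p)) (p.1 : E d)) 2 M := by
      refine hX2.norm.of_le (hX2.1.inner hθM.1) (Eventually.of_forall fun p => ?_)
      simpa using norm_inner_le_norm (𝕜 := ℝ) (X (polar d p)) (p.1 : E d)
    have hF2 : MemLp (fun p : S d × Ioi (0 : ℝ) =>
        inner ℝ (fderiv ℝ X (polar d p) (p.1 : E d)) (p.1 : E d)) 2 M := by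
      have hf : MemLp (fun p => fderiv ℝ X (polar d p)) 2 M := memLp_polar_of_continuous hXf
      refine hf.norm.of_le ?_ (Eventually.of_forall fun p => ?_)
      · have hcp := continuous_polar (d := d)
        exact Continuous.aestronglyMeasurable (by fun_prop)
      · have h1 := norm_inner_le_norm (𝕜 := ℝ) (fderiv ℝ X (polar d p) (p.1 : E d)) (p.1 : E d)
        have h2 := (fderiv ℝ X (polar d p)).le_opNorm (p.1 : E d)
        simp only [norm_sphere, mul_one] at h1 h2
        simpa using h1.trans h2
    have hβ0 : 0 ≤ β := by linarith
    have hβ1 : 0 ≤ β - 1 := by linarith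
    have i1 : Integrable (fun p => p.2.1 ^ β * c p.1 * divergence X (polar d p)) M :=
      MemLp.integrable_mul_two (memLp_rpow_smul_prod hβ0 hcM) hD2
    have i2 : Integrable (fun p => β * (p.2.1 ^ (β - 1) * c p.1
        * inner ℝ (X (polar d p)) (p.1 : E d))) M :=
      (MemLp.integrable_mul_two (memLp_rpow_smul_prod hβ1 hcM) hT2).const_mul β
    have i3 : Integrable (fun p => inner ℝ (p.2.1 ^ (β - 1) • g p.1) (X (polar d p))) M :=
      MemLp.integrable_inner_two (memLp_rpow_smul_prod hβ1 hgM) hX2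
    have i4 : Integrable (fun p => p.2.1 ^ β * c p.1 *
        inner ℝ (fderiv ℝ X (polar d p) (p.1 : E d)) (p.1 : E d)) M :=
      MemLp.integrable_mul_two (memLp_rpow_smul_prod hβ0 hcM) hF2
    have i5 : Integrable (fun p => (d - 1 : ℝ) * (p.2.1 ^ (β - 1) * c p.1
        * inner ℝ (X (polar d p)) (p.1 : E d))) M :=
      (MemLp.integrable_mul_two (memLp_rpow_smul_prod hβ1 hcM) hT2).const_mul _
    -- Tangential integration by parts at fixed `r`, with the dilated test field `X(r ·)`, which
    -- need not be tangent.
    have h3 : ∫ p, inner ℝ (p.2.1 ^ (β - 1) • g p.1) (X (polar d p)) ∂M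
        = ∫ p, (-(p.2.1 ^ β * c p.1 * divergence X (polar d p))
          + p.2.1 ^ β * c p.1 * inner ℝ (fderiv ℝ X (polar d p) (p.1 : E d)) (p.1 : E d)
          + (d - 1 : ℝ) * (p.2.1 ^ (β - 1) * c p.1
              * inner ℝ (X (polar d p)) (p.1 : E d))) ∂M := by
      rw [hM, integral_prod_symm _ i3, integral_prod_symm _ ((i1.fun_neg.fun_add i4).fun_add i5)]
      refine integral_congr_ae (Eventually.of_forall fun r => ?_)
      have hr : (0 : ℝ) < r.1 := r.2
      have h4 := h.integral_eq_of_smooth (X := fun x => X (r.1 • x))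
        (hX.comp (contDiff_id.const_smul r.1))
      simp only [inner_smul_left, polar, RCLike.conj_to_real] at h4 ⊢
      rw [integral_const_mul, ← neg_eq_iff_eq_neg.2 h4, ← integral_neg, ← integral_const_mul]
      refine integral_congr_ae (Eventually.of_forall fun θ => ?_)
      simp only [sphereDivergence_dilation (hX1.differentiable one_ne_zero)]
      rw [show r.1 ^ β = r.1 ^ (β - 1) * r.1 by rw [← Real.rpow_add_one hr.ne']; simp]
      ring
    have hsplit : ∀ p : S d × Ioi (0 : ℝ), p.2.1 ^ β * c p.1 * divergence X (polar d p)
        + inner ℝ (p.2.1 ^ (β - 1) • ((β * c p.1) • (p.1 : E d) + g p.1)) (X (polar d p))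
        = (p.2.1 ^ β * c p.1 * divergence X (polar d p) + β * (p.2.1 ^ (β - 1) * c p.1
            * inner ℝ (X (polar d p)) (p.1 : E d)))
          + inner ℝ (p.2.1 ^ (β - 1) • g p.1) (X (polar d p)) := fun p => by
      rw [smul_add, inner_add_left, inner_smul_left, inner_smul_left, real_inner_comm (p.1 : E d)]
      simp; ring
    simp_rw [hsplit]
    rw [integral_add (i1.fun_add i2) i3, h3, ← integral_add (i1.fun_add i2) ((i1.fun_neg.fun_add i4).fun_add i5)]
    -- The full divergences cancel, leaving the radial derivative and the terms of order `r^(β-1)`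
    -- handled by `integral_radial_derivative`.
    have hcomb : ∀ p : S d × Ioi (0 : ℝ), (p.2.1 ^ β * c p.1 * divergence X (polar d p)
          + β * (p.2.1 ^ (β - 1) * c p.1 * inner ℝ (X (polar d p)) (p.1 : E d)))
        + (-(p.2.1 ^ β * c p.1 * divergence X (polar d p))
          + p.2.1 ^ β * c p.1 * inner ℝ (fderiv ℝ X (polar d p) (p.1 : E d)) (p.1 : E d)
          + (d - 1 : ℝ) * (p.2.1 ^ (β - 1) * c p.1 * inner ℝ (X (polar d p)) (p.1 : E d)))
        = p.2.1 ^ β * c p.1 * inner ℝ (fderiv ℝ X (polar d p) (p.1 : E d)) (p.1 : E d)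
          + (β * (p.2.1 ^ (β - 1) * c p.1 * inner ℝ (X (polar d p)) (p.1 : E d))
          + (d - 1 : ℝ) * (p.2.1 ^ (β - 1) * c p.1 * inner ℝ (X (polar d p)) (p.1 : E d))) :=
      fun p => by ring
    simp_rw [hcomb]
    rw [hM, integral_prod _ (i4.fun_add (i2.fun_add i5))]
    refine integral_congr_ae (Eventually.of_forall fun θ => ?_)
    simp only
    rw [← integral_radial_derivative hX1 hβ θ, ← integral_const_mul]
    refine integral_congr_ae (Eventually.of_forall fun r => ?_)
    simp only [polar]
    ring

/-! ### Polynomials and the Laplace-Beltrami operator. -/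

/-- Real polynomials in `d` variables. -/
abbrev Poly (d : ℕ) : Type := MvPolynomial (Fin d) ℝ

/-- The polynomial function on `ℝ^d` defined by a polynomial. -/
def ev (p : Poly d) (x : E d) : ℝ := MvPolynomial.eval x.ofLp p

/-- The gradient of a polynomial. -/
def polyGrad (p : Poly d) (x : E d) : E d :=
  WithLp.toLp 2 fun i => ev (MvPolynomial.pderiv i p) x

theorem ev_add (p q : Poly d) (x : E d) : ev (p + q) x = ev p x + ev q x := by simp [ev]

theorem ev_sub (p q : Poly d) (x : E d) : ev (p - q) x = ev p x - ev q x := by simp [ev]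

theorem ev_mul (p q : Poly d) (x : E d) : ev (p * q) x = ev p x * ev q x := by simp [ev]

theorem ev_smul (a : ℝ) (p : Poly d) (x : E d) : ev (a • p) x = a * ev p x := by simp [ev]

theorem ev_X (i : Fin d) (x : E d) : ev (MvPolynomial.X i) x = x i := by simp [ev]

theorem ev_sum {ι : Type*} (s : Finset ι) (p : ι → Poly d) (x : E d) :
    ev (∑ i ∈ s, p i) x = ∑ i ∈ s, ev (p i) x := by simp [ev]

theorem polyGrad_apply (p : Poly d) (x : E d) (i : Fin d) :
    polyGrad p x i = ev (MvPolynomial.pderiv i p) x := rfl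

theorem polyGrad_add (p q : Poly d) (x : E d) :
    polyGrad (p + q) x = polyGrad p x + polyGrad q x := by
  ext i; simp [polyGrad_apply, ev_add]

theorem polyGrad_smul (a : ℝ) (p : Poly d) (x : E d) :
    polyGrad (a • p) x = a • polyGrad p x := by
  ext i; simp [polyGrad_apply, ev_smul]

theorem hasFDerivAt_ev (p : Poly d) (x : E d) :
    HasFDerivAt (ev p) (innerSL ℝ (polyGrad p x)) x := by
  induction p using MvPolynomial.induction_on with
  | C a =>
    have h1 : ev (MvPolynomial.C a : Poly d) = fun _ => a := by ext y; simp [ev]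
    have h2 : polyGrad (MvPolynomial.C a) x = 0 := by ext i; simp [polyGrad_apply, ev]
    rw [h1, h2, map_zero]
    exact hasFDerivAt_const a x
  | add p q hp hq =>
    have h1 : ev (p + q) = fun y => ev p y + ev q y := funext fun y => ev_add p q y
    rw [h1, polyGrad_add, map_add]
    exact hp.add hq
  | mul_X p j hp =>
    have h1 : ev (p * MvPolynomial.X j) = fun y => ev p y * y j :=
      funext fun y => by rw [ev_mul, ev_X]
    rw [h1]
    have h2 : HasFDerivAt (fun y : E d => y j) (EuclideanSpace.proj j : E d →L[ℝ] ℝ) x :=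
      (EuclideanSpace.proj j : E d →L[ℝ] ℝ).hasFDerivAt
    refine (hp.mul h2).congr_fderiv ?_
    have h3 : polyGrad (p * MvPolynomial.X j) x
        = x j • polyGrad p x + ev p x • EuclideanSpace.single j 1 := by
      ext i
      rw [polyGrad_apply, MvPolynomial.pderiv_mul, MvPolynomial.pderiv_X, ev_add, ev_mul, ev_mul,
        ev_X]
      by_cases hij : i = j
      · subst hij; simp [polyGrad_apply, ev]; ring
      · simp [polyGrad_apply, ev, hij, Ne.symm hij]; ring
    rw [h3]
    ext v
    rw [innerSL_apply_apply, inner_add_left]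
    simp [inner_smul_left, EuclideanSpace.inner_single_left]
    ring

theorem contDiff_ev (p : Poly d) {k : WithTop ℕ∞} : ContDiff ℝ k (ev p) := by
  induction p using MvPolynomial.induction_on with
  | C a =>
    have h1 : ev (MvPolynomial.C a : Poly d) = fun _ => a := by ext y; simp [ev]
    rw [h1]; exact contDiff_const
  | add p q hp hq =>
    have h1 : ev (p + q) = fun y => ev p y + ev q y := funext fun y => ev_add p q y
    rw [h1]; exact hp.add hq
  | mul_X p j hp =>
    have h1 : ev (p * MvPolynomial.X j) = fun y => ev p y * y j :=
      funext fun y => by rw [ev_mul, ev_X]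
    rw [h1]
    exact hp.mul (contDiff_euclidean.1 contDiff_id j)

theorem contDiff_polyGrad (p : Poly d) {k : WithTop ℕ∞} : ContDiff ℝ k (polyGrad p) :=
  contDiff_euclidean.2 fun _ => contDiff_ev _

theorem fderiv_polyGrad_apply (p : Poly d) (x v : E d) (i : Fin d) :
    (fderiv ℝ (polyGrad p) x v) i = inner ℝ (polyGrad (MvPolynomial.pderiv i p) x) v := by
  have h1 : HasFDerivAt (fun y => polyGrad p y i)
      ((EuclideanSpace.proj i : E d →L[ℝ] ℝ).comp (fderiv ℝ (polyGrad p) x)) x :=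
    (EuclideanSpace.proj i : E d →L[ℝ] ℝ).hasFDerivAt.comp x
      ((contDiff_polyGrad p (k := 1)).differentiable one_ne_zero x).hasFDerivAt
  have h2 := h1.unique (hasFDerivAt_ev (MvPolynomial.pderiv i p) x)
  have h3 := congrArg (fun L : E d →L[ℝ] ℝ => L v) h2
  simpa using h3

/-- The Euler operator `∑ xᵢ ∂ᵢ`. -/
def eulerOp : Poly d →ₗ[ℝ] Poly d :=
  ∑ i, (LinearMap.mulLeft ℝ (MvPolynomial.X i)) ∘ₗ (MvPolynomial.pderiv i).toLinearMap

/-- The Laplacian on polynomials. -/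
def laplaceOp : Poly d →ₗ[ℝ] Poly d :=
  ∑ i, (MvPolynomial.pderiv i).toLinearMap ∘ₗ (MvPolynomial.pderiv i).toLinearMap

/-- A polynomial representing the Laplace-Beltrami operator of the sphere. -/
def sphereLaplaceOp : Poly d →ₗ[ℝ] Poly d :=
  laplaceOp - eulerOp ∘ₗ eulerOp - ((d : ℝ) - 2) • eulerOp

theorem eulerOp_apply (p : Poly d) :
    eulerOp p = ∑ i, MvPolynomial.X i * MvPolynomial.pderiv i p := by
  simp [eulerOp]

theorem laplaceOp_apply (p : Poly d) :
    laplaceOp p = ∑ i, MvPolynomial.pderiv i (MvPolynomial.pderiv i p) := by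
  simp [laplaceOp]

theorem ev_eulerOp (p : Poly d) (x : E d) : ev (eulerOp p) x = inner ℝ (polyGrad p x) x := by
  rw [eulerOp_apply, ev_sum, PiLp.inner_apply]
  refine Finset.sum_congr rfl fun i _ => ?_
  rw [ev_mul, ev_X]; simp [polyGrad_apply]

theorem divergence_polyGrad (p : Poly d) (x : E d) :
    divergence (polyGrad p) x = ev (laplaceOp p) x := by
  rw [laplaceOp_apply, ev_sum, divergence]
  refine Finset.sum_congr rfl fun i _ => ?_
  rw [fderiv_polyGrad_apply, EuclideanSpace.inner_single_right]
  simp [polyGrad_apply]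

theorem ev_eulerOp_eulerOp (p : Poly d) (x : E d) :
    ev (eulerOp (eulerOp p)) x
      = inner ℝ (fderiv ℝ (polyGrad p) x x) x + inner ℝ (polyGrad p x) x := by
  rw [ev_eulerOp]
  have h1 := hasFDerivAt_ev (eulerOp p) x
  rw [show ev (eulerOp p) = fun y => inner ℝ (polyGrad p y) y from funext (ev_eulerOp p)] at h1
  have h2 := ((contDiff_polyGrad p (k := 1)).differentiable one_ne_zero x).hasFDerivAt.inner ℝ
    (hasFDerivAt_id x)
  have h3 := congrArg (fun L : E d →L[ℝ] ℝ => L x) (h1.unique h2)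
  simp only [innerSL_apply_apply] at h3
  rw [h3]
  simp [add_comm]

/-- With `D = r ∂_r` the Euler operator, the polar formula for the Laplacian at `r = 1` reads `Δ =
(D² - D) + (d - 1) D + Δ_S`, so `Δ_S = Δ - D² - (d - 2) D`. -/
theorem sphereDivergence_polyGrad (p : Poly d) (θ : S d) :
    sphereDivergence (polyGrad p) θ - (d - 1) * inner ℝ (polyGrad p θ) (θ : E d)
      = ev (sphereLaplaceOp p) θ := by
  have h : sphereLaplaceOp p
      = laplaceOp p - eulerOp (eulerOp p) - ((d : ℝ) - 2) • eulerOp p := rfl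
  rw [h, ev_sub, ev_sub, ev_smul, sphereDivergence, divergence_polyGrad, ev_eulerOp_eulerOp,
    ev_eulerOp]
  ring

/-- Polynomials of total degree at most `N`. -/
abbrev PolyDeg (d N : ℕ) : Submodule ℝ (Poly d) := MvPolynomial.restrictTotalDegree (Fin d) ℝ N

theorem monomial_mem_polyDeg {s : Fin d →₀ ℕ} {N : ℕ} (h : s.degree ≤ N) (a : ℝ) :
    MvPolynomial.monomial s a ∈ PolyDeg d N := by
  rw [MvPolynomial.mem_restrictTotalDegree]
  refine (MvPolynomial.totalDegree_monomial_le s a).trans ?_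
  rw [Finsupp.sum_fintype _ _ (by simp)]
  rwa [Finsupp.degree_eq_sum] at h

theorem polyDeg_induction {N : ℕ} (W : Submodule ℝ (Poly d)) (L : Poly d →ₗ[ℝ] Poly d)
    (h : ∀ (s : Fin d →₀ ℕ) (a : ℝ), s.degree ≤ N → L (MvPolynomial.monomial s a) ∈ W)
    {p : Poly d} (hp : p ∈ PolyDeg d N) : L p ∈ W := by
  rw [p.as_sum, map_sum]
  refine Submodule.sum_mem _ fun s hs => h s _ ?_
  rw [MvPolynomial.mem_restrictTotalDegree] at hp
  have := MvPolynomial.le_totalDegree hs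
  rw [Finsupp.degree_eq_sum, ← Finsupp.sum_fintype (f := s) (g := fun _ e => e) (by simp)]
  exact this.trans hp

theorem polyDeg_mono {M N : ℕ} (h : M ≤ N) : PolyDeg d M ≤ PolyDeg d N := fun p hp => by
  rw [MvPolynomial.mem_restrictTotalDegree] at hp ⊢
  exact hp.trans h

theorem eulerOp_monomial (s : Fin d →₀ ℕ) (a : ℝ) :
    eulerOp (MvPolynomial.monomial s a) = (s.degree : ℝ) • MvPolynomial.monomial s a := by
  rw [eulerOp_apply]
  simp_rw [MvPolynomial.X_mul_pderiv_monomial]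
  rw [← Finset.sum_smul, Finsupp.degree_eq_sum, Nat.cast_smul_eq_nsmul]

/-- The Laplacian lowers the degree by two; a drop by one is enough for the induction on the degree.
-/
theorem laplaceOp_monomial_mem {s : Fin d →₀ ℕ} {N : ℕ} (h : s.degree ≤ N + 1) (a : ℝ) :
    laplaceOp (MvPolynomial.monomial s a) ∈ PolyDeg d N := by
  rw [laplaceOp_apply]
  refine Submodule.sum_mem _ fun i _ => ?_
  rw [MvPolynomial.pderiv_monomial, MvPolynomial.pderiv_monomial]
  by_cases hi : s i = 0
  · simp [hi]
  · refine monomial_mem_polyDeg ?_ _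
    have h1 : s.degree = (s - Finsupp.single i 1).degree + 1 := by
      have h3 : s = (s - Finsupp.single i 1) + Finsupp.single i 1 := by
        ext j
        by_cases hj : j = i
        · subst hj; simp; omega
        · simp [Ne.symm hj]
      conv_lhs => rw [h3]
      rw [map_add]; simp
    have h2 : (s - Finsupp.single i 1 - Finsupp.single i 1).degree
        ≤ (s - Finsupp.single i 1).degree := by
      rw [Finsupp.degree_eq_sum, Finsupp.degree_eq_sum]
      exact Finset.sum_le_sum fun j _ => by simp
    omega

theorem sphereLaplaceOp_monomial (s : Fin d →₀ ℕ) (a : ℝ) :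
    sphereLaplaceOp (MvPolynomial.monomial s a) = laplaceOp (MvPolynomial.monomial s a)
      - ((s.degree : ℝ) * (s.degree + d - 2)) • MvPolynomial.monomial s a := by
  have h : sphereLaplaceOp (MvPolynomial.monomial s a) = laplaceOp (MvPolynomial.monomial s a)
    - eulerOp (eulerOp (MvPolynomial.monomial s a))
    - ((d : ℝ) - 2) • eulerOp (MvPolynomial.monomial s a) := rfl
  rw [h, eulerOp_monomial, map_smul, eulerOp_monomial, smul_smul, smul_smul, sub_sub, ← add_smul]
  congr 2
  ring

theorem sphereLaplaceOp_mem {N : ℕ} {p : Poly d} (hp : p ∈ PolyDeg d N) :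
    sphereLaplaceOp p ∈ PolyDeg d N := by
  refine polyDeg_induction _ _ (fun s a hs => ?_) hp
  rw [sphereLaplaceOp_monomial]
  exact Submodule.sub_mem _ (laplaceOp_monomial_mem (hs.trans (Nat.le_succ N)) a)
    (Submodule.smul_mem _ _ (monomial_mem_polyDeg hs a))

/-- Modulo lower degree, `-Δ_S` multiplies the top degree part by `(N + 1)(N + d - 1)`, because the
Laplacian lowers the degree. This substitutes for a decomposition into spherical harmonics. -/
theorem sphereLaplaceOp_add_mem {N : ℕ} {p : Poly d} (hp : p ∈ PolyDeg d (N + 1)) :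
    sphereLaplaceOp p + (((N + 1 : ℕ) : ℝ) * ((N + 1 : ℕ) + d - 2)) • p ∈ PolyDeg d N := by
  have := polyDeg_induction (N := N + 1) (PolyDeg d N)
    (sphereLaplaceOp + (((N + 1 : ℕ) : ℝ) * ((N + 1 : ℕ) + d - 2)) • LinearMap.id)
    (fun s a hs => ?_) hp
  · simpa using this
  · rw [LinearMap.add_apply, LinearMap.smul_apply, LinearMap.id_apply, sphereLaplaceOp_monomial]
    rcases hs.lt_or_eq with h | h
    · exact Submodule.add_mem _ (Submodule.sub_mem _ (laplaceOp_monomial_mem hs a)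
        (Submodule.smul_mem _ _ (monomial_mem_polyDeg (Nat.lt_succ_iff.1 h) a)))
        (Submodule.smul_mem _ _ (monomial_mem_polyDeg (Nat.lt_succ_iff.1 h) a))
    · rw [h, sub_add_cancel]
      exact laplaceOp_monomial_mem hs a

/-! ### Polynomials in `L²` of the sphere and the spectral gap. -/

theorem inner_toLp_toLp {α F : Type*} [MeasurableSpace α] {μ : Measure α}
    [NormedAddCommGroup F] [InnerProductSpace ℝ F] {f g : α → F} (hf : MemLp f 2 μ)
    (hg : MemLp g 2 μ) : inner ℝ (hf.toLp f) (hg.toLp g) = ∫ x, inner ℝ (f x) (g x) ∂μ := by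
  rw [L2.inner_def]
  refine integral_congr_ae ?_
  filter_upwards [hf.coeFn_toLp, hg.coeFn_toLp] with x h1 h2
  rw [h1, h2]

theorem inner_toLp_real {α : Type*} [MeasurableSpace α] {μ : Measure α}
    {f g : α → ℝ} (hf : MemLp f 2 μ)
    (hg : MemLp g 2 μ) : inner ℝ (hf.toLp f) (hg.toLp g) = ∫ x, f x * g x ∂μ := by
  rw [inner_toLp_toLp]
  simp [mul_comm]

/-- The tangential part of the gradient of a polynomial on the sphere. -/
def tangentGrad (p : Poly d) (θ : S d) : E d :=
  polyGrad p θ - inner ℝ (polyGrad p θ) (θ : E d) • (θ : E d)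

theorem hasSphereWeakGradient_ev [NeZero d] (p : Poly d) :
    HasSphereWeakGradient (fun θ : S d => ev p θ) (tangentGrad p) :=
  HasSphereWeakGradient.of_gradient (contDiff_ev p) (hasFDerivAt_ev p)
    (contDiff_polyGrad p (k := 0)).continuous

theorem memLp_ev (p : Poly d) {q : ENNReal} : MemLp (fun θ : S d => ev p θ) q (surfaceMeasure d) :=
  Continuous.memLp_sphere ((contDiff_ev p (k := 0)).continuous.comp continuous_subtype_val)

theorem memLp_tangentGrad (p : Poly d) {q : ENNReal} :
    MemLp (tangentGrad p) q (surfaceMeasure d) :=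
  Continuous.memLp_sphere (by
    have := (contDiff_polyGrad p (k := 0)).continuous
    unfold tangentGrad; fun_prop)

/-- The class in `L²(∂B₁)` of a polynomial. -/
def evLp : Poly d →ₗ[ℝ] Lp ℝ 2 (surfaceMeasure d) where
  toFun p := (memLp_ev p).toLp _
  map_add' p q := by
    rw [← MemLp.toLp_add]
    exact MemLp.toLp_congr _ _ (Eventually.of_forall fun θ => by simp [ev_add])
  map_smul' a p := by
    rw [RingHom.id_apply, ← MemLp.toLp_const_smul]
    exact MemLp.toLp_congr _ _ (Eventually.of_forall fun θ => by simp [ev_smul])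

/-- The class in `L²(∂B₁)` of the tangential gradient of a polynomial. -/
def gradLp : Poly d →ₗ[ℝ] Lp (E d) 2 (surfaceMeasure d) where
  toFun p := (memLp_tangentGrad p).toLp _
  map_add' p q := by
    rw [← MemLp.toLp_add]
    refine MemLp.toLp_congr _ _ (Eventually.of_forall fun θ => ?_)
    simp only [tangentGrad, polyGrad_add, inner_add_left, add_smul, Pi.add_apply]
    abel
  map_smul' a p := by
    rw [RingHom.id_apply, ← MemLp.toLp_const_smul]
    refine MemLp.toLp_congr _ _ (Eventually.of_forall fun θ => ?_)
    simp [tangentGrad, polyGrad_smul, inner_smul_left, smul_sub, smul_smul]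

/-- The defining weak formula tested with the field `∇q`: it moves all derivatives from an `H¹`
function to a polynomial, so spectral arguments need no regularity of `c`. -/
theorem inner_gradLp {c : S d → ℝ} {g : S d → E d} (h : HasSphereWeakGradient c g)
    (q : Poly d) : inner ℝ (h.memLp_grad.toLp g) (gradLp q)
      = - inner ℝ (h.memLp.toLp c) (evLp (sphereLaplaceOp q)) := by
  have h1 := h.integral_inner_tangent (contDiff_polyGrad q)
  simp_rw [sphereDivergence_polyGrad] at h1
  have h2 := inner_toLp_toLp h.memLp_grad (memLp_tangentGrad q)
  have h3 := inner_toLp_real h.memLp (memLp_ev (sphereLaplaceOp q))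
  exact h2.trans (h1.trans (congrArg _ h3.symm))

theorem inner_gradLp_gradLp [NeZero d] (p q : Poly d) :
    inner ℝ (gradLp p) (gradLp q) = - inner ℝ (evLp p) (evLp (sphereLaplaceOp q)) :=
  inner_gradLp (hasSphereWeakGradient_ev p) q

/-- Orthogonal projection of `L²(∂B₁)` onto polynomials of bounded degree. -/
theorem exists_polynomial_projection (f : Lp ℝ 2 (surfaceMeasure d)) (N : ℕ) :
    ∃ p ∈ PolyDeg d N, ∀ q ∈ PolyDeg d N, inner ℝ (f - evLp p) (evLp q) = 0 := by
  set V : Submodule ℝ (Lp ℝ 2 (surfaceMeasure d)) := (PolyDeg d N).map evLp with hV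
  have : FiniteDimensional ℝ V := inferInstance
  obtain ⟨p, hp, hpe⟩ := (Submodule.mem_map).1 (V.starProjection_apply_mem f)
  refine ⟨p, hp, fun q hq => ?_⟩
  rw [hpe]
  exact V.starProjection_inner_eq_zero f (evLp q) (Submodule.mem_map_of_mem hq)

/-- Polynomials are dense in `L²(∂B₁)`. -/
theorem denseRange_evLp : DenseRange (evLp (d := d)) := by
  set coord : Fin d → C(S d, ℝ) := fun i => ⟨fun θ => (θ : E d) i, by fun_prop⟩ with hcoord
  set Φ : Poly d →ₐ[ℝ] C(S d, ℝ) := MvPolynomial.aeval coord with hΦ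
  have hΦev : ∀ p (θ : S d), Φ p θ = ev p θ := by
    intro p θ
    induction p using MvPolynomial.induction_on with
    | C a => simp [hΦ, ev]
    | add p q hp hq => simp [hp, hq, ev_add]
    | mul_X p j hp =>
      have hX : Φ (MvPolynomial.X j) θ = (θ : E d) j := by simp [hΦ, hcoord]
      rw [map_mul, ContinuousMap.mul_apply, hp, hX, ev_mul, ev_X]
  -- Stone-Weierstrass: the coordinates separate points of the sphere. Density of continuous
  -- functions in `L²` then finishes.
  have hsep : (Φ.range).SeparatesPoints := by
    intro x y hxy
    have : ∃ i, (x : E d) i ≠ (y : E d) i := by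
      by_contra! h
      exact hxy (Subtype.ext (PiLp.ext h))
    obtain ⟨i, hi⟩ := this
    refine ⟨fun θ => Φ (MvPolynomial.X i) θ, ⟨Φ (MvPolynomial.X i), ⟨_, rfl⟩, rfl⟩, ?_⟩
    simpa [hΦev, ev_X] using hi
  have htop := ContinuousMap.subalgebra_topologicalClosure_eq_top_of_separatesPoints _ hsep
  have hd1 : DenseRange Φ := by
    intro f
    have : f ∈ (Φ.range).topologicalClosure := by rw [htop]; trivial
    exact this
  have : (surfaceMeasure d).WeaklyRegular := inferInstance
  have hd2 := ContinuousMap.toLp_denseRange ℝ (surfaceMeasure d) ℝ (p := 2) (by norm_num)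
  have hd3 := hd2.comp hd1 (ContinuousMap.toLp 2 (surfaceMeasure d) ℝ).continuous
  have : (evLp (d := d) : Poly d → _) = ContinuousMap.toLp 2 (surfaceMeasure d) ℝ ∘ Φ := by
    funext p
    refine Lp.ext ?_
    refine (MemLp.coeFn_toLp (memLp_ev p)).trans ?_
    refine EventuallyEq.trans ?_ (ContinuousMap.coeFn_toLp (surfaceMeasure d) (Φ p)).symm
    exact Eventually.of_forall fun θ => (hΦev p θ).symm
  rw [this]
  exact hd3

/-- Induction on the degree. Subtracting from `q` its projection onto degree at most `N` leaves a
`w` orthogonal to lower degree with `‖∇w‖² = λ ‖w‖²`, `λ = (N + 1)(N + d - 1)`. Mixed terms vanish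
since `Δ_S` preserves the degree bound, and `λ ≥ 3(d + 1)`, the value at degree three. In degree at
most two the orthogonality forces `q` to be zero in `L²`. -/
theorem spectral_gap_polynomial [NeZero d] (N : ℕ) : ∀ q ∈ PolyDeg d N,
    (∀ r ∈ PolyDeg d 2, inner ℝ (evLp q) (evLp r) = 0) →
    3 * ((d : ℝ) + 1) * ‖evLp q‖ ^ 2 ≤ ‖gradLp q‖ ^ 2 := by
  induction N with
  | zero =>
    intro q hq h
    have := h q (polyDeg_mono (by norm_num) hq)
    rw [real_inner_self_eq_norm_sq] at this
    rw [this]; simp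
  | succ N ih =>
    intro q hq h
    by_cases hN : N + 1 ≤ 2
    · have := h q (polyDeg_mono hN hq)
      rw [real_inner_self_eq_norm_sq] at this
      rw [this]; simp
    obtain ⟨p, hp, hpq⟩ := exists_polynomial_projection (evLp q) N
    set w := q - p with hw
    have hwN : w ∈ PolyDeg d (N + 1) := Submodule.sub_mem _ hq (polyDeg_mono (Nat.le_succ N) hp)
    have hwo : ∀ r ∈ PolyDeg d N, inner ℝ (evLp w) (evLp r) = 0 := fun r hr => by
      rw [hw, map_sub]; exact hpq r hr
    have hqpw : q = p + w := by rw [hw]; abel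
    have hp2 : ∀ r ∈ PolyDeg d 2, inner ℝ (evLp p) (evLp r) = 0 := fun r hr => by
      have h1 := h r hr
      rw [hqpw, map_add, inner_add_left, hwo r (polyDeg_mono (by omega) hr), add_zero] at h1
      exact h1
    have hi := ih p hp hp2
    have hc : inner ℝ (gradLp w) (gradLp p) = 0 := by
      rw [inner_gradLp_gradLp, hwo _ (sphereLaplaceOp_mem hp), neg_zero]
    have hc2 : inner ℝ (evLp w) (evLp p) = 0 := hwo p hp
    set lam : ℝ := ((N + 1 : ℕ) : ℝ) * ((N + 1 : ℕ) + d - 2) with hlam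
    have hww : ‖gradLp w‖ ^ 2 = lam * ‖evLp w‖ ^ 2 := by
      have h1 := hwo _ (sphereLaplaceOp_add_mem hwN)
      rw [map_add, map_smul, inner_add_right, inner_smul_right, real_inner_self_eq_norm_sq] at h1
      rw [← real_inner_self_eq_norm_sq, inner_gradLp_gradLp]
      linarith
    have hlam3 : 3 * ((d : ℝ) + 1) ≤ lam := by
      have h3 : (3 : ℝ) ≤ ((N + 1 : ℕ) : ℝ) := by exact_mod_cast (by omega : 3 ≤ N + 1)
      have hd0 : (0 : ℝ) ≤ d := Nat.cast_nonneg d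
      rw [hlam]; nlinarith
    have e1 : ‖gradLp q‖ ^ 2 = ‖gradLp p‖ ^ 2 + ‖gradLp w‖ ^ 2 := by
      rw [hqpw, map_add, norm_add_sq_real, real_inner_comm, hc]; ring
    have e2 : ‖evLp q‖ ^ 2 = ‖evLp p‖ ^ 2 + ‖evLp w‖ ^ 2 := by
      rw [hqpw, map_add, norm_add_sq_real, real_inner_comm, hc2]; ring
    rw [e1, e2, hww]
    nlinarith [sq_nonneg ‖evLp w‖]

/-- A function in `H¹(∂B₁)` which is orthogonal to all polynomials of degree at most `2`
satisfies the Poincaré inequality with the third nonzero eigenvalue of the sphere. -/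
theorem spectral_gap [NeZero d] {c : S d → ℝ} {g : S d → E d} (h : HasSphereWeakGradient c g)
    (ho : ∀ r ∈ PolyDeg d 2, inner ℝ (h.memLp.toLp c) (evLp r) = 0) :
    3 * ((d : ℝ) + 1) * ‖h.memLp.toLp c‖ ^ 2 ≤ ‖h.memLp_grad.toLp g‖ ^ 2 := by
  set φ := h.memLp.toLp c
  set ψ := h.memLp_grad.toLp g
  refine le_of_forall_pos_le_add fun ε hε => ?_
  have hd0 : (0 : ℝ) < 3 * ((d : ℝ) + 1) := by positivity
  -- Chosen so that `3(d + 1) η² = ε`, the allowed loss.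
  set η := Real.sqrt (ε / (3 * ((d : ℝ) + 1))) with hη
  have hηpos : 0 < η := Real.sqrt_pos.2 (by positivity)
  obtain ⟨p, hp⟩ := denseRange_evLp.exists_dist_lt φ hηpos
  set N := max 2 p.totalDegree
  obtain ⟨q, hq, hqo⟩ := exists_polynomial_projection φ N
  have hpN : p ∈ PolyDeg d N := by
    rw [MvPolynomial.mem_restrictTotalDegree]; exact le_max_right _ _
  have hq2 : ∀ r ∈ PolyDeg d 2, inner ℝ (evLp q) (evLp r) = 0 := fun r hr => by
    have h1 := hqo r (polyDeg_mono (le_max_left _ _) hr)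
    rw [inner_sub_left, ho r hr] at h1
    linarith
  have hgap := spectral_gap_polynomial N q hq hq2
  -- Because `Δ_S q` again has degree at most `N`, the gradient of the projection is the projection
  -- of the gradient. Bessel's inequality follows, and density of polynomials is needed only in
  -- `L²`, not in `H¹`.
  have e1 : inner ℝ ψ (gradLp q) = ‖gradLp q‖ ^ 2 := by
    have h1 := hqo _ (sphereLaplaceOp_mem hq)
    rw [inner_sub_left] at h1
    rw [← real_inner_self_eq_norm_sq, inner_gradLp_gradLp, inner_gradLp h]
    linarith
  have e2 : ‖gradLp q‖ ^ 2 ≤ ‖ψ‖ ^ 2 := by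
    have h1 := sq_nonneg ‖ψ - gradLp q‖
    rw [norm_sub_sq_real, e1] at h1
    linarith
  have e3 : ‖φ‖ ^ 2 = ‖φ - evLp q‖ ^ 2 + ‖evLp q‖ ^ 2 := by
    have h1 := hqo q hq
    have h2 : φ = (φ - evLp q) + evLp q := by abel
    conv_lhs => rw [h2]
    rw [norm_add_sq_real, h1]; ring
  have e4 : ‖φ - evLp q‖ ^ 2 ≤ η ^ 2 := by
    have h1 : ‖φ - evLp p‖ ^ 2 = ‖φ - evLp q‖ ^ 2 + ‖evLp (q - p)‖ ^ 2 := by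
      have h2 : φ - evLp p = (φ - evLp q) + evLp (q - p) := by rw [map_sub]; abel
      rw [h2, norm_add_sq_real, hqo _ (Submodule.sub_mem _ hq hpN)]; ring
    have h3 : ‖φ - evLp p‖ ≤ η := by rw [← dist_eq_norm]; exact hp.le
    nlinarith [sq_nonneg ‖evLp (q - p)‖, norm_nonneg (φ - evLp p)]
  have e5 : η ^ 2 = ε / (3 * ((d : ℝ) + 1)) := Real.sq_sqrt (by positivity)
  rw [e3, mul_add]
  have e6 : 3 * ((d : ℝ) + 1) * ‖φ - evLp q‖ ^ 2 ≤ ε := by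
    calc _ ≤ 3 * ((d : ℝ) + 1) * η ^ 2 := by gcongr
      _ = ε := by rw [e5]; field_simp
  linarith

/-! ### Uniqueness of traces and explicit energy formulas. -/

/-- The trace on the sphere is unique. -/
theorem HasTrace.ae_eq {u : E d → ℝ} {τ₁ τ₂ : S d → ℝ} (h₁ : HasTrace u τ₁)
    (h₂ : HasTrace u τ₂) : τ₁ =ᵐ[surfaceMeasure d] τ₂ := by
  obtain ⟨g₁, hg₁, e₁⟩ := h₁.green
  obtain ⟨g₂, hg₂, e₂⟩ := h₂.green
  have hg := hg₁.ae_eq hg₂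
  rw [← MemLp.toLp_eq_toLp_iff h₁.memLp h₂.memLp, ← sub_eq_zero]
  refine (denseRange_evLp (d := d)).eq_zero_of_inner_left ℝ fun p => ?_
  -- The field `p(x) x` has normal component `p` on the sphere, so both traces have the same `L²`
  -- product with every polynomial.
  have hX : ContDiff ℝ (⊤ : ℕ∞) fun x : E d => ev p x • x := (contDiff_ev p).smul contDiff_id
  have a₁ := e₁ _ hX
  have a₂ := e₂ _ hX
  have : ∫ x, (u x * divergence (fun x : E d => ev p x • x) x + inner ℝ (g₁ x) (ev p x • x))
      ∂(ballMeasure d)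
      = ∫ x, (u x * divergence (fun x : E d => ev p x • x) x + inner ℝ (g₂ x) (ev p x • x))
      ∂(ballMeasure d) := by
    refine integral_congr_ae ?_
    filter_upwards [hg] with x hx
    rw [hx]
  have hin : ∀ θ : S d, inner ℝ (ev p θ • (θ : E d)) (θ : E d) = ev p θ := fun θ => by
    simp [inner_smul_left]
  simp_rw [hin] at a₁ a₂
  have b₁ := inner_toLp_real h₁.memLp (memLp_ev p)
  have b₂ := inner_toLp_real h₂.memLp (memLp_ev p)
  rw [inner_sub_left]
  change inner ℝ _ (MemLp.toLp _ (memLp_ev p)) - inner ℝ _ (MemLp.toLp _ (memLp_ev p)) = _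
  rw [b₁, b₂, ← a₁, ← a₂, this, sub_self]

/-- The energy is defined through chosen gradients and traces; uniqueness almost everywhere allows
any explicit representatives. -/
theorem HasGreen.weissEnergy_eq {u : E d → ℝ} {g : E d → E d} {τ : S d → ℝ}
    (h : HasGreen u g τ) : weissEnergy u = ∫ x, ‖g x‖ ^ 2 ∂(ballMeasure d)
      - 2 * ∫ θ, τ θ ^ 2 ∂(surfaceMeasure d) + ∫ x, max (u x) 0 ∂(ballMeasure d) := by
  have h1 : ∃ g, HasWeakGradient u g := ⟨g, h.hasWeakGradient⟩
  have h2 : ∃ τ, HasTrace u τ := ⟨τ, h.hasTrace⟩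
  have e1 : weakGradient u =ᵐ[ballMeasure d] g := by
    rw [weakGradient, dif_pos h1]
    exact h1.choose_spec.ae_eq h.hasWeakGradient
  have e2 : boundaryTrace u =ᵐ[surfaceMeasure d] τ := by
    rw [boundaryTrace, dif_pos h2]
    exact h2.choose_spec.ae_eq h.hasTrace
  unfold weissEnergy
  rw [integral_congr_ae (e1.mono fun x hx => by rw [hx] : _ =ᵐ[ballMeasure d] fun x => ‖g x‖ ^ 2),
    integral_congr_ae (e2.mono fun x hx => by rw [hx] :
      _ =ᵐ[surfaceMeasure d] fun x => τ x ^ 2)]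

/-- Radial and tangential parts are orthogonal, and the remaining radial integral is that of `r^(β₁
+ β₂ - 2)` against `r^(d-1) dr`. -/
theorem integral_inner_homogGrad [NeZero d] {c₁ c₂ : S d → ℝ} {g₁ g₂ : S d → E d}
    (h₁ : HasSphereWeakGradient c₁ g₁) (h₂ : HasSphereWeakGradient c₂ g₂) {β₁ β₂ : ℝ}
    (hβ : 2 ≤ β₁ + β₂) :
    ∫ x, inner ℝ (homogGrad β₁ c₁ g₁ x) (homogGrad β₂ c₂ g₂ x) ∂(ballMeasure d)
      = (β₁ * β₂ * inner ℝ (h₁.memLp.toLp c₁) (h₂.memLp.toLp c₂)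
        + inner ℝ (h₁.memLp_grad.toLp g₁) (h₂.memLp_grad.toLp g₂)) / (d + (β₁ + β₂ - 2)) := by
  rw [integral_ball_eq]
  simp_rw [homogGrad_polar]
  have e1 : ∀ p : S d × Ioi (0 : ℝ), inner ℝ
      (p.2.1 ^ (β₁ - 1) • ((β₁ * c₁ p.1) • (p.1 : E d) + g₁ p.1))
      (p.2.1 ^ (β₂ - 1) • ((β₂ * c₂ p.1) • (p.1 : E d) + g₂ p.1))
      = inner ℝ ((β₁ * c₁ p.1) • (p.1 : E d) + g₁ p.1) ((β₂ * c₂ p.1) • (p.1 : E d) + g₂ p.1)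
        * p.2.1 ^ (β₁ + β₂ - 2) := fun p => by
    have hr : (0 : ℝ) < p.2.1 := p.2.2
    rw [inner_smul_left, inner_smul_right, show β₁ + β₂ - 2 = (β₁ - 1) + (β₂ - 1) by ring,
      Real.rpow_add hr]
    simp only [RCLike.conj_to_real]
    ring
  simp_rw [e1]
  rw [integral_prod_mul (fun θ : S d => inner ℝ ((β₁ * c₁ θ) • (θ : E d) + g₁ θ)
    ((β₂ * c₂ θ) • (θ : E d) + g₂ θ)) (fun r : Ioi (0 : ℝ) => r.1 ^ (β₁ + β₂ - 2)),
    integral_radial_rpow (by linarith), mul_one_div]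
  congr 1
  rw [inner_toLp_real, inner_toLp_toLp, ← integral_const_mul, ← integral_add
    ((MemLp.integrable_mul_two h₁.memLp h₂.memLp).const_mul _)
    (MemLp.integrable_inner_two h₁.memLp_grad h₂.memLp_grad)]
  refine integral_congr_ae ?_
  filter_upwards [h₁.tangent, h₂.tangent] with θ t₁ t₂
  rw [real_inner_comm] at t₂
  simp [inner_add_left, inner_add_right, inner_smul_left, inner_smul_right, t₁, t₂]
  ring

theorem integral_homogPow [NeZero d] (c : S d → ℝ) {β : ℝ} (hβ : 0 ≤ β) :
    ∫ x, homogPow β c x ∂(ballMeasure d) = (∫ θ, c θ ∂(surfaceMeasure d)) / (d + β) := by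
  rw [integral_ball_eq]
  simp_rw [homogPow_polar, mul_comm (_ ^ β)]
  rw [integral_prod_mul c (fun r : Ioi (0 : ℝ) => r.1 ^ β), integral_radial_rpow hβ, mul_one_div]

theorem ev_one (x : E d) : ev 1 x = 1 := by simp [ev]

theorem inner_evLp_one {c : S d → ℝ} (h : MemLp c 2 (surfaceMeasure d)) :
    inner ℝ (h.toLp c) (evLp 1) = ∫ θ, c θ ∂(surfaceMeasure d) := by
  refine (inner_toLp_real h (memLp_ev 1)).trans ?_
  simp [ev_one]

theorem norm_toLp_sq {c : S d → ℝ} (h : MemLp c 2 (surfaceMeasure d)) :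
    ∫ θ, c θ ^ 2 ∂(surfaceMeasure d) = ‖h.toLp c‖ ^ 2 := by
  rw [← real_inner_self_eq_norm_sq, inner_toLp_real]
  simp [pow_two]

theorem weissEnergy_homogExt [NeZero d] {c : S d → ℝ} {g : S d → E d}
    (h : HasSphereWeakGradient c g) (hc : ∀ᵐ θ ∂(surfaceMeasure d), 0 ≤ c θ) :
    weissEnergy (homogExt c) = (4 * ‖h.memLp.toLp c‖ ^ 2 + ‖h.memLp_grad.toLp g‖ ^ 2) / (d + 2)
      - 2 * ‖h.memLp.toLp c‖ ^ 2 + inner ℝ (h.memLp.toLp c) (evLp 1) / (d + 2) := by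
  rw [homogExt_eq_homogPow, (hasGreen_homogPow h (by norm_num : (1 : ℝ) ≤ 2)).weissEnergy_eq,
    norm_toLp_sq h.memLp]
  simp_rw [← real_inner_self_eq_norm_sq (homogGrad 2 c g _)]
  rw [integral_inner_homogGrad h h (by norm_num), inner_evLp_one,
    real_inner_self_eq_norm_sq, real_inner_self_eq_norm_sq,
    ← integral_homogPow c (by norm_num : (0 : ℝ) ≤ 2)]
  norm_num
  refine integral_congr_ae ?_
  rw [EventuallyEq, ae_ball_iff]
  filter_upwards [Measure.quasiMeasurePreserving_fst.ae hc] with p hp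
  rw [homogPow_polar]
  exact max_eq_left (mul_nonneg (Real.rpow_nonneg (mem_Ioi.1 p.2.2).le _) hp)

/-- The function `r² k(θ) + r ^ (2 + e) f(θ)`. -/
def competitor (e : ℝ) (k f : S d → ℝ) (x : E d) : ℝ := homogPow 2 k x + homogPow (2 + e) f x

theorem hasGreen_competitor [NeZero d] {k f : S d → ℝ} {gk gf : S d → E d}
    (hk : HasSphereWeakGradient k gk) (hf : HasSphereWeakGradient f gf) {e : ℝ} (he : 0 ≤ e) :
    HasGreen (competitor e k f)
      (fun x => homogGrad 2 k gk x + homogGrad (2 + e) f gf x) (fun θ => k θ + f θ) :=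
  (hasGreen_homogPow hk (by norm_num)).add (hasGreen_homogPow hf (by linarith))

/-- After division by `r²` the value at `rθ` is the convex combination of `k` and `k + f` with
weights `1 - r^e` and `r^e`. -/
theorem competitor_nonneg [NeZero d] {k f : S d → ℝ} {e : ℝ} (he : 0 ≤ e) (hk : ∀ θ, 0 ≤ k θ)
    (hkf : ∀ᵐ θ ∂(surfaceMeasure d), 0 ≤ k θ + f θ) :
    ∀ᵐ x ∂(ballMeasure d), 0 ≤ competitor e k f x := by
  rw [ae_ball_iff]
  filter_upwards [Measure.quasiMeasurePreserving_fst.ae hkf, ae_prod_radial_lt_one] with p hp hr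
  have h0 : (0 : ℝ) < p.2.1 := p.2.2
  rw [competitor, homogPow_polar, homogPow_polar, Real.rpow_add h0]
  have h1 : p.2.1 ^ e ≤ 1 := Real.rpow_le_one h0.le hr.le he
  have h2 : 0 ≤ p.2.1 ^ e := Real.rpow_nonneg h0.le _
  have h3 : p.2.1 ^ (2 : ℝ) * k p.1 + p.2.1 ^ (2 : ℝ) * p.2.1 ^ e * f p.1
      = p.2.1 ^ (2 : ℝ) * ((1 - p.2.1 ^ e) * k p.1 + p.2.1 ^ e * (k p.1 + f p.1)) := by ring
  rw [h3]
  exact mul_nonneg (Real.rpow_nonneg h0.le _)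
    (add_nonneg (mul_nonneg (by linarith) (hk _)) (mul_nonneg h2 hp))

theorem weissEnergy_competitor [NeZero d] {k f : S d → ℝ} {gk gf : S d → E d}
    (hk : HasSphereWeakGradient k gk) (hf : HasSphereWeakGradient f gf) {e : ℝ} (he : 0 ≤ e)
    (hk0 : ∀ θ, 0 ≤ k θ) (hkf : ∀ᵐ θ ∂(surfaceMeasure d), 0 ≤ k θ + f θ) :
    weissEnergy (competitor e k f)
      = (4 * ‖hk.memLp.toLp k‖ ^ 2 + ‖hk.memLp_grad.toLp gk‖ ^ 2) / (d + 2)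
        + 2 * (2 * (2 + e) * inner ℝ (hk.memLp.toLp k) (hf.memLp.toLp f)
            + inner ℝ (hk.memLp_grad.toLp gk) (hf.memLp_grad.toLp gf)) / (d + 2 + e)
        + ((2 + e) ^ 2 * ‖hf.memLp.toLp f‖ ^ 2 + ‖hf.memLp_grad.toLp gf‖ ^ 2) / (d + 2 + 2 * e)
        - 2 * ‖hk.memLp.toLp k + hf.memLp.toLp f‖ ^ 2
        + inner ℝ (hk.memLp.toLp k) (evLp 1) / (d + 2)
        + inner ℝ (hf.memLp.toLp f) (evLp 1) / (d + 2 + e) := by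
  have hGk := hasGreen_homogPow hk (by norm_num : (1 : ℝ) ≤ 2)
  have hGf := hasGreen_homogPow hf (by linarith : (1 : ℝ) ≤ 2 + e)
  have hG := hasGreen_competitor hk hf he
  rw [hG.weissEnergy_eq, norm_toLp_sq hG.memLp_trace]
  have e1 : ∀ x, ‖homogGrad 2 k gk x + homogGrad (2 + e) f gf x‖ ^ 2
      = inner ℝ (homogGrad 2 k gk x) (homogGrad 2 k gk x)
        + 2 * inner ℝ (homogGrad 2 k gk x) (homogGrad (2 + e) f gf x)
        + inner ℝ (homogGrad (2 + e) f gf x) (homogGrad (2 + e) f gf x) := fun x => by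
    rw [norm_add_sq_real, real_inner_self_eq_norm_sq, real_inner_self_eq_norm_sq]
  have i1 := MemLp.integrable_inner_two hGk.memLp_grad hGk.memLp_grad
  have i2 := (MemLp.integrable_inner_two hGk.memLp_grad hGf.memLp_grad).const_mul 2
  have i3 := MemLp.integrable_inner_two hGf.memLp_grad hGf.memLp_grad
  simp_rw [e1]
  rw [integral_add (i1.fun_add i2) i3, integral_add i1 i2, integral_const_mul,
    integral_inner_homogGrad hk hk (by norm_num), integral_inner_homogGrad hk hf (by linarith),
    integral_inner_homogGrad hf hf (by linarith)]
  have e2 : ∫ x, max (competitor e k f x) 0 ∂(ballMeasure d)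
      = ∫ x, (homogPow 2 k x + homogPow (2 + e) f x) ∂(ballMeasure d) := by
    refine integral_congr_ae ?_
    filter_upwards [competitor_nonneg he hk0 hkf] with x hx
    exact max_eq_left hx
  rw [e2, integral_add (hGk.memLp.integrable (by norm_num)) (hGf.memLp.integrable (by norm_num)),
    integral_homogPow k (by norm_num), integral_homogPow f (by linarith),
    ← inner_evLp_one hk.memLp, ← inner_evLp_one hf.memLp, real_inner_self_eq_norm_sq,
    real_inner_self_eq_norm_sq, real_inner_self_eq_norm_sq, real_inner_self_eq_norm_sq]
  have e3 : hG.memLp_trace.toLp (fun θ => k θ + f θ) = hk.memLp.toLp k + hf.memLp.toLp f := rfl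
  rw [e3]
  have e4 : (d : ℝ) + (2 + 2 - 2) = d + 2 := by ring
  have e5 : (d : ℝ) + (2 + (2 + e) - 2) = d + 2 + e := by ring
  have e6 : (d : ℝ) + (2 + e + (2 + e) - 2) = d + 2 + 2 * e := by ring
  rw [e4, e5, e6, ← add_assoc (d : ℝ) 2 e]
  ring

/-! ### Constant, linear and quadratic modes. -/

/-- The linear form `b · x` as a polynomial. -/
def linPoly (b : Fin d → ℝ) : Poly d := ∑ i, b i • MvPolynomial.X i

/-- The quadratic form `x · A x` as a polynomial. -/
def quadPoly (A : Matrix (Fin d) (Fin d) ℝ) : Poly d :=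
  ∑ i, ∑ j, A i j • (MvPolynomial.X i * MvPolynomial.X j)

theorem ev_linPoly (b : Fin d → ℝ) (x : E d) : ev (linPoly b) x = ∑ i, b i * x i := by
  simp [linPoly, ev_sum, ev_smul, ev_X]

theorem ev_quadPoly (A : Matrix (Fin d) (Fin d) ℝ) (x : E d) :
    ev (quadPoly A) x = quadForm A x := by
  simp only [quadPoly, ev_sum, ev_smul, ev_mul, ev_X, quadForm, dotProduct, Matrix.mulVec,
    Finset.mul_sum]
  exact Finset.sum_congr rfl fun i _ => Finset.sum_congr rfl fun j _ => by ring

theorem linPoly_add (b b' : Fin d → ℝ) : linPoly (b + b') = linPoly b + linPoly b' := by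
  simp [linPoly, add_smul, Finset.sum_add_distrib]

theorem linPoly_smul (a : ℝ) (b : Fin d → ℝ) : linPoly (a • b) = a • linPoly b := by
  simp [linPoly, Finset.smul_sum, smul_smul]

theorem quadPoly_add (A B : Matrix (Fin d) (Fin d) ℝ) :
    quadPoly (A + B) = quadPoly A + quadPoly B := by
  simp [quadPoly, add_smul, Finset.sum_add_distrib]

theorem quadPoly_smul (a : ℝ) (A : Matrix (Fin d) (Fin d) ℝ) :
    quadPoly (a • A) = a • quadPoly A := by
  simp [quadPoly, Finset.smul_sum, smul_smul]

theorem quadPoly_sub (A B : Matrix (Fin d) (Fin d) ℝ) :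
    quadPoly (A - B) = quadPoly A - quadPoly B := by
  simp [quadPoly, sub_smul, Finset.sum_sub_distrib]

theorem quadForm_add (A B : Matrix (Fin d) (Fin d) ℝ) (x : E d) :
    quadForm (A + B) x = quadForm A x + quadForm B x := by
  simp [← ev_quadPoly, quadPoly_add, ev_add]

theorem quadForm_sub (A B : Matrix (Fin d) (Fin d) ℝ) (x : E d) :
    quadForm (A - B) x = quadForm A x - quadForm B x := by
  simp [← ev_quadPoly, quadPoly_sub, ev_sub]

theorem quadForm_smul (a : ℝ) (A : Matrix (Fin d) (Fin d) ℝ) (x : E d) :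
    quadForm (a • A) x = a * quadForm A x := by
  simp [← ev_quadPoly, quadPoly_smul, ev_smul]

theorem quadForm_one (x : E d) : quadForm 1 x = ‖x‖ ^ 2 := by
  rw [quadForm, EuclideanSpace.norm_sq_eq]
  simp [dotProduct, ← pow_two]

theorem quadForm_one_sphere (θ : S d) : quadForm 1 (θ : E d) = 1 := by
  simp [quadForm_one]

theorem X_eq_monomial (i : Fin d) :
    (MvPolynomial.X i : Poly d) = MvPolynomial.monomial (Finsupp.single i 1) 1 := rfl

theorem X_mul_X_eq_monomial (i j : Fin d) :
    (MvPolynomial.X i * MvPolynomial.X j : Poly d)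
      = MvPolynomial.monomial (Finsupp.single i 1 + Finsupp.single j 1) 1 := by
  rw [X_eq_monomial, X_eq_monomial, MvPolynomial.monomial_mul, one_mul]

theorem one_mem_polyDeg (N : ℕ) : (1 : Poly d) ∈ PolyDeg d N :=
  monomial_mem_polyDeg (s := 0) (by simp) 1

theorem linPoly_mem (b : Fin d → ℝ) : linPoly b ∈ PolyDeg d 2 :=
  Submodule.sum_mem _ fun i _ => Submodule.smul_mem _ _
    (monomial_mem_polyDeg (by simp) 1)

theorem quadPoly_mem (A : Matrix (Fin d) (Fin d) ℝ) : quadPoly A ∈ PolyDeg d 2 :=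
  Submodule.sum_mem _ fun i _ => Submodule.sum_mem _ fun j _ => Submodule.smul_mem _ _ (by
    rw [X_mul_X_eq_monomial]
    exact monomial_mem_polyDeg (by simp) 1)

theorem sphereLaplaceOp_one : sphereLaplaceOp (1 : Poly d) = 0 := by
  have := sphereLaplaceOp_monomial (0 : Fin d →₀ ℕ) 1
  rw [show MvPolynomial.monomial (0 : Fin d →₀ ℕ) (1 : ℝ) = (1 : Poly d) from rfl] at this
  simp [this, laplaceOp_apply]

theorem sphereLaplaceOp_linPoly (b : Fin d → ℝ) :
    sphereLaplaceOp (linPoly b) = (-((d : ℝ) - 1)) • linPoly b := by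
  have h : ∀ i, sphereLaplaceOp (MvPolynomial.X i : Poly d)
      = (-((d : ℝ) - 1)) • MvPolynomial.X i := fun i => by
    rw [X_eq_monomial, sphereLaplaceOp_monomial, ← X_eq_monomial, laplaceOp_apply,
      Finset.sum_eq_zero]
    · rw [zero_sub, ← neg_smul, Finsupp.degree_single]
      congr 1; push_cast; ring
    · intro k _
      by_cases hk : k = i
      · subst hk; simp
      · simp [MvPolynomial.pderiv_X, hk]
  simp_rw [linPoly, map_sum, map_smul, h, Finset.smul_sum, smul_comm (-((d : ℝ) - 1))]

/-- Traceless forms are thus eigenfunctions with eigenvalue `2d`, the neutral one for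
`2`-homogeneous extensions; the trace only produces a constant. -/
theorem sphereLaplaceOp_quadPoly (A : Matrix (Fin d) (Fin d) ℝ) :
    sphereLaplaceOp (quadPoly A) = (2 * A.trace) • 1 - (2 * (d : ℝ)) • quadPoly A := by
  have h : ∀ i j, sphereLaplaceOp (MvPolynomial.X i * MvPolynomial.X j : Poly d)
      = (if i = j then 2 else 0 : ℝ) • 1
        - (2 * (d : ℝ)) • (MvPolynomial.X i * MvPolynomial.X j) := fun i j => by
    rw [X_mul_X_eq_monomial, sphereLaplaceOp_monomial, ← X_mul_X_eq_monomial, laplaceOp_apply]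
    congr 1
    · have h1 : ∀ k, MvPolynomial.pderiv k (MvPolynomial.pderiv k
          (MvPolynomial.X i * MvPolynomial.X j : Poly d))
          = if k = i then (if i = j then (2 : ℝ) • 1 else 0) else 0 := fun k => by
        by_cases hki : k = i
        · subst hki
          by_cases hkj : k = j
          · subst hkj; simp; norm_num [MvPolynomial.smul_eq_C_mul]
            exact (map_ofNat MvPolynomial.C 2).symm
          · simp [MvPolynomial.pderiv_X, hkj, Ne.symm hkj]
        · by_cases hkj : k = j
          · subst hkj; simp [MvPolynomial.pderiv_X, hki, Ne.symm hki]
          · simp [MvPolynomial.pderiv_X, hki, Ne.symm hki, Ne.symm hkj]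
      simp_rw [h1]
      by_cases hij : i = j <;> simp [hij]
    · congr 1
      rw [map_add]; simp
  simp_rw [quadPoly, map_sum, map_smul, h, smul_sub, Finset.sum_sub_distrib, Finset.smul_sum,
    smul_comm (2 * (d : ℝ))]
  congr 1
  simp_rw [smul_smul, ← Finset.sum_smul]
  congr 1
  simp [Matrix.trace, Finset.mul_sum, mul_comm]

theorem exists_eq_add_single {s : Fin d →₀ ℕ} {k : ℕ} (h : s.degree = k + 1) :
    ∃ i t, s = t + Finsupp.single i 1 ∧ t.degree = k := by
  have hs : s ≠ 0 := by rintro rfl; simp at h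
  obtain ⟨i, hi⟩ := Finsupp.ne_iff.1 hs
  have h3 : s = (s - Finsupp.single i 1) + Finsupp.single i 1 := by
    ext j
    by_cases hj : j = i
    · subst hj; simp at hi ⊢; omega
    · simp [Ne.symm hj]
  refine ⟨i, _, h3, ?_⟩
  rw [h3, map_add] at h
  simpa using h

/-- On the sphere, polynomials of degree at most two are sums of quadratic and linear forms. -/
theorem exists_quadPoly_add_linPoly {p : Poly d} (hp : p ∈ PolyDeg d 2) :
    ∃ (A : Matrix (Fin d) (Fin d) ℝ) (b : Fin d → ℝ), A.IsSymm ∧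
      ∀ θ : S d, ev p θ = ev (quadPoly A) θ + ev (linPoly b) θ := by
  let W : Submodule ℝ (Poly d) :=
    { carrier := {p | ∃ (A : Matrix (Fin d) (Fin d) ℝ) (b : Fin d → ℝ), A.IsSymm ∧
        ∀ θ : S d, ev p θ = ev (quadPoly A) θ + ev (linPoly b) θ}
      add_mem' := by
        rintro p q ⟨A, b, hA, h⟩ ⟨A', b', hA', h'⟩
        refine ⟨A + A', b + b', hA.add hA', fun θ => ?_⟩
        rw [ev_add, h, h', quadPoly_add, linPoly_add, ev_add, ev_add]; ring
      zero_mem' := ⟨0, 0, Matrix.isSymm_zero, fun θ => by simp [quadPoly, linPoly, ev]⟩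
      smul_mem' := by
        rintro a p ⟨A, b, hA, h⟩
        refine ⟨a • A, a • b, hA.smul a, fun θ => ?_⟩
        rw [ev_smul, h, quadPoly_smul, linPoly_smul, ev_smul, ev_smul]; ring }
  refine polyDeg_induction W LinearMap.id (fun s a hs => ?_) hp
  have hone : MvPolynomial.monomial s a = a • (MvPolynomial.monomial s 1 : Poly d) := by
    simp [MvPolynomial.smul_monomial]
  rw [LinearMap.id_apply, hone]
  refine W.smul_mem a ?_
  rcases hk : s.degree with _ | _ | _ | k
  · have : s = 0 := (Finsupp.degree_eq_zero_iff _).1 hk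
    subst this
    -- The constant `1` is the quadratic form `|x|²` on the sphere.
    refine ⟨1, 0, Matrix.isSymm_one, fun θ => ?_⟩
    rw [ev_quadPoly, quadForm_one_sphere]
    simp [linPoly, ev]
  · obtain ⟨i, t, rfl, ht⟩ := exists_eq_add_single hk
    have : t = 0 := (Finsupp.degree_eq_zero_iff _).1 ht
    subst this
    refine ⟨0, Pi.single i 1, Matrix.isSymm_zero, fun θ => ?_⟩
    rw [zero_add, ← X_eq_monomial, ev_X, ev_linPoly]
    simp [quadPoly, ev, Pi.single_apply]
  · obtain ⟨i, t, rfl, ht⟩ := exists_eq_add_single hk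
    obtain ⟨j, t', rfl, ht'⟩ := exists_eq_add_single ht
    have : t' = 0 := (Finsupp.degree_eq_zero_iff _).1 ht'
    subst this
    refine ⟨(1 / 2 : ℝ) • (Matrix.single i j 1 + Matrix.single j i 1), 0, ?_, fun θ => ?_⟩
    · rw [Matrix.IsSymm, Matrix.transpose_smul, Matrix.transpose_add, Matrix.transpose_single,
        Matrix.transpose_single, add_comm]
    · have hs : ∀ i j, ev (quadPoly (Matrix.single i j 1)) (θ : E d)
          = (θ : E d) i * (θ : E d) j := fun i j => by
        rw [ev_quadPoly]
        simp [quadForm, Matrix.single_mulVec, dotProduct, Function.update_apply]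
      rw [zero_add, ← X_mul_X_eq_monomial, ev_mul, ev_X, ev_X, quadPoly_smul, quadPoly_add,
        ev_smul, ev_add, hs, hs]
      simp [linPoly, ev]; ring
  · omega

/-- Multiples of the identity are constants on the sphere, so the excess of the trace over `1/4` can
be moved into the constant mode. -/
theorem exists_trace_decomposition [NeZero d] {p : Poly d} (hp : p ∈ PolyDeg d 2) :
    ∃ (A : Matrix (Fin d) (Fin d) ℝ) (a : ℝ) (b : Fin d → ℝ), A.IsSymm ∧ A.trace = 1 / 4 ∧
      ∀ θ : S d, ev p θ = ev (quadPoly A + a • 1 + linPoly b) θ := by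
  obtain ⟨A, b, hA, h⟩ := exists_quadPoly_add_linPoly hp
  have hd : (d : ℝ) ≠ 0 := by exact_mod_cast NeZero.ne d
  set a := (A.trace - 1 / 4) / d with ha
  refine ⟨A - a • 1, a, b, hA.sub (Matrix.isSymm_one.smul a), ?_, fun θ => ?_⟩
  · rw [Matrix.trace_sub, Matrix.trace_smul, Matrix.trace_one, Fintype.card_fin, smul_eq_mul, ha]
    field_simp; ring
  · rw [h, ev_add, ev_add, ev_smul, ev_one, ev_quadPoly, ev_quadPoly, quadForm_sub, quadForm_smul,
      quadForm_one_sphere]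
    ring

theorem gradLp_one [NeZero d] : gradLp (1 : Poly d) = 0 := by
  rw [← inner_self_eq_zero (𝕜 := ℝ), inner_gradLp_gradLp, sphereLaplaceOp_one, map_zero,
    inner_zero_right, neg_zero]

/-- Inner products of forms of degree at most two. -/
theorem inner_gradLp_quadPoly {c : S d → ℝ} {g : S d → E d} (h : HasSphereWeakGradient c g)
    (A : Matrix (Fin d) (Fin d) ℝ) :
    inner ℝ (h.memLp_grad.toLp g) (gradLp (quadPoly A))
      = 2 * d * inner ℝ (h.memLp.toLp c) (evLp (quadPoly A))
        - 2 * A.trace * inner ℝ (h.memLp.toLp c) (evLp 1) := by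
  rw [inner_gradLp h, sphereLaplaceOp_quadPoly, map_sub, map_smul, map_smul, inner_sub_right,
    inner_smul_right, inner_smul_right]
  ring

theorem inner_gradLp_linPoly {c : S d → ℝ} {g : S d → E d} (h : HasSphereWeakGradient c g)
    (b : Fin d → ℝ) :
    inner ℝ (h.memLp_grad.toLp g) (gradLp (linPoly b))
      = (d - 1) * inner ℝ (h.memLp.toLp c) (evLp (linPoly b)) := by
  rw [inner_gradLp h, sphereLaplaceOp_linPoly, map_smul, inner_smul_right]
  ring

theorem inner_gradLp_poly_quadPoly [NeZero d] (p : Poly d) (A : Matrix (Fin d) (Fin d) ℝ) :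
    inner ℝ (gradLp p) (gradLp (quadPoly A))
      = 2 * d * inner ℝ (evLp p) (evLp (quadPoly A))
        - 2 * A.trace * inner ℝ (evLp p) (evLp 1) :=
  inner_gradLp_quadPoly (hasSphereWeakGradient_ev p) A

theorem inner_gradLp_poly_linPoly [NeZero d] (p : Poly d) (b : Fin d → ℝ) :
    inner ℝ (gradLp p) (gradLp (linPoly b)) = (d - 1) * inner ℝ (evLp p) (evLp (linPoly b)) :=
  inner_gradLp_linPoly (hasSphereWeakGradient_ev p) b

/-- The mean of `Q_A` comes from testing the weak formula for `Q_A` against the constant `1`, whose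
gradient vanishes. -/
theorem inner_one_quadPoly [NeZero d] (A : Matrix (Fin d) (Fin d) ℝ) :
    d * inner ℝ (evLp 1) (evLp (quadPoly A)) = A.trace * ‖evLp (1 : Poly d)‖ ^ 2 := by
  have h := inner_gradLp_poly_quadPoly (1 : Poly d) A
  rw [gradLp_one, inner_zero_left, real_inner_self_eq_norm_sq] at h
  linarith

theorem inner_one_linPoly [NeZero d] (hd : 2 ≤ d) (b : Fin d → ℝ) :
    inner ℝ (evLp 1) (evLp (linPoly b)) = 0 := by
  have h := inner_gradLp_poly_linPoly (1 : Poly d) b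
  rw [gradLp_one, inner_zero_left] at h
  have h2 : (2 : ℝ) ≤ d := by exact_mod_cast hd
  rcases mul_eq_zero.1 h.symm with h3 | h3
  · linarith
  · exact h3

/-- Computing the product of the gradients from either side gives the factors `2d` and `d - 1`; the
trace term drops out because linear forms have zero mean, and `2d - (d - 1) = d + 1` is nonzero. -/
theorem inner_linPoly_quadPoly [NeZero d] (hd : 2 ≤ d) (b : Fin d → ℝ)
    (A : Matrix (Fin d) (Fin d) ℝ) :
    inner ℝ (evLp (linPoly b)) (evLp (quadPoly A)) = 0 := by
  have h1 := inner_gradLp_poly_quadPoly (linPoly b) A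
  have h2 := inner_gradLp_poly_linPoly (quadPoly A) b
  have h3 := inner_one_linPoly hd b
  rw [real_inner_comm] at h2 h3
  rw [h1, h3, real_inner_comm] at h2
  have h4 : (2 : ℝ) ≤ d := by exact_mod_cast hd
  have h5 : ((d : ℝ) + 1) * inner ℝ (evLp (linPoly b)) (evLp (quadPoly A)) = 0 := by
    rw [real_inner_comm]
    linarith
  rcases mul_eq_zero.1 h5 with h6 | h6
  · linarith
  · exact h6

/-- The polynomial `x · A x + a + b · x`. -/
def lowPoly (A : Matrix (Fin d) (Fin d) ℝ) (a : ℝ) (b : Fin d → ℝ) : Poly d :=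
  quadPoly A + a • 1 + linPoly b

theorem lowPoly_mem (A : Matrix (Fin d) (Fin d) ℝ) (a : ℝ) (b : Fin d → ℝ) :
    lowPoly A a b ∈ PolyDeg d 2 :=
  Submodule.add_mem _ (Submodule.add_mem _ (quadPoly_mem A)
    (Submodule.smul_mem _ _ (one_mem_polyDeg 2))) (linPoly_mem b)

theorem evLp_congr {p q : Poly d} (h : ∀ θ : S d, ev p θ = ev q θ) : evLp p = evLp q :=
  MemLp.toLp_congr (memLp_ev p) (memLp_ev q) (Eventually.of_forall h)

theorem exists_decomposition [NeZero d] (f : Lp ℝ 2 (surfaceMeasure d)) :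
    ∃ (A : Matrix (Fin d) (Fin d) ℝ) (a : ℝ) (b : Fin d → ℝ), A.IsSymm ∧ A.trace = 1 / 4 ∧
      ∀ r ∈ PolyDeg d 2, inner ℝ (f - evLp (lowPoly A a b)) (evLp r) = 0 := by
  obtain ⟨p, hp, ho⟩ := exists_polynomial_projection f 2
  obtain ⟨A, a, b, hA, ht, h⟩ := exists_trace_decomposition hp
  exact ⟨A, a, b, hA, ht, fun r hr => by
    rw [lowPoly, ← evLp_congr h]; exact ho r hr⟩

theorem quadForm_smul_one_eq (a : ℝ) :
    quadForm (a • (1 : Matrix (Fin d) (Fin d) ℝ))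
      = homogExt fun θ : S d => ev (a • 1 : Poly d) θ := by
  ext x
  rw [quadForm_smul, quadForm_one, homogExt]
  split_ifs with h
  · simp [h]
  · rw [ev_smul, ev_one]; ring

theorem weissEnergy_homogExt_poly [NeZero d] {p : Poly d} (hp : ∀ θ : S d, 0 ≤ ev p θ) :
    weissEnergy (homogExt fun θ : S d => ev p θ)
      = (4 * ‖evLp p‖ ^ 2 + ‖gradLp p‖ ^ 2) / (d + 2) - 2 * ‖evLp p‖ ^ 2
        + inner ℝ (evLp p) (evLp 1) / (d + 2) :=
  weissEnergy_homogExt (hasSphereWeakGradient_ev p) (Eventually.of_forall hp)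

/-- Here `‖1‖²` is the area of the sphere, `d |B₁|`, so the right-hand side is `|B₁| / 8`. -/
theorem theta_eq [NeZero d] :
    (d + 2) * theta d = ‖evLp (1 : Poly d)‖ ^ 2 / (8 * d) := by
  have hd : (0 : ℝ) < d := by exact_mod_cast NeZero.pos d
  rw [theta, quadForm_smul_one_eq, weissEnergy_homogExt_poly
    (fun θ => by rw [ev_smul, ev_one]; positivity), map_smul, map_smul, gradLp_one, smul_zero,
    norm_zero, real_inner_smul_left, real_inner_self_eq_norm_sq, norm_smul, mul_pow,
    Real.norm_eq_abs, sq_abs]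
  generalize ‖evLp (1 : Poly d)‖ ^ 2 = s
  field_simp
  ring

/-! ### Energy excess and gain of the competitor. -/

section

variable [NeZero d] {c : S d → ℝ} {g : S d → E d} {A : Matrix (Fin d) (Fin d) ℝ} {a : ℝ}
  {b : Fin d → ℝ}

theorem inner_grad_sub_gradLp (h : HasSphereWeakGradient c g) {p : Poly d}
    (ho : ∀ r ∈ PolyDeg d 2, inner ℝ (h.memLp.toLp c - evLp p) (evLp r) = 0)
    {r : Poly d} (hr : r ∈ PolyDeg d 2) :
    inner ℝ (h.memLp_grad.toLp g - gradLp p) (gradLp r) = 0 := by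
  have h1 := ho _ (sphereLaplaceOp_mem hr)
  rw [inner_sub_left, inner_gradLp h, inner_gradLp_gradLp, ← neg_eq_zero, ← h1, inner_sub_left]
  ring

theorem spectral_gap_sub (h : HasSphereWeakGradient c g) {p : Poly d}
    (ho : ∀ r ∈ PolyDeg d 2, inner ℝ (h.memLp.toLp c - evLp p) (evLp r) = 0) :
    3 * ((d : ℝ) + 1) * ‖h.memLp.toLp c - evLp p‖ ^ 2 ≤ ‖h.memLp_grad.toLp g - gradLp p‖ ^ 2 :=
  spectral_gap (h.sub (hasSphereWeakGradient_ev p)) ho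

/-- The energy of the low modes. -/
theorem lowPoly_energy (hd : 2 ≤ d) (hA : A.trace = 1 / 4) :
    ‖gradLp (lowPoly A a b)‖ ^ 2 - 2 * d * ‖evLp (lowPoly A a b)‖ ^ 2
      + inner ℝ (evLp (lowPoly A a b)) (evLp 1)
      = ‖evLp (1 : Poly d)‖ ^ 2 / (8 * d) - 2 * d * a ^ 2 * ‖evLp (1 : Poly d)‖ ^ 2
        - (d + 1) * ‖evLp (linPoly b)‖ ^ 2 := by
  have hd0 : (0 : ℝ) < d := by exact_mod_cast NeZero.pos d
  have e1 := inner_gradLp_poly_quadPoly (quadPoly A) A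
  have e2 := inner_gradLp_poly_linPoly (linPoly b) b
  have e3 := inner_gradLp_poly_linPoly (quadPoly A) b
  have e4 := inner_one_quadPoly A
  have e5 := inner_one_linPoly hd b
  have e6 := inner_linPoly_quadPoly hd b A
  have e7 : inner ℝ (evLp (quadPoly A)) (evLp 1) = inner ℝ (evLp 1) (evLp (quadPoly A)) :=
    real_inner_comm _ _
  have e8 : inner ℝ (evLp (quadPoly A)) (evLp (linPoly b)) = 0 := by rw [real_inner_comm]; exact e6
  have e9 : inner ℝ (evLp (linPoly b)) (evLp 1) = 0 := by rw [real_inner_comm]; exact e5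
  have e10 : inner ℝ (gradLp (linPoly b)) (gradLp (quadPoly A)) = 0 := by
    rw [real_inner_comm, e3, e8, mul_zero]
  rw [hA, e7] at e1
  rw [hA] at e4
  rw [e8, mul_zero] at e3
  simp only [lowPoly, map_add, map_smul, gradLp_one, smul_zero, add_zero]
  simp only [← real_inner_self_eq_norm_sq, inner_add_left, inner_add_right, inner_smul_left,
    inner_smul_right, RCLike.conj_to_real, e1, e2, e3, e5, e6, e7, e8, e9, e10]
  rw [← real_inner_self_eq_norm_sq] at e4
  have e11 : inner ℝ (evLp 1) (evLp (quadPoly A))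
      = inner ℝ (evLp (1 : Poly d)) (evLp (1 : Poly d)) / (4 * d) := by
    field_simp; linarith
  rw [e11]
  field_simp
  ring

/-- The energy excess of the homogeneous extension in terms of the high modes. -/
theorem weissEnergy_homogExt_sub_theta (hd : 2 ≤ d) (h : HasSphereWeakGradient c g)
    (hc : ∀ᵐ θ ∂(surfaceMeasure d), 0 ≤ c θ) (hA : A.trace = 1 / 4)
    (ho : ∀ r ∈ PolyDeg d 2,
      inner ℝ (h.memLp.toLp c - evLp (lowPoly A a b)) (evLp r) = 0) :
    (d + 2) * (weissEnergy (homogExt c) - theta d)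
      = ‖h.memLp_grad.toLp g - gradLp (lowPoly A a b)‖ ^ 2
        - 2 * d * ‖h.memLp.toLp c - evLp (lowPoly A a b)‖ ^ 2
        - 2 * d * a ^ 2 * ‖evLp (1 : Poly d)‖ ^ 2 - (d + 1) * ‖evLp (linPoly b)‖ ^ 2 := by
  rw [weissEnergy_homogExt h hc, mul_sub, theta_eq]
  have hl := lowPoly_energy (a := a) (b := b) hd hA
  set p := lowPoly A a b
  have hp : p ∈ PolyDeg d 2 := lowPoly_mem A a b
  set C := h.memLp.toLp c
  set G := h.memLp_grad.toLp g
  -- Pythagoras for values and for gradients: low and high modes decouple, and the linear term of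
  -- the energy sees only `p`.
  have e1 : ‖C‖ ^ 2 = ‖C - evLp p‖ ^ 2 + ‖evLp p‖ ^ 2 := by
    conv_lhs => rw [← sub_add_cancel C (evLp p)]
    rw [norm_add_sq_real, ho p hp]; ring
  have e2 : ‖G‖ ^ 2 = ‖G - gradLp p‖ ^ 2 + ‖gradLp p‖ ^ 2 := by
    conv_lhs => rw [← sub_add_cancel G (gradLp p)]
    rw [norm_add_sq_real, inner_grad_sub_gradLp h ho hp]; ring
  have e3 : inner ℝ C (evLp 1) = inner ℝ (evLp p) (evLp 1) := by
    have := ho 1 (one_mem_polyDeg 2)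
    rw [inner_sub_left] at this
    linarith
  have hn : (d : ℝ) + 2 ≠ 0 := by positivity
  have e4 : ((d : ℝ) + 2) * ((4 * ‖C‖ ^ 2 + ‖G‖ ^ 2) / (d + 2) - 2 * ‖C‖ ^ 2
      + inner ℝ C (evLp 1) / (d + 2))
      = 4 * ‖C‖ ^ 2 + ‖G‖ ^ 2 - 2 * (d + 2) * ‖C‖ ^ 2 + inner ℝ C (evLp 1) := by
    field_simp
  rw [e4, e1, e2, e3]
  linear_combination hl

/-- Expansion of the gain in `e`, with `n = d + 2` and `f = c - k`. The letters stand for `cc =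
‖c‖²`, `gg = ‖∇c‖²`, `ca = ⟨c, f⟩`, `ga = ⟨∇c, ∇f⟩`, `s = ‖f‖²`, `t = ‖∇f‖²`, and `c1`, `f1` for the
integrals of `c`, `f`. The coefficient `2(n - 2) = 2d` in the leading term is the eigenvalue of
degree two. -/
theorem competitor_gain_identity {n e : ℝ} (hn : 0 < n) (he : 0 ≤ e)
    (cc gg ca ga s t c1 f1 : ℝ) :
    ((4 * cc + gg) / n - 2 * cc + c1 / n)
      - ((4 * (cc - 2 * ca + s) + (gg - 2 * ga + t)) / n
        + 2 * (2 * (2 + e) * (ca - s) + (ga - t)) / (n + e)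
        + ((2 + e) ^ 2 * s + t) / (n + 2 * e) - 2 * cc + (c1 - f1) / n + f1 / (n + e))
      = e / (n * (n + e)) * (2 * (ga - 2 * (n - 2) * ca) + f1)
        - e ^ 2 * ((8 / (n * (n + e) * (n + 2 * e)) - 4 / ((n + e) * (n + 2 * e))
          + 1 / (n + 2 * e)) * s + 2 / (n * (n + e) * (n + 2 * e)) * t) := by
  have h1 : n + e ≠ 0 := by positivity
  have h2 : n + 2 * e ≠ 0 := by positivity
  field_simp
  ring

theorem competitor_gain_le {n e : ℝ} (hn : 4 ≤ n) (he : 0 ≤ e) {s t : ℝ} (hs : 0 ≤ s)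
    (ht : 0 ≤ t) :
    (8 / (n * (n + e) * (n + 2 * e)) - 4 / ((n + e) * (n + 2 * e)) + 1 / (n + 2 * e)) * s
      + 2 / (n * (n + e) * (n + 2 * e)) * t ≤ s + t := by
  have h0 : 0 < n := by linarith
  have h3 : (64 : ℝ) ≤ n * (n + e) * (n + 2 * e) := by
    have : (16 : ℝ) ≤ n * (n + e) := by nlinarith
    nlinarith
  have h4 : 8 / (n * (n + e) * (n + 2 * e)) ≤ 8 / 64 := by gcongr
  have h5 : 1 / (n + 2 * e) ≤ 1 / 4 := by gcongr; linarith
  have h6 : 0 ≤ 4 / ((n + e) * (n + 2 * e)) := by positivity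
  have h7 : 2 / (n * (n + e) * (n + 2 * e)) ≤ 2 / 64 := by gcongr
  have h8 := mul_le_mul_of_nonneg_right h7 ht
  have h9 : (8 / (n * (n + e) * (n + 2 * e)) - 4 / ((n + e) * (n + 2 * e)) + 1 / (n + 2 * e)) * s
      ≤ 1 * s := mul_le_mul_of_nonneg_right (by linarith) hs
  linarith

/-- The energy gain of the competitor. -/
theorem weissEnergy_competitor_le (hd : 2 ≤ d) (h : HasSphereWeakGradient c g)
    (hc : ∀ᵐ θ ∂(surfaceMeasure d), 0 ≤ c θ) {p : Poly d} (hp : p ∈ PolyDeg d 2)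
    (ho : ∀ r ∈ PolyDeg d 2, inner ℝ (h.memLp.toLp c - evLp p) (evLp r) = 0)
    {T : Matrix (Fin d) (Fin d) ℝ} (hT : T.trace = 0)
    (hpos : ∀ θ : S d, 0 ≤ ev (p + quadPoly T) θ) {e : ℝ} (he : 0 ≤ e) :
    weissEnergy (competitor e (fun θ : S d => ev (p + quadPoly T) θ)
        (fun θ => c θ - ev (p + quadPoly T) θ))
      ≤ weissEnergy (homogExt c)
        - (e / ((d + 2) * (d + 2 + e)) * (2 * (‖h.memLp_grad.toLp g - gradLp p‖ ^ 2
            - 2 * d * ‖h.memLp.toLp c - evLp p‖ ^ 2))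
          - e ^ 2 * (‖h.memLp.toLp c - evLp p‖ ^ 2 + ‖h.memLp_grad.toLp g - gradLp p‖ ^ 2
            + (1 + 2 * d) * ‖evLp (quadPoly T)‖ ^ 2)) := by
  have hk := hasSphereWeakGradient_ev (p + quadPoly T)
  have hf := h.sub hk
  rw [weissEnergy_homogExt h hc, weissEnergy_competitor hk hf he hpos
    (by filter_upwards [hc] with θ hθ; simpa using hθ)]
  set D := quadPoly T with hD
  have hDm : D ∈ PolyDeg d 2 := quadPoly_mem T
  set C := h.memLp.toLp c with hC
  set G := h.memLp_grad.toLp g with hG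
  set F := hf.memLp.toLp (fun θ => c θ - ev (p + D) θ) with hF
  set GF := hf.memLp_grad.toLp (fun θ => g θ - tangentGrad (p + D) θ) with hGF
  have hd0 : (0 : ℝ) < d := by exact_mod_cast NeZero.pos d
  have eF : F = C - evLp p - evLp D := by
    rw [sub_sub, ← map_add]; rfl
  have eGF : GF = G - gradLp p - gradLp D := by
    rw [sub_sub, ← map_add]; rfl
  have eK : hk.memLp.toLp (fun θ : S d => ev (p + D) θ) = C - F := by
    rw [eF]
    change evLp (p + D) = _
    rw [map_add]; abel
  have eGK : hk.memLp_grad.toLp (tangentGrad (p + D)) = G - GF := by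
    rw [eGF]
    change gradLp (p + D) = _
    rw [map_add]; abel
  rw [eK, eGK]
  set Φ := C - evLp p with hΦ
  set Ψ := G - gradLp p with hΨ
  have o1 := ho
  have o2 : ∀ r ∈ PolyDeg d 2, inner ℝ Ψ (gradLp r) = 0 := fun r hr =>
    inner_grad_sub_gradLp h ho hr
  -- As `T` is traceless, `Q_T` is an eigenfunction with eigenvalue `2d`. This makes the correction
  -- cancel from the first order term below.
  have q1 : inner ℝ G (gradLp D) = 2 * d * inner ℝ C (evLp D) := by
    have := inner_gradLp_quadPoly h T
    rw [hT, mul_zero, zero_mul, sub_zero] at this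
    exact this
  have q2 : inner ℝ (evLp D) (evLp 1) = 0 := by
    have := inner_one_quadPoly T
    rw [hT, zero_mul] at this
    rw [real_inner_comm]
    exact (mul_eq_zero.1 this).resolve_left hd0.ne'
  have q3 : ‖gradLp D‖ ^ 2 = 2 * d * ‖evLp D‖ ^ 2 := by
    have := inner_gradLp_poly_quadPoly D T
    rw [hT, mul_zero, zero_mul, sub_zero] at this
    rw [← real_inner_self_eq_norm_sq, ← real_inner_self_eq_norm_sq]
    exact this
  have q4 : inner ℝ C Φ = ‖Φ‖ ^ 2 := by
    have : inner ℝ Φ C = ‖Φ‖ ^ 2 := by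
      conv_lhs => rw [← sub_add_cancel C (evLp p)]
      rw [inner_add_right, o1 p hp, add_zero, ← hΦ, real_inner_self_eq_norm_sq]
    rw [real_inner_comm]; exact this
  have q5 : inner ℝ G Ψ = ‖Ψ‖ ^ 2 := by
    have : inner ℝ Ψ G = ‖Ψ‖ ^ 2 := by
      conv_lhs => rw [← sub_add_cancel G (gradLp p)]
      rw [inner_add_right, o2 p hp, add_zero, ← hΨ, real_inner_self_eq_norm_sq]
    rw [real_inner_comm]; exact this
  have hca : inner ℝ C F = ‖Φ‖ ^ 2 - inner ℝ C (evLp D) := by rw [eF, inner_sub_right, q4]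
  have hga : inner ℝ G GF = ‖Ψ‖ ^ 2 - 2 * d * inner ℝ C (evLp D) := by
    rw [eGF, inner_sub_right, q5, q1]
  have hs : ‖F‖ ^ 2 = ‖Φ‖ ^ 2 + ‖evLp D‖ ^ 2 := by
    rw [eF, norm_sub_sq_real, o1 D hDm]; ring
  have ht : ‖GF‖ ^ 2 = ‖Ψ‖ ^ 2 + 2 * d * ‖evLp D‖ ^ 2 := by
    rw [eGF, norm_sub_sq_real, o2 D hDm, q3]; ring
  have hf1 : inner ℝ F (evLp 1) = 0 := by
    rw [eF, inner_sub_left, o1 1 (one_mem_polyDeg 2), q2, sub_zero]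
  have hcf : inner ℝ (C - F) F = inner ℝ C F - ‖F‖ ^ 2 := by
    rw [inner_sub_left, real_inner_self_eq_norm_sq]
  have hgf : inner ℝ (G - GF) GF = inner ℝ G GF - ‖GF‖ ^ 2 := by
    rw [inner_sub_left, real_inner_self_eq_norm_sq]
  rw [hcf, hgf, norm_sub_sq_real, norm_sub_sq_real, sub_add_cancel, inner_sub_left C F]
  have hn : (4 : ℝ) ≤ d + 2 := by
    have : (2 : ℝ) ≤ d := by exact_mod_cast hd
    linarith
  have key := competitor_gain_identity (n := (d : ℝ) + 2) (by linarith) he (‖C‖ ^ 2) (‖G‖ ^ 2)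
    (inner ℝ C F) (inner ℝ G GF) (‖F‖ ^ 2) (‖GF‖ ^ 2) (inner ℝ C (evLp 1)) (inner ℝ F (evLp 1))
  have hle := competitor_gain_le hn he (sq_nonneg ‖F‖) (sq_nonneg ‖GF‖)
  have hle2 := mul_le_mul_of_nonneg_left hle (sq_nonneg e)
  have hfirst : 2 * (inner ℝ G GF - 2 * ((d : ℝ) + 2 - 2) * inner ℝ C F) + inner ℝ F (evLp 1)
      = 2 * (‖Ψ‖ ^ 2 - 2 * d * ‖Φ‖ ^ 2) := by
    rw [hga, hca, hf1]; ring
  rw [hfirst] at key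
  have hst : ‖F‖ ^ 2 + ‖GF‖ ^ 2 = ‖Φ‖ ^ 2 + ‖Ψ‖ ^ 2 + (1 + 2 * d) * ‖evLp D‖ ^ 2 := by
    rw [hs, ht]; ring
  rw [← hst]
  linarith

end

/-! ### Nonnegative quadratic forms and the correction `T`. -/

theorem quadForm_smul_vec (A : Matrix (Fin d) (Fin d) ℝ) (a : ℝ) (x : E d) :
    quadForm A (a • x) = a ^ 2 * quadForm A x := by
  simp [quadForm, Matrix.mulVec_smul]; ring

theorem quadForm_nonneg_of_sphere {A : Matrix (Fin d) (Fin d) ℝ}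
    (h : ∀ θ : S d, 0 ≤ quadForm A θ) (x : E d) : 0 ≤ quadForm A x := by
  by_cases hx : x = 0
  · subst hx; simp [quadForm]
  · have h1 := h ⟨‖x‖⁻¹ • x, by simp [norm_smul, hx]⟩
    rw [quadForm_smul_vec] at h1
    exact nonneg_of_mul_nonneg_right h1 (by positivity)

-- Factoring `R = Bᵀ B` writes the form as a sum of squares of linear functionals. Each of them
-- vanishes at any zero of the form, which is what yields quadratic growth with constant `tr R`.
open scoped MatrixOrder Matrix.Norms.L2Operator in
theorem exists_sum_sq {R : Matrix (Fin d) (Fin d) ℝ} (hR : R.IsSymm)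
    (h : ∀ θ : S d, 0 ≤ quadForm R θ) :
    ∃ B : Matrix (Fin d) (Fin d) ℝ, (∀ x : E d, quadForm R x = ∑ k, (∑ i, B k i * x i) ^ 2) ∧
      R.trace = ∑ k, ∑ i, B k i ^ 2 := by
  have hps : R.PosSemidef := Matrix.PosSemidef.of_dotProduct_mulVec_nonneg
    (by rw [Matrix.IsHermitian, Matrix.conjTranspose_eq_transpose_of_trivial]; exact hR)
    (fun v => by simpa [quadForm] using quadForm_nonneg_of_sphere h (WithLp.toLp 2 v))
  obtain ⟨B, rfl⟩ := CStarAlgebra.nonneg_iff_eq_star_mul_self.mp hps.nonneg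
  rw [Matrix.star_eq_conjTranspose, Matrix.conjTranspose_eq_transpose_of_trivial]
  refine ⟨B, fun x => ?_, ?_⟩
  · rw [quadForm, ← Matrix.mulVec_mulVec, Matrix.dotProduct_mulVec, Matrix.vecMul_transpose]
    simp [dotProduct, Matrix.mulVec, pow_two]
  · rw [Matrix.trace, Finset.sum_comm]
    simp [Matrix.mul_apply, pow_two]

theorem sum_sq_le (B : Matrix (Fin d) (Fin d) ℝ) (x : E d) :
    ∑ k, (∑ i, B k i * x i) ^ 2 ≤ (∑ k, ∑ i, B k i ^ 2) * ‖x‖ ^ 2 := by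
  rw [Finset.sum_mul]
  refine Finset.sum_le_sum fun k _ => ?_
  rw [EuclideanSpace.norm_sq_eq]
  simp only [Real.norm_eq_abs, sq_abs]
  exact Finset.sum_mul_sq_le_sq_mul_sq _ _ _

theorem quadForm_le_trace {R : Matrix (Fin d) (Fin d) ℝ} (hR : R.IsSymm)
    (h : ∀ θ : S d, 0 ≤ quadForm R θ) (θ : S d) : quadForm R θ ≤ R.trace := by
  obtain ⟨B, hB, ht⟩ := exists_sum_sq hR h
  rw [hB, ht]
  simpa using sum_sq_le B (θ : E d)

/-- A nonnegative quadratic form grows at most quadratically away from its zeros. -/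
theorem quadForm_le_trace_mul_dist {R : Matrix (Fin d) (Fin d) ℝ} (hR : R.IsSymm)
    (h : ∀ θ : S d, 0 ≤ quadForm R θ) {x₀ : E d} (h0 : quadForm R x₀ = 0) (x : E d) :
    quadForm R x ≤ R.trace * ‖x - x₀‖ ^ 2 := by
  obtain ⟨B, hB, ht⟩ := exists_sum_sq hR h
  rw [hB] at h0
  have hz : ∀ k, ∑ i, B k i * x₀ i = 0 := fun k => by
    have := (Finset.sum_eq_zero_iff_of_nonneg fun k _ => sq_nonneg _).1 h0 k (Finset.mem_univ k)
    exact pow_eq_zero_iff two_ne_zero |>.1 this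
  have he : quadForm R x = ∑ k, (∑ i, B k i * (x - x₀) i) ^ 2 := by
    rw [hB]
    refine Finset.sum_congr rfl fun k _ => ?_
    simp only [PiLp.sub_apply, mul_sub, Finset.sum_sub_distrib, hz, sub_zero]
  rw [he, ht]
  exact sum_sq_le B _

/-- Correction of a symmetric form of trace `1/4` to a nonnegative one. -/
theorem exists_nonneg_correction [NeZero d] {A : Matrix (Fin d) (Fin d) ℝ} (hA : A.IsSymm)
    (ht : A.trace = 1 / 4) :
    ∃ m : ℝ, 0 ≤ m ∧ (m = 0 ∨ ∃ θ₀ : S d, ∀ θ : S d,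
        quadForm A θ ≤ -m + (1 / 4 + d * m) * ‖(θ : E d) - θ₀‖ ^ 2) ∧
      ∀ (a β : ℝ) (b : Fin d → ℝ), (∀ θ : S d, |ev (linPoly b) θ| ≤ β) →
        4 * d * (|a| + β) ≤ 1 → ∃ T : Matrix (Fin d) (Fin d) ℝ, T.trace = 0 ∧
          (∀ θ : S d, 0 ≤ ev (lowPoly A a b + quadPoly T) θ) ∧
          ∀ θ : S d, |ev (quadPoly T) θ| ≤ d * (m + (|a| + β)) := by
  have hd1 : (1 : ℝ) ≤ d := by exact_mod_cast NeZero.one_le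
  have hcont : Continuous fun θ : S d => quadForm A θ := by
    simp_rw [← ev_quadPoly]
    exact (contDiff_ev _ (k := 0)).continuous.comp continuous_subtype_val
  have : Nonempty (S d) := ⟨⟨EuclideanSpace.single 0 1, by simp⟩⟩
  obtain ⟨θ₀, -, hmin⟩ := (isCompact_univ (X := S d)).exists_isMinOn univ_nonempty
    hcont.continuousOn
  have hmin' : ∀ θ : S d, quadForm A θ₀ ≤ quadForm A θ := fun θ => hmin (mem_univ θ)
  -- The negative part of the minimum. If it is nonzero, `R = A + m I` is nonnegative and vanishes
  -- exactly at the value `Q_A(θ₀) = -m`, so its quadratic growth from `θ₀` bounds `Q_A` above.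
  set m : ℝ := max 0 (-quadForm A θ₀) with hm
  have hm0 : 0 ≤ m := le_max_left _ _
  have hmA : ∀ θ : S d, 0 ≤ quadForm A θ + m := fun θ => by
    have := hmin' θ
    have := le_max_right 0 (-quadForm A θ₀)
    linarith
  set R : Matrix (Fin d) (Fin d) ℝ := A + m • 1 with hR
  have hRq : ∀ θ : S d, quadForm R θ = quadForm A θ + m := fun θ => by
    rw [hR, quadForm_add, quadForm_smul, quadForm_one_sphere, mul_one]
  have hRs : R.IsSymm := hA.add (Matrix.isSymm_one.smul m)
  have hRt : R.trace = 1 / 4 + d * m := by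
    rw [hR, Matrix.trace_add, ht, Matrix.trace_smul, Matrix.trace_one, Fintype.card_fin,
      smul_eq_mul, mul_comm]
  have hR0 : ∀ θ : S d, 0 ≤ quadForm R θ := fun θ => by rw [hRq]; exact hmA θ
  refine ⟨m, hm0, ?_, fun a β b hb hs => ?_⟩
  · rcases le_total (-quadForm A θ₀) 0 with h | h
    · exact Or.inl (max_eq_left h)
    · right
      have hme : m = -quadForm A θ₀ := max_eq_right h
      refine ⟨θ₀, fun θ => ?_⟩
      have := quadForm_le_trace_mul_dist hRs hR0 (x₀ := θ₀) (by rw [hRq, hme]; ring) (θ : E d)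
      rw [hRq, hRt] at this
      linarith
  · set κ := |a| + β with hκ
    have hβ : 0 ≤ β := (abs_nonneg _).trans (hb θ₀)
    have hκ0 : 0 ≤ κ := by positivity
    have hD : 0 < 1 + 4 * d * m := by positivity
    set P : S d → ℝ := fun θ => quadForm R θ / (1 + 4 * d * m) with hP
    have hP0 : ∀ θ, 0 ≤ P θ := fun θ => div_nonneg (hR0 θ) hD.le
    have hP1 : ∀ θ, P θ ≤ 1 / 4 := fun θ => by
      rw [hP, div_le_iff₀ hD]
      have := quadForm_le_trace hRs hR0 θ
      rw [hRt] at this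
      linarith
    have hPA : ∀ θ : S d, quadForm A θ = (1 + 4 * d * m) * P θ - m := fun θ => by
      rw [hP]
      simp only [mul_div_cancel₀ _ hD.ne', hRq]
      ring
    -- On the sphere `Q_A + Q_T = (1 - 4dκ) P + κ`, where `P = R / (1 + 4dm)` is nonnegative of
    -- trace `1/4`. The weight `1 - 4dκ` keeps the trace at `1/4` and is nonnegative by the
    -- smallness of `κ`; the added `κ` absorbs `a + b · θ`.
    refine ⟨((1 - 4 * d * κ) / (1 + 4 * d * m)) • R - A + κ • 1, ?_, fun θ => ?_, fun θ => ?_⟩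
    · rw [Matrix.trace_add, Matrix.trace_sub, Matrix.trace_smul, Matrix.trace_smul,
        Matrix.trace_one, hRt, ht, Fintype.card_fin, smul_eq_mul, smul_eq_mul]
      field_simp
      ring
    all_goals
      have hT : quadForm (((1 - 4 * d * κ) / (1 + 4 * d * m)) • R - A + κ • 1) (θ : E d)
          = (1 - 4 * d * κ) * P θ - quadForm A θ + κ := by
        rw [quadForm_add, quadForm_sub, quadForm_smul, quadForm_smul, quadForm_one_sphere, hP]
        ring
    · rw [ev_add, ev_quadPoly, hT, lowPoly, ev_add, ev_add, ev_smul, ev_one, ev_quadPoly]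
      have h1 := neg_abs_le a
      have h2 := neg_le_of_abs_le (hb θ)
      have h3 : 0 ≤ (1 - 4 * d * κ) * P θ := mul_nonneg (by linarith) (hP0 θ)
      linarith
    -- Since `0 ≤ P ≤ 1/4`, the factor `1 - 4dP` lies between `1 - d` and `1`.
    · have : (1 - 4 * d * κ) * P θ - ((1 + 4 * d * m) * P θ - m) + κ
          = (m + κ) * (1 - 4 * d * P θ) := by ring
      rw [ev_quadPoly, hT, hPA, this, abs_mul, abs_of_nonneg (by positivity), mul_comm]
      refine mul_le_mul_of_nonneg_right ?_ (by positivity)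
      rw [abs_le]
      have := hP0 θ
      have h4 := mul_le_mul_of_nonneg_left (hP1 θ) (by positivity : (0 : ℝ) ≤ 4 * d)
      have h5 : 0 ≤ 4 * d * P θ := by positivity
      constructor <;> linarith

/-! ### Sizes of low modes and measure of spherical caps. -/

theorem norm_evLp_sq_le {p : Poly d} {K : ℝ} (h : ∀ θ : S d, |ev p θ| ≤ K) :
    ‖evLp p‖ ^ 2 ≤ K ^ 2 * ‖evLp (1 : Poly d)‖ ^ 2 := by
  have e : ∀ q : Poly d, ‖evLp q‖ ^ 2 = ∫ θ : S d, ev q θ ^ 2 ∂(surfaceMeasure d) := fun q =>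
    (norm_toLp_sq (memLp_ev q)).symm
  rw [e, e, ← integral_const_mul]
  have hc : ∀ q : Poly d, Continuous fun θ : S d => ev q θ ^ 2 := fun q =>
    ((contDiff_ev q (k := 0)).continuous.comp continuous_subtype_val).pow 2
  refine integral_mono (Continuous.integrable_sphere (hc p))
    (Continuous.integrable_sphere ((hc 1).const_smul (K ^ 2))) fun θ => ?_
  simp only [ev_one, one_pow, mul_one]
  rw [← sq_abs]
  exact pow_le_pow_left₀ (abs_nonneg _) (h θ) 2

theorem abs_ev_linPoly_le (b : Fin d → ℝ) (θ : S d) :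
    |ev (linPoly b) θ| ≤ ‖(WithLp.toLp 2 b : E d)‖ := by
  have h := abs_real_inner_le_norm (θ : E d) (WithLp.toLp 2 b : E d)
  rw [norm_sphere, one_mul, PiLp.inner_apply] at h
  rw [ev_linPoly]
  simpa using h

/-- The tangential gradient has square `|b|² - (b · θ)²`; its integral is also `d - 1` times that of
`(b · θ)²`, the eigenvalue of linear forms. -/
theorem norm_evLp_linPoly_sq [NeZero d] (b : Fin d → ℝ) :
    d * ‖evLp (linPoly b)‖ ^ 2
      = ‖(WithLp.toLp 2 b : E d)‖ ^ 2 * ‖evLp (1 : Poly d)‖ ^ 2 := by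
  set v : E d := WithLp.toLp 2 b with hv
  have hg : ∀ x, polyGrad (linPoly b) x = v := fun x => by
    ext i
    rw [polyGrad_apply, linPoly, map_sum, ev_sum]
    simp [MvPolynomial.pderiv_X, Pi.single_apply, hv, ev, apply_ite]
  have hl : ∀ x : E d, ev (linPoly b) x = inner ℝ v x := fun x => by
    rw [ev_linPoly, PiLp.inner_apply]
    simp [hv, mul_comm]
  have h1 := inner_gradLp_poly_linPoly (linPoly b) b
  have h2 : inner ℝ (gradLp (linPoly b)) (gradLp (linPoly b))
      = ∫ θ, inner ℝ (tangentGrad (linPoly b) θ) (tangentGrad (linPoly b) θ)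
        ∂(surfaceMeasure d) := inner_toLp_toLp (memLp_tangentGrad _) (memLp_tangentGrad _)
  have h3 : ∀ θ : S d, inner ℝ (tangentGrad (linPoly b) θ) (tangentGrad (linPoly b) θ)
      = ‖v‖ ^ 2 * ev (1 : Poly d) θ ^ 2 - ev (linPoly b) θ ^ 2 := fun θ => by
    rw [tangentGrad, hg, hl, ev_one, real_inner_self_eq_norm_sq, norm_sub_sq_real, norm_smul,
      inner_smul_right, norm_sphere, mul_one, Real.norm_eq_abs, sq_abs]
    ring
  have hc : ∀ q : Poly d, Integrable (fun θ : S d => ev q θ ^ 2) (surfaceMeasure d) := fun q =>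
    Continuous.integrable_sphere
      (((contDiff_ev q (k := 0)).continuous.comp continuous_subtype_val).pow 2)
  have e : ∀ q : Poly d, ∫ θ : S d, ev q θ ^ 2 ∂(surfaceMeasure d) = ‖evLp q‖ ^ 2 := fun q =>
    norm_toLp_sq (memLp_ev q)
  simp_rw [h3] at h2
  rw [integral_sub ((hc 1).const_mul _) (hc _), integral_const_mul, e, e] at h2
  rw [h2, real_inner_self_eq_norm_sq] at h1
  linarith

/-- The linear map fixing `θ` and scaling its orthogonal complement by `ρ`. -/
def squeeze (θ : E d) (ρ : ℝ) : E d →ₗ[ℝ] E d :=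
  ρ • LinearMap.transvection (innerₛₗ ℝ θ : E d →ₗ[ℝ] ℝ) ((ρ⁻¹ - 1) • θ)

theorem squeeze_apply (θ : E d) {ρ : ℝ} (hρ : ρ ≠ 0) (x : E d) :
    squeeze θ ρ x = inner ℝ θ x • θ + ρ • (x - inner ℝ θ x • θ) := by
  simp only [squeeze, LinearMap.smul_apply, LinearMap.transvection.apply, innerₛₗ_apply_apply]
  match_scalars <;> field_simp
  ring

theorem det_squeeze [NeZero d] (θ : S d) {ρ : ℝ} (hρ : ρ ≠ 0) :
    LinearMap.det (squeeze (θ : E d) ρ) = ρ ^ (d - 1) := by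
  rw [squeeze, LinearMap.det_smul, LinearMap.transvection.det, finrank_euclideanSpace_fin]
  obtain ⟨n, hn⟩ := Nat.exists_eq_succ_of_ne_zero (NeZero.ne d)
  have : (innerₛₗ ℝ (θ : E d) : E d →ₗ[ℝ] ℝ) ((ρ⁻¹ - 1) • (θ : E d)) = ρ⁻¹ - 1 := by
    simp
  rw [this, hn, Nat.succ_sub_one, pow_succ]
  field_simp
  ring

open scoped Pointwise in
/-- Squeezing a small ball around `3/4 θ₀` stays in the cone over the spherical cap. -/
theorem squeeze_image_subset (θ₀ : S d) {ρ : ℝ} (hρ : 0 < ρ) (hρ1 : ρ ≤ 1) :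
    squeeze (θ₀ : E d) ρ '' ball ((3 / 4 : ℝ) • (θ₀ : E d)) (1 / 8)
      ⊆ Ioo (0 : ℝ) 1 • (Subtype.val '' {θ : S d | ‖(θ : E d) - θ₀‖ < ρ}) := by
  rintro _ ⟨x, hx, rfl⟩
  rw [mem_ball, dist_eq_norm] at hx
  set t := inner ℝ (θ₀ : E d) x with ht
  have h0 : inner ℝ (θ₀ : E d) (θ₀ : E d) = 1 := by
    rw [real_inner_self_eq_norm_sq, norm_sphere, one_pow]
  set y := x - t • (θ₀ : E d) with hy
  have horth : inner ℝ (θ₀ : E d) y = 0 := by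
    rw [hy, inner_sub_right, inner_smul_right, h0, ← ht]; ring
  have hdec : x - (3 / 4 : ℝ) • (θ₀ : E d) = y + (t - 3 / 4) • (θ₀ : E d) := by
    rw [hy]; module
  have hsq : ‖x - (3 / 4 : ℝ) • (θ₀ : E d)‖ ^ 2 = ‖y‖ ^ 2 + (t - 3 / 4) ^ 2 := by
    rw [hdec, norm_add_sq_real, inner_smul_right, real_inner_comm, horth, norm_smul, norm_sphere,
      Real.norm_eq_abs, mul_one, sq_abs]
    ring
  have hlt : ‖y‖ ^ 2 + (t - 3 / 4) ^ 2 < (1 / 8) ^ 2 := by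
    rw [← hsq]; exact pow_lt_pow_left₀ hx (norm_nonneg _) two_ne_zero
  -- The radii `3/4` and `1/8` give `5/8 < t < 7/8`. The squeezed point then has norm in `[1/2, 1)`,
  -- and its normalization is within `(ρ/4) / ‖w‖ < ρ` of `θ₀`.
  have hy8 : ‖y‖ < 1 / 8 := by nlinarith [norm_nonneg y]
  have ht1 : 5 / 8 < t := by nlinarith [sq_nonneg ‖y‖]
  have ht2 : t < 7 / 8 := by nlinarith [sq_nonneg ‖y‖]
  rw [squeeze_apply _ hρ.ne', ← ht, ← hy]
  set w := t • (θ₀ : E d) + ρ • y with hw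
  have hwt : ‖w - t • (θ₀ : E d)‖ ≤ ρ / 8 := by
    rw [hw, add_sub_cancel_left, norm_smul, Real.norm_eq_abs, abs_of_pos hρ]
    nlinarith
  have hnt : ‖t • (θ₀ : E d)‖ = t := by
    rw [norm_smul, norm_sphere, Real.norm_eq_abs, abs_of_pos (by linarith), mul_one]
  have hn1 : |‖w‖ - t| ≤ ρ / 8 := by
    have := abs_norm_sub_norm_le w (t • (θ₀ : E d))
    rw [hnt] at this
    exact this.trans hwt
  have hn2 := abs_le.1 hn1
  have hn0 : 1 / 2 ≤ ‖w‖ := by linarith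
  have hw0 : w ≠ 0 := by
    intro h; rw [h, norm_zero] at hn0; linarith
  have hwlt : ‖w‖ < 1 := by linarith
  refine ⟨‖w‖, ⟨by linarith, hwlt⟩, ‖w‖⁻¹ • w,
    ⟨⟨‖w‖⁻¹ • w, by simp [norm_smul, hw0]⟩, ?_, rfl⟩, ?_⟩
  · show ‖‖w‖⁻¹ • w - (θ₀ : E d)‖ < ρ
    have e : ‖w‖⁻¹ • w - (θ₀ : E d)
        = ‖w‖⁻¹ • ((w - t • (θ₀ : E d)) + (t - ‖w‖) • (θ₀ : E d)) := by
      have : ‖w‖ ≠ 0 := norm_ne_zero_iff.2 hw0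
      match_scalars <;> field_simp
      ring
    rw [e, norm_smul, norm_inv, norm_norm, inv_mul_lt_iff₀ (by linarith)]
    calc _ ≤ ‖w - t • (θ₀ : E d)‖ + ‖(t - ‖w‖) • (θ₀ : E d)‖ := norm_add_le _ _
      _ ≤ ρ / 8 + ρ / 8 := by
        refine add_le_add hwt ?_
        rw [norm_smul, norm_sphere, mul_one, Real.norm_eq_abs, abs_sub_comm]
        exact hn1
      _ < ‖w‖ * ρ := by nlinarith
  · simp [smul_smul, hw0]

-- The area of a cap is `d` times the volume of the cone over it, and that cone contains the image
-- of a fixed ball under a linear map of determinant `ρ^(d-1)`.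
open scoped Pointwise in
theorem exists_le_measure_cap [NeZero d] : ∃ κ : ℝ, 0 < κ ∧ ∀ (θ₀ : S d) (ρ : ℝ), 0 < ρ → ρ ≤ 1 →
    κ * ρ ^ (d - 1) ≤ (surfaceMeasure d).real {θ : S d | ‖(θ : E d) - θ₀‖ < ρ} := by
  have hd : (0 : ℝ) < d := by exact_mod_cast NeZero.pos d
  set V := (volume : Measure (E d)).real (ball 0 (1 / 8)) with hV
  have hVpos : 0 < V := ENNReal.toReal_pos (measure_ball_pos _ _ (by norm_num)).ne'
    measure_ball_lt_top.ne
  refine ⟨d * V, by positivity, fun θ₀ ρ hρ hρ1 => ?_⟩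
  have hmeas : MeasurableSet {θ : S d | ‖(θ : E d) - θ₀‖ < ρ} :=
    (isOpen_lt (by fun_prop) continuous_const).measurableSet
  have hfin : (volume : Measure (E d))
      (Ioo (0 : ℝ) 1 • (Subtype.val '' {θ : S d | ‖(θ : E d) - θ₀‖ < ρ})) ≠ ⊤ := by
    refine ((measure_mono ?_).trans_lt
      (measure_ball_lt_top (μ := (volume : Measure (E d))) (x := 0) (r := 1))).ne
    rintro _ ⟨r, hr, _, ⟨θ, -, rfl⟩, rfl⟩
    simp only [mem_ball_zero_iff, norm_smul, norm_sphere, mul_one, Real.norm_eq_abs]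
    rw [abs_of_pos hr.1]; exact hr.2
  have h1 := measureReal_mono (μ := (volume : Measure (E d))) (squeeze_image_subset θ₀ hρ hρ1) hfin
  rw [measureReal_def, Measure.addHaar_image_linearMap, det_squeeze θ₀ hρ.ne',
    Measure.addHaar_ball_center, ENNReal.toReal_mul, ENNReal.toReal_ofReal (abs_nonneg _),
    abs_of_pos (by positivity), ← measureReal_def, ← hV] at h1
  rw [surfaceMeasure, measureReal_def, Measure.toSphere_apply' _ hmeas, ENNReal.toReal_mul,
    ENNReal.toReal_natCast, finrank_euclideanSpace_fin, ← measureReal_def]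
  nlinarith

/-! ### The negative part of `Q_A` in general dimension. -/

theorem norm_toLp_sub_evLp_sq {c : S d → ℝ} (hc : MemLp c 2 (surfaceMeasure d)) (p : Poly d) :
    ‖hc.toLp c - evLp p‖ ^ 2 = ∫ θ : S d, (c θ - ev p θ) ^ 2 ∂(surfaceMeasure d) := by
  have := norm_toLp_sq (hc.sub (memLp_ev p))
  rw [MemLp.toLp_sub hc (memLp_ev p)] at this
  exact this.symm

theorem measurableSet_cap (θ₀ : S d) (ρ : ℝ) :
    MeasurableSet {θ : S d | ‖(θ : E d) - θ₀‖ < ρ} :=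
  (isOpen_lt (by fun_prop) continuous_const).measurableSet

/-- A nonnegative function is far from a form which is negative on a cap. -/
theorem measure_cap_mul_le {c : S d → ℝ} (hc : MemLp c 2 (surfaceMeasure d))
    (h0 : ∀ᵐ θ ∂(surfaceMeasure d), 0 ≤ c θ) {A : Matrix (Fin d) (Fin d) ℝ} {m ρ : ℝ} (hm : 0 ≤ m)
    {θ₀ : S d} (hA : ∀ θ : S d, quadForm A θ ≤ -m + (1 / 4 + d * m) * ‖(θ : E d) - θ₀‖ ^ 2)
    (hρm : (1 / 4 + d * m) * ρ ^ 2 ≤ m / 2) :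
    (surfaceMeasure d).real {θ : S d | ‖(θ : E d) - θ₀‖ < ρ} * (m / 2) ^ 2
      ≤ ‖hc.toLp c - evLp (quadPoly A)‖ ^ 2 := by
  rw [norm_toLp_sub_evLp_sq, ← smul_eq_mul, ← integral_indicator_const _ (measurableSet_cap θ₀ ρ)]
  refine integral_mono_ae ((integrable_const _).indicator (measurableSet_cap θ₀ ρ))
    (hc.sub (memLp_ev _)).integrable_sq ?_
  filter_upwards [h0] with θ hθ
  rw [indicator_apply]
  split_ifs with hθρ
  swap
  · exact sq_nonneg _
  refine pow_le_pow_left₀ (by positivity) ?_ 2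
  have h1 := hA θ
  have h2 : ‖(θ : E d) - θ₀‖ ^ 2 ≤ ρ ^ 2 := pow_le_pow_left₀ (norm_nonneg _) (le_of_lt hθρ) 2
  have h3 := mul_le_mul_of_nonneg_left h2 (by positivity : 0 ≤ 1 / 4 + d * m)
  rw [ev_quadPoly]
  linarith

/-- For `m ≤ 1` a cap of radius comparable to `√m`, on which `c - Q_A ≥ m/2`, contributes `m²
√m^(d-1)` to the squared distance. For `m ≥ 1` a cap of fixed radius contributes a multiple of `m²`.
-/
theorem exists_sqrt_pow_le [NeZero d] : ∃ M : ℝ, 0 < M ∧ ∀ {c : S d → ℝ}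
    (hc : MemLp c 2 (surfaceMeasure d)), (∀ᵐ θ ∂(surfaceMeasure d), 0 ≤ c θ) →
    ∀ {A : Matrix (Fin d) (Fin d) ℝ} {m : ℝ}, 0 < m → ∀ {θ₀ : S d},
    (∀ θ : S d, quadForm A θ ≤ -m + (1 / 4 + d * m) * ‖(θ : E d) - θ₀‖ ^ 2) →
    √m ^ (d - 1 + 4) ≤ M * ‖hc.toLp c - evLp (quadPoly A)‖ ^ 2 ∨
      m ^ 2 ≤ M * ‖hc.toLp c - evLp (quadPoly A)‖ ^ 2 := by
  obtain ⟨κ, hκ, hcap⟩ := exists_le_measure_cap (d := d)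
  have hd : (1 : ℝ) ≤ d := by exact_mod_cast NeZero.one_le
  -- With `ρ² = m / K` for `m ≤ 1`, and `ρ² = 1 / K` for `m ≥ 1`, one has `(1/4 + dm) ρ² ≤ m/2`.
  set K : ℝ := 1 / 2 + 2 * d with hK
  have hK1 : 1 ≤ K := by linarith
  have hsK : 1 ≤ √K := Real.one_le_sqrt.2 hK1
  have hsK2 : √K ^ 2 = K := Real.sq_sqrt (by linarith)
  refine ⟨4 * √K ^ (d - 1) / κ, by positivity, fun {c} hc h0 {A m} hm {θ₀} hA => ?_⟩
  set N := ‖hc.toLp c - evLp (quadPoly A)‖ ^ 2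
  have key : ∀ ρ, 0 < ρ → ρ ≤ 1 → (1 / 4 + d * m) * ρ ^ 2 ≤ m / 2 →
      κ * ρ ^ (d - 1) * (m / 2) ^ 2 ≤ N := fun ρ h1 h2 h3 =>
    (mul_le_mul_of_nonneg_right (hcap θ₀ ρ h1 h2) (by positivity)).trans
      (measure_cap_mul_le hc h0 hm.le hA h3)
  have hsm2 : √m ^ 2 = m := Real.sq_sqrt hm.le
  rcases le_total m 1 with hm1 | hm1
  · left
    have hs1 : √m ≤ 1 := Real.sqrt_le_one.2 hm1
    have := key (√m / √K) (by positivity) (by rw [div_le_one (by positivity)]; linarith) (by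
      rw [div_pow, hsm2, hsK2, mul_div_assoc', div_le_iff₀ (by positivity), hK]
      nlinarith [mul_nonneg (mul_nonneg (Nat.cast_nonneg d) hm.le) (sub_nonneg.2 hm1)])
    rw [div_mul_eq_mul_div, le_div_iff₀ hκ]
    rw [div_pow, mul_div_assoc', div_mul_eq_mul_div, div_le_iff₀ (by positivity)] at this
    have h4 : √m ^ (d - 1 + 4) = √m ^ (d - 1) * m ^ 2 := by
      rw [pow_add, show 4 = 2 * 2 from rfl, pow_mul, hsm2]
    rw [h4]
    linarith
  · right
    have := key (1 / √K) (by positivity) (by rw [div_le_one (by positivity)]; linarith) (by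
      rw [div_pow, hsK2, one_pow, mul_one_div, div_le_iff₀ (by positivity)]
      nlinarith)
    rw [div_mul_eq_mul_div, le_div_iff₀ hκ]
    rw [div_pow, mul_div_assoc', div_mul_eq_mul_div, div_le_iff₀ (by positivity), one_pow] at this
    linarith

/-- Interpolation: writing `L = y^(n+4)`, the factors are at most `y⁴` and `yⁿ`. It is used with `t
= √m` and `n = d - 1`, where the exponent is `γ = (d - 1)/(d + 3)`. -/
theorem pow_four_mul_rpow_le {n : ℕ} {t w L : ℝ} (ht : 0 ≤ t) (hw : 0 ≤ w) (hwL : w ≤ L)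
    (h : t ^ (n + 4) ≤ L) : t ^ 4 * w ^ ((n : ℝ) / (n + 4)) ≤ L := by
  have hL : 0 ≤ L := hw.trans hwL
  set y := L ^ (((n + 4 : ℕ) : ℝ)⁻¹) with hy
  have hy0 : 0 ≤ y := by positivity
  have hyn : y ^ (n + 4) = L := Real.rpow_inv_natCast_pow hL (by omega)
  have hty : t ≤ y := le_of_pow_le_pow_left₀ (by omega) hy0 (h.trans_eq hyn.symm)
  have hwy : w ^ ((n : ℝ) / (n + 4)) ≤ y ^ n := by
    refine (Real.rpow_le_rpow hw hwL (by positivity)).trans_eq ?_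
    rw [hy, ← Real.rpow_mul_natCast hL]
    congr 1
    push_cast
    field_simp
  calc _ ≤ y ^ 4 * y ^ n := mul_le_mul (pow_le_pow_left₀ ht hty 4) hwy (by positivity)
        (by positivity)
    _ = L := by rw [← pow_add, add_comm, hyn]

/-! ### The negative part of `Q_A` in the plane. -/

/-- Rotation of the plane by a right angle. -/
def rot : E 2 →L[ℝ] E 2 :=
  (EuclideanSpace.proj (𝕜 := ℝ) (0 : Fin 2)).smulRight (EuclideanSpace.single 1 1)
    - (EuclideanSpace.proj (𝕜 := ℝ) (1 : Fin 2)).smulRight (EuclideanSpace.single 0 1)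

theorem rot_apply_zero (x : E 2) : rot x 0 = -x 1 := by simp [rot]

theorem rot_apply_one (x : E 2) : rot x 1 = x 0 := by simp [rot]

theorem traceE_rot : traceE rot = 0 := by
  rw [rot, traceE_sub, traceE_smulRight, traceE_smulRight]
  simp

theorem rot_rot (x : E 2) : rot (rot x) = -x := by
  ext i
  fin_cases i
  · simp [rot_apply_zero, rot_apply_one]
  · simp [rot_apply_zero, rot_apply_one]

theorem inner_two (x y : E 2) : inner ℝ x y = x 0 * y 0 + x 1 * y 1 := by
  rw [PiLp.inner_apply, Fin.sum_univ_two]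
  simp [mul_comm]

theorem inner_rot_self (x : E 2) : inner ℝ (rot x) x = 0 := by
  rw [inner_two, rot_apply_zero, rot_apply_one]; ring

theorem inner_rot_rot (x y : E 2) : inner ℝ (rot x) (rot y) = inner ℝ x y := by
  simp only [inner_two, rot_apply_zero, rot_apply_one]; ring

theorem inner_rot_right (x y : E 2) : inner ℝ x (rot y) = -inner ℝ (rot x) y := by
  simp only [inner_two, rot_apply_zero, rot_apply_one]; ring

theorem norm_rot (x : E 2) : ‖rot x‖ = ‖x‖ := by
  rw [@norm_eq_sqrt_real_inner _ _ _ (rot x), inner_rot_rot, ← norm_eq_sqrt_real_inner]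

theorem inner_sq_add_inner_rot_sq (θ₀ θ : S 2) :
    inner ℝ (θ₀ : E 2) θ ^ 2 + inner ℝ (rot θ₀) (θ : E 2) ^ 2 = 1 := by
  have h : ∀ η : S 2, (η : E 2) 0 * (η : E 2) 0 + (η : E 2) 1 * (η : E 2) 1 = 1 := fun η => by
    rw [← inner_two, real_inner_self_eq_norm_sq, norm_sphere, one_pow]
  simp only [inner_two, rot_apply_zero, rot_apply_one]
  linear_combination ((θ : E 2) 0 * (θ : E 2) 0 + (θ : E 2) 1 * (θ : E 2) 1) * h θ₀ + h θ

/-- A bounded tangent field whose divergence approximates a point mass at `θ₀`. -/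
def bumpField (θ₀ : E 2) (s : ℝ) (x : E 2) : E 2 :=
  (Real.arctan (inner ℝ (rot θ₀) x / s) * (1 + inner ℝ θ₀ x)) • rot x

theorem contDiff_bumpField (θ₀ : E 2) (s : ℝ) {k : ℕ∞} :
    ContDiff ℝ k (bumpField θ₀ s) := by
  unfold bumpField
  have h1 : ContDiff ℝ k fun x : E 2 => Real.arctan (inner ℝ (rot θ₀) x / s) :=
    ((contDiff_const.inner ℝ contDiff_id).div_const s).arctan
  exact (h1.mul (contDiff_const.add (contDiff_const.inner ℝ contDiff_id))).smul rot.contDiff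

/-- If `θ₀` is a unit vector and `α` the angle from it, this is the `α`-derivative of `arctan(sin α
/ s) (1 + cos α)`. The first term concentrates at `α = 0`; the factor `1 + cos α` suppresses the
opposite concentration at the antipode, where `sin α` vanishes too. -/
theorem sphereDivergence_bumpField (θ₀ : E 2) {s : ℝ} (hs : s ≠ 0) (θ : S 2) :
    sphereDivergence (bumpField θ₀ s) θ
      = s * inner ℝ θ₀ (θ : E 2) * (1 + inner ℝ θ₀ (θ : E 2))
          / (s ^ 2 + inner ℝ (rot θ₀) (θ : E 2) ^ 2)
        - inner ℝ (rot θ₀) (θ : E 2) * Real.arctan (inner ℝ (rot θ₀) (θ : E 2) / s) := by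
  have hv : HasFDerivAt (fun x : E 2 => inner ℝ (rot θ₀) x / s)
      (s⁻¹ • innerSL ℝ (rot θ₀)) (θ : E 2) := by
    simp_rw [div_eq_inv_mul]
    exact ((innerSL ℝ (rot θ₀)).hasFDerivAt).const_mul s⁻¹
  have hu : HasFDerivAt (fun x : E 2 => 1 + inner ℝ θ₀ x) (innerSL ℝ θ₀) (θ : E 2) :=
    ((innerSL ℝ θ₀).hasFDerivAt).const_add 1
  have hF := hv.arctan.mul hu
  have hr : DifferentiableAt ℝ (fun x : E 2 => rot x) (θ : E 2) := rot.differentiableAt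
  have hX : HasFDerivAt (bumpField θ₀ s) _ (θ : E 2) := hF.smul rot.hasFDerivAt
  have hdiv := divergence_smul hF hr
  have hrot : divergence (fun x : E 2 => rot x) (θ : E 2) = 0 := by
    rw [divergence_eq_traceE, rot.hasFDerivAt.fderiv, traceE_rot]
  rw [hrot, mul_zero, zero_add] at hdiv
  have hdiv' : divergence (bumpField θ₀ s) (θ : E 2) = _ := hdiv
  rw [sphereDivergence, hdiv', hX.fderiv]
  simp only [add_apply, smul_apply,
    ContinuousLinearMap.smulRight_apply, innerSL_apply_apply, inner_add_left, inner_smul_left,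
    inner_rot_self, mul_zero, inner_rot_right, rot_rot, inner_neg_left, smul_eq_mul]
  have : s ^ 2 + inner ℝ (rot θ₀) (θ : E 2) ^ 2 ≠ 0 := by positivity
  field_simp
  ring

/-- Here `u`, `v` are the cosine and sine of the angle and `2(1 - u) = |θ - θ₀|²`. Where `u ≥ 0` the
kernel is nonnegative, is at least `1/(4s)` on the cap of radius `s`, and satisfies `(1 - u) K ≤ s`,
so the quadratic loss in `φ` costs only `O(s)`. Where `u ≤ 0` the kernel is bounded by `1`. -/
theorem bump_lower_bound {u v s m φ : ℝ} (huv : u ^ 2 + v ^ 2 = 1) (hs : 0 < s) (hs1 : s ≤ 1)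
    (hm : 0 ≤ m) (hφ : m - (1 / 4 + 2 * m) * (2 * (1 - u)) ≤ φ) :
    (if 2 * (1 - u) < s ^ 2 then m / (4 * s) else 0) - (1 / 2 + 4 * m) * s - |φ|
      ≤ φ * (s * u * (1 + u) / (s ^ 2 + v ^ 2)) := by
  have hD : 0 < s ^ 2 + v ^ 2 := by positivity
  have hu1 : u ≤ 1 := by nlinarith [sq_nonneg v]
  have hu2 : -1 ≤ u := by nlinarith [sq_nonneg v]
  have hs2 : s ^ 2 ≤ 1 := pow_le_one₀ hs.le hs1
  set K := s * u * (1 + u) / (s ^ 2 + v ^ 2) with hK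
  have hms : 0 ≤ (1 / 2 + 4 * m) * s := by positivity
  rcases le_total 0 u with hu | hu
  · have hK0 : 0 ≤ K := by positivity
    have h1 : (1 - u) * K ≤ s := by
      rw [hK, mul_div_assoc', div_le_iff₀ hD]
      have : (1 - u) * (s * u * (1 + u)) = s * u * v ^ 2 := by
        linear_combination (-(s * u)) * huv
      rw [this]
      nlinarith [mul_nonneg (mul_nonneg hs.le (sq_nonneg v)) (sub_nonneg.2 hu1), pow_pos hs 3]
    have h2 := mul_le_mul_of_nonneg_right hφ hK0
    have h3 : (1 / 2 + 4 * m) * ((1 - u) * K) ≤ (1 / 2 + 4 * m) * s :=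
      mul_le_mul_of_nonneg_left h1 (by positivity)
    have h4 : (if 2 * (1 - u) < s ^ 2 then m / (4 * s) else 0) ≤ m * K := by
      split_ifs with h
      · rw [div_eq_mul_one_div]
        refine mul_le_mul_of_nonneg_left ?_ hm
        have hu3 : 1 / 2 < u := by linarith
        have hv : v ^ 2 < s ^ 2 := by nlinarith
        rw [hK, div_le_div_iff₀ (by positivity) hD]
        have : 3 / 4 ≤ u * (1 + u) := by nlinarith
        nlinarith [pow_pos hs 2]
      · positivity
    have := abs_nonneg φ
    nlinarith
  · rw [if_neg (by linarith)]
    have h1 : |K| ≤ 1 := by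
      rw [hK, abs_div, abs_of_pos hD, div_le_one hD, abs_of_nonpos (by
        have : 0 ≤ s * (-u) * (1 + u) :=
          mul_nonneg (mul_nonneg hs.le (by linarith)) (by linarith)
        linarith)]
      have : -(s * u * (1 + u)) ≤ s * v ^ 2 := by nlinarith [mul_nonneg hs.le (by linarith : 0 ≤ 1 + u)]
      nlinarith [sq_nonneg v]
    have h2 : |φ * K| ≤ |φ| := by
      rw [abs_mul]
      exact mul_le_of_le_one_right (abs_nonneg _) h1
    have := neg_abs_le (φ * K)
    linarith

theorem abs_arctan_le_two (x : ℝ) : |Real.arctan x| ≤ 2 := by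
  have h1 := Real.neg_pi_div_two_lt_arctan x
  have h2 := Real.arctan_lt_pi_div_two x
  have h3 := Real.pi_lt_four
  rw [abs_le]
  constructor <;> linarith

theorem norm_bumpField_le (θ₀ : S 2) (s : ℝ) (θ : S 2) : ‖bumpField θ₀ s θ‖ ≤ 4 := by
  have h1 : |Real.arctan (inner ℝ (rot θ₀) (θ : E 2) / s)| ≤ 2 :=
    abs_arctan_le_two _
  have h2 : |1 + inner ℝ (θ₀ : E 2) (θ : E 2)| ≤ 2 := by
    have := abs_real_inner_le_norm (θ₀ : E 2) (θ : E 2)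
    rw [norm_sphere, norm_sphere, mul_one, abs_le] at this
    rw [abs_le]
    constructor <;> linarith
  rw [bumpField, norm_smul, norm_rot, norm_sphere, mul_one, Real.norm_eq_abs, abs_mul]
  nlinarith [abs_nonneg (Real.arctan (inner ℝ (rot θ₀) (θ : E 2) / s))]

theorem norm_toLp_sub_gradLp_sq {g : S d → E d} (hg : MemLp g 2 (surfaceMeasure d)) (p : Poly d) :
    ‖hg.toLp g - gradLp p‖ ^ 2 = ∫ θ : S d, ‖g θ - tangentGrad p θ‖ ^ 2 ∂(surfaceMeasure d) := by
  have := inner_toLp_toLp (hg.sub (memLp_tangentGrad p)) (hg.sub (memLp_tangentGrad p))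
  rw [MemLp.toLp_sub hg (memLp_tangentGrad p), real_inner_self_eq_norm_sq] at this
  refine this.trans ?_
  simp_rw [real_inner_self_eq_norm_sq]
  rfl

/-- The concentrating part of the divergence gives the cap term. The other contributions are linear
in `φ` and its gradient with bounded coefficients, and Young's inequality with parameter `μ` absorbs
them. -/
theorem bump_integrand_bound {c : S 2 → ℝ} {g : S 2 → E 2} {A : Matrix (Fin 2) (Fin 2) ℝ}
    {m s μ : ℝ} (hm : 0 ≤ m) (hs : 0 < s) (hs1 : s ≤ 1) (hμ : 0 < μ)
    (hsμ : (1 / 2 + 4 * m) * s ≤ μ) {θ₀ θ : S 2} (hc : 0 ≤ c θ)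
    (hA : quadForm A θ ≤ -m + (1 / 4 + 2 * m) * ‖(θ : E 2) - θ₀‖ ^ 2) :
    {θ : S 2 | ‖(θ : E 2) - θ₀‖ < s}.indicator (fun _ => m / (4 * s)) θ - 3 * μ
        - 4 / μ * ((c θ - ev (quadPoly A) θ) ^ 2 + ‖g θ - tangentGrad (quadPoly A) θ‖ ^ 2)
      ≤ (c θ - ev (quadPoly A) θ) * sphereDivergence (bumpField θ₀ s) θ
        + inner ℝ (g θ - tangentGrad (quadPoly A) θ) (bumpField θ₀ s θ) := by
  set γ := g θ - tangentGrad (quadPoly A) θ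
  set φ := c θ - ev (quadPoly A) θ with hφ
  set u := inner ℝ (θ₀ : E 2) (θ : E 2) with hu
  set v := inner ℝ (rot θ₀) (θ : E 2) with hv
  have huv : u ^ 2 + v ^ 2 = 1 := inner_sq_add_inner_rot_sq θ₀ θ
  have hr : ‖(θ : E 2) - θ₀‖ ^ 2 = 2 * (1 - u) := by
    rw [norm_sub_sq_real, norm_sphere, norm_sphere, real_inner_comm, ← hu]; ring
  have hind : {θ : S 2 | ‖(θ : E 2) - θ₀‖ < s}.indicator (fun _ => m / (4 * s)) θ
      = if 2 * (1 - u) < s ^ 2 then m / (4 * s) else 0 := by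
    rw [indicator_apply, ← hr]
    congr 1
    rw [mem_ofPred_eq, eq_iff_iff, pow_lt_pow_iff_left₀ (norm_nonneg _) hs.le two_ne_zero]
  have h1 := bump_lower_bound (φ := φ) huv hs hs1 hm (by
    rw [hφ, ev_quadPoly, ← hr]; linarith)
  rw [hind, sphereDivergence_bumpField _ hs.ne', ← hu, ← hv, mul_sub φ]
  have hv1 : |v| ≤ 1 := by
    rw [← sq_le_one_iff_abs_le_one]; nlinarith [sq_nonneg u]
  have harc : |Real.arctan (v / s)| ≤ 2 :=
    abs_arctan_le_two _
  have h2 : φ * (v * Real.arctan (v / s)) ≤ 2 * |φ| := by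
    refine (le_abs_self _).trans ?_
    rw [abs_mul, abs_mul, mul_comm]
    refine mul_le_mul_of_nonneg_right ?_ (abs_nonneg _)
    nlinarith [abs_nonneg (Real.arctan (v / s)), abs_nonneg v]
  have h3 : -(4 * ‖γ‖) ≤ inner ℝ γ (bumpField θ₀ s θ) := by
    have := (abs_le.1 (abs_real_inner_le_norm γ (bumpField θ₀ s θ))).1
    have := mul_le_mul_of_nonneg_left (norm_bumpField_le θ₀ s θ) (norm_nonneg γ)
    linarith
  have young : ∀ {a : ℝ}, 4 * a ≤ μ + 4 / μ * a ^ 2 := fun {a} => by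
    have : μ + 4 / μ * a ^ 2 - 4 * a = (μ - 2 * a) ^ 2 / μ := by field_simp; ring
    have : 0 ≤ (μ - 2 * a) ^ 2 / μ := by positivity
    linarith
  have h4 := young (a := |φ|)
  have h5 := young (a := ‖γ‖)
  rw [sq_abs] at h4
  have := abs_nonneg φ
  rw [mul_add (4 / μ)]
  linarith

/-- In the plane a nonnegative function stays away from a negative form in `H¹` norm. -/
theorem exists_sq_le_two : ∃ M : ℝ, 0 < M ∧ ∀ {c : S 2 → ℝ} {g : S 2 → E 2}
    (h : HasSphereWeakGradient c g), (∀ᵐ θ ∂(surfaceMeasure 2), 0 ≤ c θ) →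
    ∀ {A : Matrix (Fin 2) (Fin 2) ℝ} {m : ℝ}, 0 < m → ∀ {θ₀ : S 2},
    (∀ θ : S 2, quadForm A θ ≤ -m + (1 / 4 + 2 * m) * ‖(θ : E 2) - θ₀‖ ^ 2) →
    m ^ 2 ≤ M * (‖h.memLp.toLp c - evLp (quadPoly A)‖ ^ 2
      + ‖h.memLp_grad.toLp g - gradLp (quadPoly A)‖ ^ 2) := by
  obtain ⟨κ, hκ, hcap⟩ := exists_le_measure_cap (d := 2)
  set σ := (surfaceMeasure 2).real univ with hσ
  have hσ0 : 0 ≤ σ := measureReal_nonneg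
  -- With `μ = η m`, the total error `3 μ σ` is at most `κ m / 8`, half of the main term.
  set η := min 1 (κ / (24 * (σ + 1))) with hη
  have hη0 : 0 < η := lt_min one_pos (by positivity)
  have hη1 : η ≤ 1 := min_le_left _ _
  have hησ : 3 * η * σ ≤ κ / 8 := by
    have h1 : η ≤ κ / (24 * (σ + 1)) := min_le_right _ _
    rw [le_div_iff₀ (by positivity)] at h1
    nlinarith
  refine ⟨32 / (κ * η), by positivity, fun {c g} h h0 {A m} hm {θ₀} hA => ?_⟩
  set p := quadPoly A with hp
  have hφ := h.sub (hasSphereWeakGradient_ev p)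
  set μ := η * m with hμ
  have hμ0 : 0 < μ := by positivity
  -- Makes the `O(s)` loss of the kernel estimate exactly `μ`.
  set s := μ / (1 / 2 + 4 * m) with hs
  have hs0 : 0 < s := by positivity
  have hsμ : (1 / 2 + 4 * m) * s = μ := by rw [hs]; field_simp
  have hs1 : s ≤ 1 := by
    rw [hs, div_le_one (by positivity), hμ]; nlinarith
  have hX := contDiff_bumpField (θ₀ : E 2) s (k := ⊤)
  have hX0 : ∀ θ : S 2, inner ℝ (bumpField θ₀ s θ) (θ : E 2) = 0 := fun θ => by
    rw [bumpField, inner_smul_left, inner_rot_self, mul_zero]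
  have hint := hφ.integral_eq _ hX hX0
  have i1 : Integrable (fun θ : S 2 => (c θ - ev p θ) * sphereDivergence (bumpField θ₀ s) θ)
      (surfaceMeasure 2) :=
    MemLp.integrable_mul_two hφ.memLp (Continuous.memLp_sphere
      ((continuous_sphereDivergence (hX.of_le (by exact_mod_cast le_top)))))
  have i2 : Integrable (fun θ : S 2 => inner ℝ (g θ - tangentGrad p θ) (bumpField θ₀ s θ))
      (surfaceMeasure 2) :=
    MemLp.integrable_inner_two hφ.memLp_grad (Continuous.memLp_sphere
      (hX.continuous.comp continuous_subtype_val))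
  have i3 : Integrable ({θ : S 2 | ‖(θ : E 2) - θ₀‖ < s}.indicator (fun _ => m / (4 * s)))
      (surfaceMeasure 2) := (integrable_const _).indicator (measurableSet_cap θ₀ s)
  have i4 : Integrable (fun θ : S 2 => (c θ - ev p θ) ^ 2) (surfaceMeasure 2) :=
    hφ.memLp.integrable_sq
  have i5 : Integrable (fun θ : S 2 => ‖g θ - tangentGrad p θ‖ ^ 2) (surfaceMeasure 2) :=
    hφ.memLp_grad.integrable_norm_pow two_ne_zero
  have hmono := integral_mono_ae ((i3.sub (integrable_const (3 * μ))).sub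
      ((i4.add i5).const_mul (4 / μ))) (i1.add i2) (by
    filter_upwards [h0] with θ hθ
    exact bump_integrand_bound hm.le hs0 hs1 hμ0 hsμ.le hθ (hA θ))
  have e1 := integral_add i1 i2
  have e2 := integral_sub (i3.sub (integrable_const (3 * μ))) ((i4.add i5).const_mul (4 / μ))
  have e3 := integral_sub i3 (integrable_const (3 * μ))
  have e4 := integral_add i4 i5
  rw [integral_indicator_const _ (measurableSet_cap θ₀ s), integral_const, smul_eq_mul,
    smul_eq_mul, ← hσ] at e3
  rw [← norm_toLp_sub_evLp_sq h.memLp, ← norm_toLp_sub_gradLp_sq h.memLp_grad] at e4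
  rw [integral_const_mul] at e2
  set N := ‖h.memLp.toLp c - evLp p‖ ^ 2 + ‖h.memLp_grad.toLp g - gradLp p‖ ^ 2
  -- The right-hand side of the pointwise bound integrates to zero by the weak formula for `c -
  -- Q_A`.
  have key : (surfaceMeasure 2).real {θ : S 2 | ‖(θ : E 2) - θ₀‖ < s} * (m / (4 * s))
      - σ * (3 * μ) - 4 / μ * N ≤ 0 := by
    have l := e2.trans (congrArg₂ (fun x y => x - y) e3 (congrArg (fun x => 4 / μ * x) e4))
    have r := e1.trans ((congrArg (fun x => x + _) hint).trans (neg_add_cancel _))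
    have := l.symm.le.trans (hmono.trans r.le)
    linarith
  have hc1 := hcap θ₀ s hs0 hs1
  -- In the plane a cap has measure at least `κ s`, so the dependence on `s` cancels and the bound
  -- is linear in `m`.
  have h2 : κ * m / 4 ≤ (surfaceMeasure 2).real {θ : S 2 | ‖(θ : E 2) - θ₀‖ < s}
      * (m / (4 * s)) := by
    refine le_trans (le_of_eq ?_) (mul_le_mul_of_nonneg_right hc1 (by positivity))
    norm_num
    field_simp
  have h3 : σ * (3 * μ) ≤ κ / 8 * m := by
    rw [hμ]; nlinarith
  have h4 : κ * m / 8 ≤ 4 / μ * N := by linarith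
  rw [div_mul_eq_mul_div, le_div_iff₀ hμ0] at h4
  rw [div_mul_eq_mul_div, le_div_iff₀ (by positivity)]
  rw [hμ] at h4
  linarith

/-! ### Absorbing the errors and conclusion. -/

theorem norm_evLp_one_sq_pos [NeZero d] : 0 < ‖evLp (1 : Poly d)‖ ^ 2 := by
  have h : ∫ θ : S d, ev (1 : Poly d) θ ^ 2 ∂(surfaceMeasure d) = ‖evLp (1 : Poly d)‖ ^ 2 :=
    norm_toLp_sq (memLp_ev 1)
  rw [← h]
  simp only [ev_one, one_pow, integral_const, smul_eq_mul, mul_one]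
  exact ENNReal.toReal_pos (by
    simp [surfaceMeasure, NeZero.ne d, (measure_ball_pos volume (0 : E d) one_pos).ne'])
    (measure_ne_top _ _)

theorem norm_add_sq_le_two_mul {F : Type*} [SeminormedAddCommGroup F] (x y : F) :
    ‖x + y‖ ^ 2 ≤ 2 * ‖x‖ ^ 2 + 2 * ‖y‖ ^ 2 := by
  have h := norm_add_le x y
  nlinarith [sq_nonneg (‖x‖ - ‖y‖), norm_nonneg (x + y), norm_nonneg x, norm_nonneg y]

theorem gammaExp_nonneg (hd : 2 ≤ d) : 0 ≤ gammaExp d := by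
  have : (2 : ℝ) ≤ d := by exact_mod_cast hd
  rw [gammaExp]
  split_ifs
  · exact le_rfl
  · exact div_nonneg (by linarith) (by linarith)

/-- The negative part of the quadratic form closest to `c` is controlled by the distance. -/
theorem exists_sq_mul_rpow_le [NeZero d] (hd : 2 ≤ d) : ∃ M : ℝ, 1 ≤ M ∧
    ∀ {c : S d → ℝ} {g : S d → E d} (h : HasSphereWeakGradient c g),
    (∀ᵐ θ ∂(surfaceMeasure d), 0 ≤ c θ) →
    ∀ {A : Matrix (Fin d) (Fin d) ℝ} {m : ℝ}, 0 < m → ∀ {θ₀ : S d},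
    (∀ θ : S d, quadForm A θ ≤ -m + (1 / 4 + d * m) * ‖(θ : E d) - θ₀‖ ^ 2) →
    ∀ {w L : ℝ}, 0 ≤ w → w ≤ 1 → w ≤ L →
    ‖h.memLp.toLp c - evLp (quadPoly A)‖ ^ 2
      + ‖h.memLp_grad.toLp g - gradLp (quadPoly A)‖ ^ 2 ≤ L →
    m ^ 2 * w ^ gammaExp d ≤ M * L := by
  by_cases hd2 : d = 2
  · subst hd2
    obtain ⟨M, hM, H⟩ := exists_sq_le_two
    refine ⟨max 1 M, le_max_left _ _, fun {c g} h h0 {A m} hm {θ₀} hA {w L} hw hw1 hwL hL => ?_⟩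
    rw [gammaExp, if_pos rfl, Real.rpow_zero, mul_one]
    have hL0 : 0 ≤ L := hw.trans hwL
    refine (H h h0 hm (by exact_mod_cast hA)).trans ((mul_le_mul_of_nonneg_left hL hM.le).trans ?_)
    exact mul_le_mul_of_nonneg_right (le_max_right _ _) hL0
  · obtain ⟨M, hM, H⟩ := exists_sqrt_pow_le (d := d)
    refine ⟨max 1 M, le_max_left _ _, fun {c g} h h0 {A m} hm {θ₀} hA {w L} hw hw1 hwL hL => ?_⟩
    have hL0 : 0 ≤ L := hw.trans hwL
    have hNL : M * ‖h.memLp.toLp c - evLp (quadPoly A)‖ ^ 2 ≤ max 1 M * L :=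
      mul_le_mul (le_max_right _ _) (by
        linarith [sq_nonneg ‖h.memLp_grad.toLp g - gradLp (quadPoly A)‖]) (by positivity)
        (by positivity)
    -- The first alternative is interpolated with `w ≤ L`; in the second, `m²` is already controlled
    -- and `w^γ ≤ 1`.
    rcases H h.memLp h0 hm hA with h1 | h1
    · have h2 := pow_four_mul_rpow_le (Real.sqrt_nonneg m) hw
        (hwL.trans (le_mul_of_one_le_left hL0 (le_max_left 1 M))) (h1.trans hNL)
      have h3 : √m ^ 4 = m ^ 2 := by
        rw [show 4 = 2 * 2 from rfl, pow_mul, Real.sq_sqrt hm.le]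
      have h4 : ((d - 1 : ℕ) : ℝ) / ((d - 1 : ℕ) + 4) = gammaExp d := by
        rw [gammaExp, if_neg hd2, Nat.cast_sub (by omega)]
        norm_num
        ring
      rwa [h3, h4] at h2
    · refine le_trans ?_ (h1.trans hNL)
      exact mul_le_of_le_one_right (sq_nonneg m) (Real.rpow_le_one hw hw1 (gammaExp_nonneg hd))

section

variable [NeZero d] {c : S d → ℝ} {g : S d → E d} {A : Matrix (Fin d) (Fin d) ℝ} {a : ℝ}
  {b : Fin d → ℝ}

/-- The constant and linear modes of functions close to forms of trace `1/4` are small. -/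
theorem low_modes_le (hd : 2 ≤ d) {f : Lp ℝ 2 (surfaceMeasure d)} (hA : A.trace = 1 / 4)
    (ho : ∀ r ∈ PolyDeg d 2, inner ℝ (f - evLp (lowPoly A a b)) (evLp r) = 0)
    {A₀ : Matrix (Fin d) (Fin d) ℝ} (hA₀ : A₀.trace = 1 / 4) :
    a ^ 2 * ‖evLp (1 : Poly d)‖ ^ 2 ≤ ‖f - evLp (quadPoly A₀)‖ ^ 2 ∧
      ‖evLp (linPoly b)‖ ^ 2 ≤ ‖f - evLp (quadPoly A₀)‖ ^ 2 := by
  have hd0 : (0 : ℝ) < d := by exact_mod_cast NeZero.pos d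
  set f₀ := f - evLp (quadPoly A₀) with hf₀
  have hs := norm_evLp_one_sq_pos (d := d)
  -- `Q_A` and `Q_{A₀}` have equal traces, hence equal means, and both are orthogonal to linear
  -- forms. So `f - Q_{A₀}` has exactly the constant mode `a` and the linear mode `b`, and
  -- Cauchy-Schwarz bounds them.
  have e1 : inner ℝ f₀ (evLp 1) = a * ‖evLp (1 : Poly d)‖ ^ 2 := by
    have h1 := ho 1 (one_mem_polyDeg 2)
    have h2 := inner_one_quadPoly A
    have h3 := inner_one_quadPoly A₀
    have h4 := inner_one_linPoly hd b
    rw [hA, ← hA₀, ← h3] at h2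
    have h5 := mul_left_cancel₀ hd0.ne' h2
    simp only [lowPoly, map_add, map_smul, inner_sub_left, inner_add_left, inner_smul_left,
      RCLike.conj_to_real, real_inner_self_eq_norm_sq] at h1
    rw [hf₀, inner_sub_left, real_inner_comm (evLp 1) (evLp (quadPoly A₀)), ← h5]
    rw [real_inner_comm (evLp 1) (evLp (quadPoly A)), real_inner_comm (evLp 1) (evLp (linPoly b)),
      h4] at h1
    linarith
  have e2 : inner ℝ f₀ (evLp (linPoly b)) = ‖evLp (linPoly b)‖ ^ 2 := by
    have h1 := ho (linPoly b) (linPoly_mem b)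
    have h2 := inner_linPoly_quadPoly hd b A
    have h3 := inner_linPoly_quadPoly hd b A₀
    have h4 := inner_one_linPoly hd b
    simp only [lowPoly, map_add, map_smul, inner_sub_left, inner_add_left, inner_smul_left,
      RCLike.conj_to_real, real_inner_self_eq_norm_sq, h4] at h1
    rw [real_inner_comm (evLp (linPoly b)) (evLp (quadPoly A)), h2] at h1
    rw [hf₀, inner_sub_left, real_inner_comm (evLp (linPoly b)) (evLp (quadPoly A₀)), h3]
    linarith
  have c1 := real_inner_mul_inner_self_le f₀ (evLp 1)
  have c2 := real_inner_mul_inner_self_le f₀ (evLp (linPoly b))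
  rw [e1, real_inner_self_eq_norm_sq, real_inner_self_eq_norm_sq] at c1
  rw [e2, real_inner_self_eq_norm_sq, real_inner_self_eq_norm_sq] at c2
  constructor
  · refine le_of_mul_le_mul_right ?_ hs
    linarith
  · rcases eq_or_lt_of_le (sq_nonneg ‖evLp (linPoly b)‖) with h | h
    · rw [← h]; positivity
    · exact le_of_mul_le_mul_right c2 h

end

/-- Doubling `δ` makes the bound on the infimum strict, which provides a form without asking that
the infimum be attained. -/
theorem exists_near_of_distBlowUps_le {c : S d → ℝ} (hc : MemLp c 2 (surfaceMeasure d)) {δ : ℝ}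
    (hδ : 0 < δ) (h : distBlowUps c ≤ ENNReal.ofReal δ) :
    ∃ A₀ : Matrix (Fin d) (Fin d) ℝ, A₀.trace = 1 / 4 ∧
      ‖hc.toLp c - evLp (quadPoly A₀)‖ ≤ 2 * δ := by
  have hlt : distBlowUps c < ENNReal.ofReal (2 * δ) :=
    h.trans_lt (ENNReal.ofReal_lt_ofReal_iff (by positivity) |>.2 (by linarith))
  simp only [distBlowUps, iInf_lt_iff] at hlt
  obtain ⟨_, ⟨A₀, -, ht, rfl⟩, hlt⟩ := hlt
  refine ⟨A₀, ht, ?_⟩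
  have e : hc.toLp c - evLp (quadPoly A₀)
      = (hc.sub (memLp_ev (quadPoly A₀))).toLp _ := (MemLp.toLp_sub hc (memLp_ev _)).symm
  rw [e, Lp.norm_toLp]
  refine ENNReal.toReal_le_of_le_ofReal (by positivity) (le_trans (le_of_eq ?_) hlt.le)
  congr 1
  ext θ
  simp [ev_quadPoly]

/-- With `e = ε₁ w^γ ≤ 1` the linear gain is at least `2 e Γ / (n (n + 1))`. Half of it absorbs the
quadratic error by the choice of `ε₁`, and the other half is bounded below using `Γ ≥ n w`. -/
theorem gain_bound {n w γ Γ X ε₁ C : ℝ} (hn : 0 < n) (hw : 0 ≤ w) (hw1 : w ≤ 1) (hγ : 0 ≤ γ)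
    (hwΓ : n * w ≤ Γ) (hε : 0 ≤ ε₁) (hε1 : ε₁ ≤ 1) (hεC : ε₁ * C ≤ 1 / (n * (n + 1)))
    (hX : ε₁ * w ^ γ * X ≤ ε₁ * C * Γ) :
    ε₁ / (n + 1) * w ^ (1 + γ) ≤ ε₁ * w ^ γ / (n * (n + ε₁ * w ^ γ)) * (2 * Γ)
      - (ε₁ * w ^ γ) ^ 2 * X := by
  have hp0 : 0 ≤ w ^ γ := Real.rpow_nonneg hw _
  have hp1 : w ^ γ ≤ 1 := Real.rpow_le_one hw hw1 hγ
  set e := ε₁ * w ^ γ with he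
  have he0 : 0 ≤ e := mul_nonneg hε hp0
  have he1 : e ≤ 1 := mul_le_one₀ hε1 hp0 hp1
  have hΓ : 0 ≤ Γ := (mul_nonneg hn.le hw).trans hwΓ
  have h1 : e * (1 / (n * (n + 1)) * (2 * Γ)) ≤ e / (n * (n + e)) * (2 * Γ) := by
    rw [div_eq_mul_one_div e, mul_assoc e]
    refine mul_le_mul_of_nonneg_left (mul_le_mul_of_nonneg_right ?_ (by positivity)) he0
    exact one_div_le_one_div_of_le (by positivity) (by nlinarith)
  have h2 : e ^ 2 * X ≤ e * (1 / (n * (n + 1)) * Γ) := by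
    rw [pow_two, mul_assoc]
    exact mul_le_mul_of_nonneg_left (hX.trans (mul_le_mul_of_nonneg_right hεC hΓ)) he0
  have h3 : ε₁ / (n + 1) * w ^ (1 + γ) = e * (1 / (n * (n + 1)) * (n * w)) := by
    rw [Real.rpow_add_of_nonneg hw zero_le_one hγ, Real.rpow_one, he]
    field_simp
  have h4 : e * (1 / (n * (n + 1)) * (n * w)) ≤ e * (1 / (n * (n + 1)) * Γ) :=
    mul_le_mul_of_nonneg_left (mul_le_mul_of_nonneg_left hwΓ (by positivity)) he0
  rw [h3]
  linarith

/-- `P` stands for `w^γ`, `X` for `‖φ‖² + ‖∇φ‖²`, `t` for `‖Q_T‖²` and `D` for the dimension. Only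
the `m²` part of `t` needs the factor `P` to be comparable to `Γ`; elsewhere `P ≤ 1` suffices. -/
theorem error_bound {X t m κ s Γ M D P : ℝ} (hP0 : 0 ≤ P) (hP1 : P ≤ 1) (hD : 0 ≤ D) (hs : 0 ≤ s)
    (hΓ : 0 ≤ Γ) (hX : X ≤ 4 * Γ) (hX0 : 0 ≤ X) (ht : t ≤ (D * (m + κ)) ^ 2 * s)
    (hm : m ^ 2 * P ≤ M * (18 * Γ)) (hκ : κ ^ 2 * s ≤ 4 * Γ) :
    P * (X + (1 + 2 * D) * t) ≤ (4 + (1 + 2 * D) * (2 * D ^ 2) * (18 * s * M + 4)) * Γ := by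
  have t1 : t ≤ 2 * D ^ 2 * (m ^ 2 * s + 4 * Γ) := by
    have h1 : (m + κ) ^ 2 ≤ 2 * m ^ 2 + 2 * κ ^ 2 := by nlinarith [sq_nonneg (m - κ)]
    have h2 : (m + κ) ^ 2 * s ≤ 2 * (m ^ 2 * s + 4 * Γ) := by
      have := mul_le_mul_of_nonneg_right h1 hs
      linarith
    have := mul_le_mul_of_nonneg_left h2 (sq_nonneg D)
    rw [mul_pow] at ht
    linarith
  have t2 : P * (m ^ 2 * s + 4 * Γ) ≤ (18 * s * M + 4) * Γ := by
    have h1 := mul_le_mul_of_nonneg_right hm hs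
    have h2 : P * Γ ≤ Γ := mul_le_of_le_one_left hΓ hP1
    linarith
  have t3 := mul_le_mul_of_nonneg_left t1 hP0
  have t4 := mul_le_mul_of_nonneg_left t2 (by positivity : 0 ≤ 2 * D ^ 2)
  have t5 : P * t ≤ 2 * D ^ 2 * ((18 * s * M + 4) * Γ) := by linarith
  have t6 := mul_le_mul_of_nonneg_left t5 (by positivity : 0 ≤ 1 + 2 * D)
  have t7 : P * X ≤ 4 * Γ := (mul_le_of_le_one_left hX0 hP1).trans hX
  linarith

section

variable [NeZero d] {c : S d → ℝ} {g : S d → E d} {A : Matrix (Fin d) (Fin d) ℝ} {a : ℝ}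
  {b : Fin d → ℝ}

/-- All errors are controlled by the energy of the high modes. -/
theorem high_modes_bounds (hd : 2 ≤ d) (h : HasSphereWeakGradient c g)
    (ho : ∀ r ∈ PolyDeg d 2,
      inner ℝ (h.memLp.toLp c - evLp (lowPoly A a b)) (evLp r) = 0) {Γ : ℝ}
    (hΓ : Γ = ‖h.memLp_grad.toLp g - gradLp (lowPoly A a b)‖ ^ 2
        - 2 * d * ‖h.memLp.toLp c - evLp (lowPoly A a b)‖ ^ 2)
    (hlow : 2 * d * a ^ 2 * ‖evLp (1 : Poly d)‖ ^ 2 + (d + 1) * ‖evLp (linPoly b)‖ ^ 2 ≤ Γ) :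
    ‖h.memLp.toLp c - evLp (lowPoly A a b)‖ ^ 2
        + ‖h.memLp_grad.toLp g - gradLp (lowPoly A a b)‖ ^ 2 ≤ 4 * Γ ∧
      ‖h.memLp.toLp c - evLp (quadPoly A)‖ ^ 2
        + ‖h.memLp_grad.toLp g - gradLp (quadPoly A)‖ ^ 2 ≤ 18 * Γ ∧
      (|a| + ‖(WithLp.toLp 2 b : E d)‖) ^ 2 * ‖evLp (1 : Poly d)‖ ^ 2 ≤ 4 * Γ := by
  have hd2 : (2 : ℝ) ≤ d := by exact_mod_cast hd
  have hgap := spectral_gap_sub h ho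
  set p := lowPoly A a b with hp
  set x := ‖h.memLp.toLp c - evLp p‖ ^ 2 with hx
  set y := ‖h.memLp_grad.toLp g - gradLp p‖ ^ 2 with hy
  set s := ‖evLp (1 : Poly d)‖ ^ 2 with hs
  set l := ‖evLp (linPoly b)‖ ^ 2 with hl
  have hx0 : 0 ≤ x := sq_nonneg _
  have hs0 : 0 ≤ s := sq_nonneg _
  have hl0 : 0 ≤ l := sq_nonneg _
  have has : 0 ≤ a ^ 2 * s := by positivity
  -- The gap gives `Γ ≥ (3(d + 1) - 2d) x = (d + 3) x`; then `y = Γ + 2dx ≤ 3Γ`. The numerical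
  -- constants in the conclusion are not sharp.
  have h1 : d * x ≤ Γ := by nlinarith
  have h2 : 4 * (a ^ 2 * s) ≤ Γ := by nlinarith
  have h3 : d * l ≤ Γ := by nlinarith
  have h4 : 2 * x ≤ Γ := by nlinarith
  have h5 : 2 * l ≤ Γ := by nlinarith
  have hy3 : y ≤ 3 * Γ := by linarith
  have e1 : h.memLp.toLp c - evLp (quadPoly A)
      = (h.memLp.toLp c - evLp p) + (a • evLp 1 + evLp (linPoly b)) := by
    rw [hp, lowPoly, map_add, map_add, map_smul]; abel
  have e2 : h.memLp_grad.toLp g - gradLp (quadPoly A)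
      = (h.memLp_grad.toLp g - gradLp p) + gradLp (linPoly b) := by
    rw [hp, lowPoly, map_add, map_add, map_smul, gradLp_one, smul_zero]; abel
  have n1 := norm_add_sq_le_two_mul (h.memLp.toLp c - evLp p) (a • evLp 1 + evLp (linPoly b))
  have n2 := norm_add_sq_le_two_mul (a • evLp (1 : Poly d)) (evLp (linPoly b))
  have n3 := norm_add_sq_le_two_mul (h.memLp_grad.toLp g - gradLp p) (gradLp (linPoly b))
  have n4 := inner_gradLp_poly_linPoly (linPoly b) b
  rw [real_inner_self_eq_norm_sq, real_inner_self_eq_norm_sq] at n4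
  rw [norm_smul, mul_pow, Real.norm_eq_abs, sq_abs] at n2
  rw [← e1] at n1
  rw [← e2, n4] at n3
  have n5 := norm_evLp_linPoly_sq b
  refine ⟨by linarith, by linarith, ?_⟩
  set β := ‖(WithLp.toLp 2 b : E d)‖
  have n6 : (|a| + β) ^ 2 ≤ 2 * a ^ 2 + 2 * β ^ 2 := by
    nlinarith [sq_nonneg (|a| - β), sq_abs a]
  have n7 := mul_le_mul_of_nonneg_right n6 hs0
  linarith

theorem exists_competitor (hd : 2 ≤ d) {M : ℝ} (hM1 : 1 ≤ M)
    (hM : ∀ {m : ℝ}, 0 < m → ∀ {θ₀ : S d},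
      (∀ θ : S d, quadForm A θ ≤ -m + (1 / 4 + d * m) * ‖(θ : E d) - θ₀‖ ^ 2) →
      ∀ {w L : ℝ}, 0 ≤ w → w ≤ 1 → w ≤ L →
      ∀ (h : HasSphereWeakGradient c g), ‖h.memLp.toLp c - evLp (quadPoly A)‖ ^ 2
      + ‖h.memLp_grad.toLp g - gradLp (quadPoly A)‖ ^ 2 ≤ L → m ^ 2 * w ^ gammaExp d ≤ M * L)
    (h : HasSphereWeakGradient c g) (hc : ∀ᵐ θ ∂(surfaceMeasure d), 0 ≤ c θ)
    (hAs : A.IsSymm) (hA : A.trace = 1 / 4)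
    (ho : ∀ r ∈ PolyDeg d 2,
      inner ℝ (h.memLp.toLp c - evLp (lowPoly A a b)) (evLp r) = 0)
    (hsmall : 4 * d * (|a| + ‖(WithLp.toLp 2 b : E d)‖) ≤ 1)
    (hw : 0 ≤ weissEnergy (homogExt c) - theta d) (hw1 : weissEnergy (homogExt c) - theta d ≤ 1)
    {ε₁ : ℝ} (hε : 0 ≤ ε₁) (hε1 : ε₁ ≤ 1)
    (hεC : ε₁ * (4 + (1 + 2 * d) * (2 * d ^ 2) * (18 * ‖evLp (1 : Poly d)‖ ^ 2 * M + 4))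
      ≤ 1 / (((d : ℝ) + 2) * (d + 2 + 1))) :
    ∃ u : E d → ℝ, MemH1Ball u ∧ (∀ᵐ x ∂(ballMeasure d), 0 ≤ u x) ∧ HasTrace u c ∧
      weissEnergy u ≤ weissEnergy (homogExt c)
        - ε₁ / (d + 2 + 1) * (weissEnergy (homogExt c) - theta d) ^ (1 + gammaExp d) := by
  have hexc := weissEnergy_homogExt_sub_theta hd h hc hA ho
  set w := weissEnergy (homogExt c) - theta d with hwdef
  set Γ := ‖h.memLp_grad.toLp g - gradLp (lowPoly A a b)‖ ^ 2
        - 2 * d * ‖h.memLp.toLp c - evLp (lowPoly A a b)‖ ^ 2 with hΓ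
  have hd0 : (0 : ℝ) ≤ d := Nat.cast_nonneg d
  have hdw : 0 ≤ (d + 2) * w := by positivity
  -- The constant and linear modes enter the excess with a negative sign, so `w ≥ 0` bounds them by
  -- `Γ`.
  obtain ⟨b1, b2, b3⟩ := high_modes_bounds hd h ho hΓ (by linarith)
  set s := ‖evLp (1 : Poly d)‖ ^ 2 with hs
  have hs0 : 0 ≤ s := sq_nonneg _
  have hwΓ : (d + 2) * w ≤ Γ := by
    have : 0 ≤ 2 * d * a ^ 2 * s := by positivity
    have : 0 ≤ (d + 1) * ‖evLp (linPoly b)‖ ^ 2 := by positivity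
    linarith
  have hΓ0 : 0 ≤ Γ := hdw.trans hwΓ
  have hw18 : w ≤ 18 * Γ := by nlinarith
  obtain ⟨m, hm, hneg, hcorr⟩ := exists_nonneg_correction hAs hA
  have hmw : m ^ 2 * w ^ gammaExp d ≤ M * (18 * Γ) := by
    rcases eq_or_lt_of_le hm with h0 | h0
    · rw [← h0]
      have : 0 ≤ M * (18 * Γ) := by positivity
      simpa using this
    · rcases hneg with h1 | ⟨θ₀, h1⟩
      · exact absurd h1 h0.ne'
      · exact hM h0 h1 hw hw1 hw18 h b2
  obtain ⟨T, hT, hpos, hTb⟩ := hcorr a _ b (abs_ev_linPoly_le b) hsmall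
  set κ := |a| + ‖(WithLp.toLp 2 b : E d)‖
  have hTn := norm_evLp_sq_le hTb
  have hγ := gammaExp_nonneg hd
  have hp0 : 0 ≤ w ^ gammaExp d := Real.rpow_nonneg hw _
  have hp1 : w ^ gammaExp d ≤ 1 := Real.rpow_le_one hw hw1 hγ
  set p := lowPoly A a b with hp
  -- This exponent makes `e ‖Q_T‖²` at most a small multiple of `Γ`, because `m² w^γ` is bounded by
  -- a multiple of `Γ`.
  set e := ε₁ * w ^ gammaExp d with he
  have he0 : 0 ≤ e := mul_nonneg hε hp0
  have hle := weissEnergy_competitor_le hd h hc (lowPoly_mem A a b) ho hT hpos he0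
  have hX : e * (‖h.memLp.toLp c - evLp p‖ ^ 2 + ‖h.memLp_grad.toLp g - gradLp p‖ ^ 2
      + (1 + 2 * d) * ‖evLp (quadPoly T)‖ ^ 2)
      ≤ ε₁ * (4 + (1 + 2 * d) * (2 * d ^ 2) * (18 * s * M + 4)) * Γ := by
    rw [he, mul_assoc, mul_assoc]
    refine mul_le_mul_of_nonneg_left ?_ hε
    exact error_bound hp0 hp1 hd0 hs0 hΓ0 b1 (by positivity) hTn hmw b3
  have hgain := gain_bound (by positivity : 0 < (d : ℝ) + 2) hw hw1 hγ hwΓ hε hε1 hεC hX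
  have hG := hasGreen_competitor (hasSphereWeakGradient_ev (p + quadPoly T))
    (h.sub (hasSphereWeakGradient_ev (p + quadPoly T))) he0
  have htr := hG.hasTrace
  have hsum : (fun θ : S d => ev (p + quadPoly T) θ + (c θ - ev (p + quadPoly T) θ)) = c := by
    funext θ; ring
  rw [hsum] at htr
  refine ⟨_, ⟨_, hG.hasWeakGradient⟩, competitor_nonneg he0 hpos ?_, htr, hle.trans ?_⟩
  · filter_upwards [hc] with θ hθ
    rwa [add_sub_cancel]
  · linarith

end

theorem weiss_epiperimetric_inequality (hd : 2 ≤ d) :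
    ∃ δ : ℝ, 0 < δ ∧ ∃ ε : ℝ, 0 < ε ∧
      ∀ c : S d → ℝ, MemH1Sphere c → (∀ᵐ θ ∂(surfaceMeasure d), 0 ≤ c θ) →
        distBlowUps c ≤ ENNReal.ofReal δ →
        0 ≤ weissEnergy (homogExt c) - theta d → weissEnergy (homogExt c) - theta d ≤ 1 →
        ∃ u : E d → ℝ, MemH1Ball u ∧ (∀ᵐ x ∂(ballMeasure d), 0 ≤ u x) ∧ HasTrace u c ∧
          weissEnergy u ≤ weissEnergy (homogExt c)
            - ε * (weissEnergy (homogExt c) - theta d) ^ (1 + gammaExp d) := by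
  have : NeZero d := ⟨by omega⟩
  obtain ⟨M, hM1, hM⟩ := exists_sq_mul_rpow_le hd
  have hs := norm_evLp_one_sq_pos (d := d)
  set s := ‖evLp (1 : Poly d)‖ ^ 2 with hsdef
  have hd0 : (0 : ℝ) < d := by exact_mod_cast NeZero.pos d
  set C := 4 + (1 + 2 * (d : ℝ)) * (2 * d ^ 2) * (18 * s * M + 4) with hC
  have hC0 : 0 < C := by positivity
  -- Here `C` is the constant of `error_bound` with `D = d`; the choice lets half of the linear gain
  -- absorb the error.
  set ε₁ := min 1 (1 / (((d : ℝ) + 2) * (d + 2 + 1)) / C) with hε₁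
  have hε0 : 0 < ε₁ := lt_min one_pos (by positivity)
  have hεC : ε₁ * C ≤ 1 / (((d : ℝ) + 2) * (d + 2 + 1)) :=
    (le_div_iff₀ hC0).1 (min_le_right _ _)
  -- The low modes satisfy `(|a| + |b|)² s ≤ 8(1 + d) δ²`; multiplying by `16 d²` gives exactly `s`
  -- on the right, that is `4d (|a| + |b|) ≤ 1`, as the correction requires.
  set δ := √(s / (128 * d ^ 2 * (1 + d))) with hδ
  have hδ2 : δ ^ 2 = s / (128 * d ^ 2 * (1 + d)) := Real.sq_sqrt (by positivity)
  have hδ0 : 0 < δ := Real.sqrt_pos.2 (by positivity)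
  refine ⟨δ, hδ0, ε₁ / (d + 2 + 1), by positivity, fun c ⟨g, h⟩ hc hdist hw hw1 => ?_⟩
  obtain ⟨A₀, hA₀, hnear⟩ := exists_near_of_distBlowUps_le h.memLp hδ0 hdist
  obtain ⟨A, a, b, hAs, hA, ho⟩ := exists_decomposition (h.memLp.toLp c)
  obtain ⟨h1, h2⟩ := low_modes_le hd hA ho hA₀
  refine exists_competitor hd hM1 (fun hm _ hA _ _ hw hw1 hwL h => hM h hc hm hA hw hw1 hwL)
    h hc hAs hA ho ?_ hw hw1 hε0.le (min_le_left _ _) hεC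
  have h3 : ‖h.memLp.toLp c - evLp (quadPoly A₀)‖ ^ 2 ≤ (2 * δ) ^ 2 :=
    pow_le_pow_left₀ (norm_nonneg _) hnear 2
  have h4 := norm_evLp_linPoly_sq b
  set β := ‖(WithLp.toLp 2 b : E d)‖
  have h5 : (|a| + β) ^ 2 ≤ 2 * a ^ 2 + 2 * β ^ 2 := by
    nlinarith [sq_nonneg (|a| - β), sq_abs a]
  have h6 : (|a| + β) ^ 2 * s ≤ 8 * (1 + d) * δ ^ 2 := by
    have h7 := mul_le_mul_of_nonneg_right h5 hs.le
    have h8 := mul_le_mul_of_nonneg_left (h2.trans h3) hd0.le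
    linarith
  have h7 : (4 * d * (|a| + β)) ^ 2 ≤ 1 := by
    refine le_of_mul_le_mul_right ?_ hs
    have h8 := mul_le_mul_of_nonneg_left h6 (by positivity : 0 ≤ 16 * (d : ℝ) ^ 2)
    have h9 : 16 * (d : ℝ) ^ 2 * (8 * (1 + d) * δ ^ 2) = s := by
      rw [hδ2]; field_simp; norm_num
    linarith
  exact (abs_le_one_iff_mul_self_le_one.2 (by rwa [← pow_two])) |> fun h => (abs_le.1 h).2

end Obstacle

end

theorem theorem1 (d : ℕ) (hd : 2 ≤ d) :
    ∃ δ : ℝ, 0 < δ ∧ ∃ ε : ℝ, 0 < ε ∧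
      ∀ c : Obstacle.S d → ℝ,
        Obstacle.MemH1Sphere c →
        (∀ᵐ θ ∂(Obstacle.surfaceMeasure d), 0 ≤ c θ) →
        Obstacle.distBlowUps c ≤ ENNReal.ofReal δ →
        0 ≤ Obstacle.weissEnergy (Obstacle.homogExt c) - Obstacle.theta d →
        Obstacle.weissEnergy (Obstacle.homogExt c) - Obstacle.theta d ≤ 1 →
        ∃ h : Obstacle.E d → ℝ,
          Obstacle.MemH1Ball h ∧
          (∀ᵐ x ∂(Obstacle.ballMeasure d), 0 ≤ h x) ∧
          Obstacle.HasTrace h c ∧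
          Obstacle.weissEnergy h ≤ Obstacle.weissEnergy (Obstacle.homogExt c)
            - ε * (Obstacle.weissEnergy (Obstacle.homogExt c) - Obstacle.theta d)
                ^ (1 + Obstacle.gammaExp d) :=
  Obstacle.weiss_epiperimetric_inequality hd
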